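/- Let $P$ be a simple polygon in the Euclidean plane with vertices $v_1,\dots,v_n$ ($n\ge 3$) in boundary order. Two points of $P$ are mutually visible if the segment between them does not meet the exterior of $P$, and the visibility graph $G$ of $P$ has the vertices of $P$ as its vertices, two distinct ones being adjacent iff they are mutually visible. A chord (internal edge) of $P$ is an edge of $G$ that is not a boundary edge of $P$. A chord $uv$ crosses a chord $xy$ if the two segments meet and $u,v$ lie on different sides of $xy$, i.e. one in each of the two open boundary chains between $x$ and $y$. A bottleneck pair of $G$ is a pair of adjacent vertices whose removal disconnects $G$. $P$ is reduced if each of its chords is crossed by another chord. The reduced subpolygons of $P$ are the reduced polygons obtained from $P$ by repeatedly dividing the current polygon along a chord of it that is crossed by none of its chords. The reduced subgraphs of $G$ are the graphs obtained as follows: start with $G$; as long as a bottleneck pair $x,y$ of $G$ lies in the current piece and disconnects it, remove $x,y$ from the piece and replace it by the pieces induced on $C\cup\{x,y\}$, one for each connected component $C$ that is left (each component receives its own copy of $x,y$); the pieces that no bottleneck pair of $G$ disconnects are the reduced subgraphs. Then the following hold. 1. A pair $\{x,y\}$ of vertices is a bottleneck pair of $G$ if and only if $xy$ is a chord of $P$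 that no chord of $P$ crosses. 2. If moreover no chord of $P$ passes through a third vertex of $P$ (for instance if no three vertices are collinear), then $\{x,y\}$ is a bottleneck pair of $G$ if and only if $xy$ is a chord of $P$ and the open segment $xy$ is disjoint from the open segment $uv$ for every other chord $uv$ of $P$. 3. Every reduced subpolygon of $P$ is a simple polygon; each reduced subgraph of $G$ is the visibility graph of some reduced subpolygon of $P$ (with the same vertices), and each reduced subpolygon of $P$ has a reduced subgraph of $G$ as its visibility graph. -/

import Mathlib

/-- The Euclidean plane. -/
abbrev Plane : Type := EuclideanSpace ℝ (Fin 2)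

namespace Polygon

variable {n : ℕ}

/-- A simple polygon: at least three vertices, pairwise distinct; two consecutive edges meet
exactly in their common vertex, and any two other distinct edges are disjoint.
The successor of the vertex `i` on the boundary is `finRotate n i`. -/
structure IsSimple (P : Polygon Plane n) : Prop where
  three_le : 3 ≤ n
  injective : Function.Injective P.vertices
  consecutive : ∀ i : Fin n,
    P.edgeSet ℝ i ∩ P.edgeSet ℝ (finRotate n i) = {P (finRotate n i)}
  nonconsecutive : ∀ i j : Fin n, j ≠ i → j ≠ finRotate n i → i ≠ finRotate n j →
    Disjoint (P.edgeSet ℝ i) (P.edgeSet ℝ j)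

/-- The exterior of a polygon: the points off the boundary whose connected component in the
complement of the boundary is unbounded. -/
def exterior (P : Polygon Plane n) : Set Plane :=
  {z | z ∈ (P.boundary ℝ)ᶜ ∧
    ¬ Bornology.IsBounded (connectedComponentIn (P.boundary ℝ)ᶜ z)}

/-- Two points are mutually visible if the segment between them misses the exterior. -/
def MutuallyVisible (P : Polygon Plane n) (p q : Plane) : Prop :=
  Disjoint (segment ℝ p q) P.exterior

/-- The visibility graph: two distinct vertices are adjacent iff they are mutually visible. -/
def visibilityGraph (P : Polygon Plane n) : SimpleGraph (Fin n) where
  Adj i j := i ≠ j ∧ P.MutuallyVisible (P i) (P j)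
  symm := ⟨fun i j h => ⟨h.1.symm, by
    have h2 := h.2
    unfold MutuallyVisible at h2 ⊢
    rwa [segment_symm]⟩⟩
  loopless := ⟨fun _ h => h.1 rfl⟩

/-- An internal edge (chord): a visibility edge that is not a boundary edge of the polygon. -/
def IsChord (P : Polygon Plane n) (x y : Fin n) : Prop :=
  P.visibilityGraph.Adj x y ∧ y ≠ finRotate n x ∧ x ≠ finRotate n y

/-- The chord `uv` crosses the chord `xy`: the segments meet, and `u`, `v` lie on different
sides of `xy`, that is, one in each of the two open boundary chains between `x` and `y`. -/
def Crosses (P : Polygon Plane n) (u v x y : Fin n) : Prop :=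
  (segment ℝ (P u) (P v) ∩ segment ℝ (P x) (P y)).Nonempty ∧
    ((sbtw x u y ∧ sbtw y v x) ∨ (sbtw x v y ∧ sbtw y u x))

/-- A chord that is crossed by no chord. -/
def IsUncrossedChord (P : Polygon Plane n) (x y : Fin n) : Prop :=
  P.IsChord x y ∧ ∀ u v : Fin n, P.IsChord u v → ¬ P.Crosses u v x y

/-- A polygon is reduced if each of its chords is crossed by another chord. -/
def IsReduced (P : Polygon Plane n) : Prop :=
  ∀ x y : Fin n, P.IsChord x y → ∃ u v : Fin n, P.IsChord u v ∧ P.Crosses u v x y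

/-- The polygon whose vertices are the vertices of `P` with index in `S`, in the order in
which they occur on the boundary of `P`. -/
def sub (P : Polygon Plane n) (S : Finset (Fin n)) : Polygon Plane S.card :=
  ⟨fun a => P (S.orderEmbOfFin rfl a)⟩

/-- The vertex sets of the subpolygons which arise from `P` by repeatedly dividing along an
uncrossed chord `ab` of the current subpolygon: the part that is kept has as its vertices
`a`, `b` and the vertices between `a` and `b` in the cyclic order. (The other part is obtained
by interchanging `a` and `b`.) -/
inductive IsSubpolygon (P : Polygon Plane n) : Finset (Fin n) → Prop
  | whole : IsSubpolygon P Finset.univ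
  | divide (S T : Finset (Fin n)) (a b : Fin S.card) :
      IsSubpolygon P S → (P.sub S).IsUncrossedChord a b →
      (∀ w : Fin n,
        w ∈ T ↔ w ∈ S ∧ btw (S.orderEmbOfFin rfl a) w (S.orderEmbOfFin rfl b)) →
      IsSubpolygon P T

/-- The reduced subpolygons of `P` (given by their vertex sets): the subpolygons that arise by
dividing along uncrossed chords and that are reduced. -/
def IsReducedSubpolygon (P : Polygon Plane n) (S : Finset (Fin n)) : Prop :=
  P.IsSubpolygon S ∧ (P.sub S).IsReduced

/-- The subgraph `H` of the visibility graph of `P` is the visibility graph of the polygon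
`P.sub S`, the vertices of `P.sub S` being identified with those of `P`. -/
def IsVisibilityGraphOfSub (P : Polygon Plane n) (S : Finset (Fin n))
    (H : P.visibilityGraph.Subgraph) : Prop :=
  H.verts = (S : Set (Fin n)) ∧
    ∀ a b : Fin S.card, H.Adj (S.orderEmbOfFin rfl a) (S.orderEmbOfFin rfl b) ↔
      (P.sub S).visibilityGraph.Adj a b

end Polygon

namespace SimpleGraph

variable {V : Type*}

/-- A bottleneck pair: two adjacent vertices whose removal disconnects the graph. -/
def IsBottleneckPair (G : SimpleGraph V) (x y : V) : Prop :=
  G.Adj x y ∧ ¬ (G.induce ({x, y}ᶜ : Set V)).Preconnected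

/-- The vertex sets obtained from `G` by successively cutting at bottleneck pairs `x, y` of `G`:
`x` and `y` are removed from the current piece, and each connected component that is left
receives a copy of `x` and `y` back. -/
inductive IsPiece (G : SimpleGraph V) : Set V → Prop
  | whole : IsPiece G Set.univ
  | cut (S : Set V) (x y : V) (C : (G.induce (S \ {x, y})).ConnectedComponent) :
      IsPiece G S → G.IsBottleneckPair x y → x ∈ S → y ∈ S →
      IsPiece G ((Subtype.val '' C.supp) ∪ {x, y})

/-- A reduced subgraph of `G`: what is left when this has been done with every bottleneck pair,
that is, the subgraph of `G` induced on a piece which no bottleneck pair of `G` disconnects. -/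
def IsReducedSubgraph (G : SimpleGraph V) (H : G.Subgraph) : Prop :=
  ∃ S : Set V, G.IsPiece S ∧
    (∀ x y : V, G.IsBottleneckPair x y → x ∈ S → y ∈ S →
      (G.induce (S \ {x, y})).Preconnected) ∧
    H = (⊤ : G.Subgraph).induce S

end SimpleGraph

/-! The boundary of `P` is a Hamiltonian cycle of the visibility graph. Removing two vertices x, y
leaves two boundary arcs, each connected, so the rest is disconnected iff both arcs are nonempty and
no visibility edge joins them. A chord crossing xy is such an edge, hence a bottleneck pair is an
uncrossed chord. For the converse, visible vertices u, v in different arcs of an uncrossed chord xy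
must be shown to give a segment that really meets xy.

This holds if xy is a diagonal, that is, if its open segment misses the boundary: it then divides
`P` into two simple polygons whose bodies cover that of `P` and meet only in xy, so a segment inside
`P` from one to the other hits xy. A general chord may pass through vertices or run along edges, but
an uncrossed one does not. Indeed, a diagonal exists whenever n ≥ 4, and induction on n shows that
two non-consecutive vertices are joined by a diagonal or separated by one
(`IsSimple.isDiagonal_or_separated`). A chord meets every diagonal that separates its ends, so in
the second case it is crossed.

The topology rests on winding numbers. The total angle `wind` is a multiple of 2π, locally constant
off the boundary, zero far away, and changes by 2π across an edge. The boundary is connected and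
locally two-sided, so every component of its complement accumulates at the whole boundary and
contains one of the two sides of a fixed edge. The jump tells these apart: off the boundary, the
exterior is where `wind` vanishes, and elsewhere it is ±2π (`IsSimple.jordan`). Under division along
a diagonal winding numbers add, and ±2π is not a sum of two numbers ±2π, so the two parts do not
overlap.

For the second claim, a chord meeting an uncrossed chord stays in one of the two parts, of which the
uncrossed chord is an edge. It cannot pass that edge transversally, so the two are parallel, and
without third vertices on chords they coincide. For the third claim, every subpolygon inherits the
visibility graph and the uncrossed chords of `P` (`IsFaithful`), so dividing a subpolygon and
cutting a piece at a bottleneck pair are the same operation, except that a pair consecutive on the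
subpolygon cuts nothing off. -/

namespace Polygon

open Set Filter Topology

/-! ### The winding number of a polygon -/

variable {n : ℕ}

/-- The plane as the complex numbers. -/
noncomputable def toC : Plane ≃ₗᵢ[ℝ] ℂ := Complex.orthonormalBasisOneI.repr.symm

/-- The angle under which the segment from `p` to `q` is seen from `z`. -/
noncomputable def ang (p q z : Plane) : ℝ := Complex.arg (toC (q - z) / toC (p - z))

/-- The total angle by which the boundary of a polygon winds around a point. -/
noncomputable def wind (P : Polygon Plane n) (z : Plane) : ℝ :=
  ∑ i, ang (P i) (P (finRotate n i)) z

lemma toC_ne_zero {v : Plane} : toC v ≠ 0 ↔ v ≠ 0 := map_ne_zero_iff toC toC.injective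

lemma edgeSet_eq (P : Polygon Plane n) (i : Fin n) :
    P.edgeSet ℝ i = segment ℝ (P i) (P (finRotate n i)) := by
  rw [edgeSet, affineSegment_eq_segment]

lemma mem_boundary (P : Polygon Plane n) {z : Plane} :
    z ∈ P.boundary ℝ ↔ ∃ i, z ∈ segment ℝ (P i) (P (finRotate n i)) := by
  simp [boundary, edgeSet_eq]

lemma vertex_mem_boundary (P : Polygon Plane n) (i : Fin n) : P i ∈ P.boundary ℝ :=
  (mem_boundary P).2 ⟨i, left_mem_segment _ _ _⟩

lemma isCompact_segment (p q : Plane) : IsCompact (segment ℝ p q) := by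
  rw [segment_eq_image_lineMap]
  exact isCompact_Icc.image AffineMap.lineMap_continuous

lemma isClosed_segment (p q : Plane) : IsClosed (segment ℝ p q) := (isCompact_segment p q).isClosed

lemma isCompact_boundary (P : Polygon Plane n) : IsCompact (P.boundary ℝ) := by
  unfold boundary
  exact isCompact_iUnion fun i => by rw [edgeSet_eq]; exact isCompact_segment _ _

lemma isClosed_boundary (P : Polygon Plane n) : IsClosed (P.boundary ℝ) :=
  (isCompact_boundary P).isClosed

/-- The ratio is a nonpositive real only if the vectors from `z` to the end points are opposite or
one of them vanishes, that is, only on the segment. So off the segment the branch cut of `arg` is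
avoided. -/
lemma ratio_mem_slitPlane {p q z : Plane} (hz : z ∉ segment ℝ p q) :
    toC (q - z) / toC (p - z) ∈ Complex.slitPlane := by
  by_contra h
  rw [Complex.mem_slitPlane_iff] at h
  push Not at h
  obtain ⟨h1, h2⟩ := h
  have hpz : p - z ≠ 0 := by
    intro h; apply hz
    rw [← sub_eq_zero.1 h]; exact left_mem_segment _ _ _
  have ha : toC (p - z) ≠ 0 := toC_ne_zero.2 hpz
  set r : ℝ := -(toC (q - z) / toC (p - z)).re with hr
  have hb : toC (q - z) = toC ((-r) • (p - z)) := by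
    have : toC (q - z) / toC (p - z) = ((-r : ℝ) : ℂ) := by
      apply Complex.ext <;> simp only [hr, h2, Complex.ofReal_re, Complex.ofReal_im, neg_neg]
    rw [div_eq_iff ha] at this
    rw [this, map_smul, Complex.real_smul]
  have hb' := toC.injective hb
  apply hz
  have hr0 : 0 ≤ r := by linarith
  rw [segment_eq_image_lineMap]
  refine ⟨1 / (1 + r), ⟨by positivity, ?_⟩, ?_⟩
  · rw [div_le_one (by positivity)]; linarith
  · have hq : q = z + (-r) • (p - z) := by rw [← hb']; abel
    have h0 : (1 + r) ≠ 0 := by positivity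
    rw [AffineMap.lineMap_apply_module, hq]
    have e : 1 - 1 / (1 + r) = r / (1 + r) := by field_simp; ring
    rw [e]
    have e1 : (r / (1 + r)) = (1 / (1 + r)) * r := by ring
    have e2 : (1 / (1 + r)) * r + 1 / (1 + r) = 1 := by field_simp; ring
    rw [e1]
    generalize 1 / (1 + r) = c at *
    calc (c * r) • p + c • (z + -r • (p - z)) = (c * r + c) • z := by module
      _ = z := by rw [e2, one_smul]

lemma ratio_im_eq_zero {p q z : Plane} (hz : z ∈ segment ℝ p q) :
    (toC (q - z) / toC (p - z)).im = 0 := by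
  rw [segment_eq_image_lineMap] at hz
  obtain ⟨s, -, rfl⟩ := hz
  have e1 : q - AffineMap.lineMap p q s = (1 - s) • (q - p) := by
    rw [AffineMap.lineMap_apply_module]; module
  have e2 : p - AffineMap.lineMap p q s = (-s) • (q - p) := by
    rw [AffineMap.lineMap_apply_module]; module
  rw [e1, e2, map_smul, map_smul, Complex.real_smul, Complex.real_smul, mul_div_mul_comm]
  by_cases h : toC (q - p) = 0
  · simp [h]
  · rw [div_self h, mul_one, ← Complex.ofReal_div, Complex.ofReal_im]

lemma toC_sub_ne_zero {p z : Plane} (h : p ≠ z) : toC (p - z) ≠ 0 :=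
  toC_ne_zero.2 (sub_ne_zero.2 h)

lemma ne_of_notMem_segment_left {p q z : Plane} (hz : z ∉ segment ℝ p q) : p ≠ z := by
  rintro rfl; exact hz (left_mem_segment _ _ _)

lemma ne_of_notMem_segment_right {p q z : Plane} (hz : z ∉ segment ℝ p q) : q ≠ z := by
  rintro rfl; exact hz (right_mem_segment _ _ _)

lemma continuousAt_ang {p q z : Plane} (hz : z ∉ segment ℝ p q) : ContinuousAt (ang p q) z := by
  unfold ang
  have h1 := ratio_mem_slitPlane hz
  have h2 := toC_sub_ne_zero (ne_of_notMem_segment_left hz)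
  refine ContinuousAt.comp (f := fun z => toC (q - z) / toC (p - z))
    (Complex.continuousAt_arg h1) ?_
  refine ContinuousAt.div ?_ ?_ h2
  · exact (toC.continuous.comp (continuous_const.sub continuous_id)).continuousAt
  · exact (toC.continuous.comp (continuous_const.sub continuous_id)).continuousAt

/-- Off the branch cut, inversion negates `arg`. This cancels a dividing diagonal, which the two
parts traverse in opposite directions. -/
lemma ang_add_ang_swap {p q z : Plane} (hz : z ∉ segment ℝ p q) : ang p q z + ang q p z = 0 := by
  unfold ang
  have h : toC (p - z) / toC (q - z) = (toC (q - z) / toC (p - z))⁻¹ := by rw [inv_div]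
  have h1 := (Complex.mem_slitPlane_iff_arg.1 (ratio_mem_slitPlane hz)).1
  rw [h, Complex.arg_inv, if_neg h1]; ring

lemma notMem_edge (P : Polygon Plane n) {z : Plane} (hz : z ∉ P.boundary ℝ) (i : Fin n) :
    z ∉ segment ℝ (P i) (P (finRotate n i)) := fun h => hz ((mem_boundary P).2 ⟨i, h⟩)

lemma continuousAt_wind (P : Polygon Plane n) {z : Plane} (hz : z ∉ P.boundary ℝ) :
    ContinuousAt P.wind z := by
  unfold wind
  exact tendsto_finsetSum _ fun i _ => continuousAt_ang (notMem_edge P hz i)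

/-- Modulo 2π each summand is the difference of the directions to consecutive vertices, so the sum
telescopes around the cycle. -/
lemma wind_eq_int_mul (P : Polygon Plane n) {z : Plane} (hz : z ∉ P.boundary ℝ) :
    ∃ k : ℤ, P.wind z = 2 * Real.pi * k := by
  have key : ((P.wind z : ℝ) : Real.Angle) = ((0 : ℝ) : Real.Angle) := by
    unfold wind
    have e : ∀ i, ((ang (P i) (P (finRotate n i)) z : ℝ) : Real.Angle) =
        (Complex.arg (toC (P (finRotate n i) - z)) : Real.Angle) -
          (Complex.arg (toC (P i - z)) : Real.Angle) := fun i =>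
      Complex.arg_div_coe_angle
        (toC_sub_ne_zero (ne_of_notMem_segment_right (notMem_edge P hz i)))
        (toC_sub_ne_zero (ne_of_notMem_segment_left (notMem_edge P hz i)))
    have : ((∑ i, ang (P i) (P (finRotate n i)) z : ℝ) : Real.Angle) =
        ∑ i, ((ang (P i) (P (finRotate n i)) z : ℝ) : Real.Angle) :=
      map_sum Real.Angle.coeHom _ _
    rw [this, Finset.sum_congr rfl fun i _ => e i, Finset.sum_sub_distrib,
      Equiv.sum_comp (finRotate n) fun i => ((toC (P i - z)).arg : Real.Angle), sub_self]
    rfl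
  rw [Real.Angle.angle_eq_iff_two_pi_dvd_sub] at key
  obtain ⟨k, hk⟩ := key
  exact ⟨k, by simpa using hk⟩

lemma wind_eq_of_abs_sub_lt (P : Polygon Plane n) {z z' : Plane} (hz : z ∉ P.boundary ℝ)
    (hz' : z' ∉ P.boundary ℝ) (h : |P.wind z - P.wind z'| < 2 * Real.pi) :
    P.wind z = P.wind z' := by
  obtain ⟨k, hk⟩ := wind_eq_int_mul P hz
  obtain ⟨k', hk'⟩ := wind_eq_int_mul P hz'
  rw [hk, hk', ← mul_sub, abs_mul, abs_of_pos Real.two_pi_pos] at h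
  have h1 : |(k : ℝ) - k'| < 1 := by
    by_contra h2
    push Not at h2
    nlinarith [Real.two_pi_pos]
  have h2 : |k - k'| < 1 := by exact_mod_cast h1
  have : k = k' := by rw [Int.abs_lt_one_iff] at h2; omega
  rw [hk, hk', this]

lemma eventually_wind_eq (P : Polygon Plane n) {z : Plane} (hz : z ∉ P.boundary ℝ) :
    ∀ᶠ z' in 𝓝 z, z' ∉ P.boundary ℝ ∧ P.wind z' = P.wind z := by
  have h1 : ∀ᶠ z' in 𝓝 z, z' ∉ P.boundary ℝ := (isClosed_boundary P).isOpen_compl.mem_nhds hz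
  have h2 := Metric.tendsto_nhds.1 (continuousAt_wind P hz) (2 * Real.pi) Real.two_pi_pos
  filter_upwards [h1, h2] with z' h1 h2
  exact ⟨h1, wind_eq_of_abs_sub_lt P h1 hz h2⟩

lemma wind_eq_of_isPreconnected (P : Polygon Plane n) {S : Set Plane} (hS : IsPreconnected S)
    (hd : Disjoint S (P.boundary ℝ)) {z z' : Plane} (hz : z ∈ S) (hz' : z' ∈ S) :
    P.wind z = P.wind z' := by
  have hU : ∀ T : Set ℝ, IsOpen {y | y ∉ P.boundary ℝ ∧ P.wind y ∈ T} := by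
    intro T
    rw [isOpen_iff_mem_nhds]
    rintro y ⟨hy, hyT⟩
    filter_upwards [eventually_wind_eq P hy] with y' h
    exact ⟨h.1, by rw [h.2]; exact hyT⟩
  have hnot : ∀ y ∈ S, y ∉ P.boundary ℝ := fun y hy => disjoint_left.1 hd hy
  have := isPreconnected_iff_subset_of_disjoint.1 hS _ _ (hU {P.wind z}) (hU {P.wind z}ᶜ)
    (fun y hy => by
      by_cases h : P.wind y = P.wind z
      · exact Or.inl ⟨hnot y hy, h⟩
      · exact Or.inr ⟨hnot y hy, h⟩)
    (by ext y; simp +contextual)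
  rcases this with h | h
  · exact (h hz').2.symm
  · exact absurd rfl (h hz).2

/-- The ratio equals 1 + (q - p) / (p - z), which tends to 1 far away. -/
lemma tendsto_ang_cobounded (p q : Plane) :
    Tendsto (ang p q) (Bornology.cobounded Plane) (𝓝 0) := by
  have h1 : Tendsto (fun z => toC (p - z)) (Bornology.cobounded Plane)
      (Bornology.cobounded ℂ) := by
    rw [← tendsto_norm_atTop_iff_cobounded]
    have : ∀ z, ‖toC (p - z)‖ = ‖p - z‖ := fun z => toC.norm_map _
    simp_rw [this]
    refine tendsto_atTop_mono (f := fun z => ‖z‖ - ‖p‖) (fun z => ?_)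
      (tendsto_atTop_add_const_right _ _ tendsto_norm_cobounded_atTop)
    rw [norm_sub_rev]; exact norm_sub_norm_le _ _
  have h2 : Tendsto (fun z => 1 + toC (q - p) * (toC (p - z))⁻¹) (Bornology.cobounded Plane)
      (𝓝 1) := by
    have := ((tendsto_inv₀_cobounded (α := ℂ)).comp h1).const_mul (toC (q - p))
    simpa using this.const_add 1
  have h3 : Tendsto (fun z => Complex.arg (1 + toC (q - p) * (toC (p - z))⁻¹))
      (Bornology.cobounded Plane) (𝓝 0) := by
    have := (Complex.continuousAt_arg (x := 1) (by simp)).tendsto.comp h2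
    rw [Complex.arg_one] at this
    exact this
  refine h3.congr' ?_
  have h4 : ∀ᶠ z in Bornology.cobounded Plane, p - z ≠ 0 := by
    have h5 : ∀ᶠ w in Bornology.cobounded ℂ, w ≠ 0 :=
      Bornology.isBounded_def.1 (Bornology.isBounded_singleton (x := (0 : ℂ)))
    filter_upwards [h1.eventually h5] with z hz
    exact toC_ne_zero.1 hz
  filter_upwards [h4] with z hz
  have ha : toC (p - z) ≠ 0 := toC_ne_zero.2 hz
  unfold ang
  congr 1
  have : toC (q - z) = toC (p - z) + toC (q - p) := by rw [← map_add]; congr 1; abel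
  rw [this]; field_simp

lemma exists_wind_eq_zero_of_norm_gt (P : Polygon Plane n) :
    ∃ R : ℝ, ∀ z, R < ‖z‖ → z ∉ P.boundary ℝ ∧ P.wind z = 0 := by
  have h1 : Tendsto P.wind (Bornology.cobounded Plane) (𝓝 0) := by
    have := tendsto_finsetSum (Finset.univ : Finset (Fin n)) fun i _ =>
      tendsto_ang_cobounded (P i) (P (finRotate n i))
    rw [Finset.sum_const_zero] at this
    exact this
  have h2 := Metric.tendsto_nhds.1 h1 (2 * Real.pi) Real.two_pi_pos
  have h3 : ∀ᶠ z in Bornology.cobounded Plane, z ∉ P.boundary ℝ :=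
    Bornology.isBounded_def.1 (isCompact_boundary P).isBounded
  obtain ⟨R, -, hR⟩ := (hasBasis_cobounded_norm (E := Plane)).eventually_iff.1 (h2.and h3)
  refine ⟨R, fun z hz => ?_⟩
  obtain ⟨h4, h5⟩ := hR (show z ∈ {x | R ≤ ‖x‖} from hz.le)
  obtain ⟨k, hk⟩ := wind_eq_int_mul P h5
  refine ⟨h5, ?_⟩
  rw [Real.dist_eq, sub_zero, hk, abs_mul, abs_of_pos Real.two_pi_pos] at h4
  have h6 : |(k : ℝ)| < 1 := by
    by_contra h7; push Not at h7; nlinarith [Real.two_pi_pos]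
  have : k = 0 := by
    have : |k| < 1 := by exact_mod_cast h6
    rwa [Int.abs_lt_one_iff] at this
  simp [hk, this]

/-- The ratio defining `ang p q`, at the point `(1 - s) p + s q + t d`. -/
lemma ratio_lineMap_add {p q d : Plane} (hpq : p ≠ q) (s t : ℝ) :
    toC (q - (AffineMap.lineMap p q s + t • d)) / toC (p - (AffineMap.lineMap p q s + t • d)) =
      ((1 - s : ℝ) - (t : ℂ) * (toC d / toC (q - p))) /
        ((-s : ℝ) - (t : ℂ) * (toC d / toC (q - p))) := by
  have hD : toC (q - p) ≠ 0 := toC_sub_ne_zero hpq.symm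
  have e1 : q - (AffineMap.lineMap p q s + t • d) = (1 - s) • (q - p) - t • d := by
    rw [AffineMap.lineMap_apply_module]; module
  have e2 : p - (AffineMap.lineMap p q s + t • d) = (-s) • (q - p) - t • d := by
    rw [AffineMap.lineMap_apply_module]; module
  rw [e1, e2, map_sub toC, map_sub toC, map_smul, map_smul, map_smul, Complex.real_smul,
    Complex.real_smul, Complex.real_smul]
  generalize toC (q - p) = D at *
  generalize toC d = c at *
  have e3 : ((1 - s : ℝ) : ℂ) * D - t * c = D * (((1 - s : ℝ) : ℂ) - t * (c / D)) := by
    field_simp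
  have e4 : ((-s : ℝ) : ℂ) * D - t * c = D * (((-s : ℝ) : ℂ) - t * (c / D)) := by
    field_simp
  rw [e3, e4, mul_div_mul_left _ _ hD]

/-- The polynomial in `h` is the real part of the numerator times the conjugate of the denominator;
the imaginary part of that product collapses to `t * c.im`. The number `N` is the squared norm of
the denominator. -/
lemma ratio_signs {s t : ℝ} {c : ℂ} (hc : c.im ≠ 0) (ht : t ≠ 0)
    (h : -(s * (1 - s)) + t * c.re * (2 * s - 1) + t ^ 2 * (c.re ^ 2 + c.im ^ 2) < 0) :
    ((((1 - s : ℝ) : ℂ) - (t : ℂ) * c) / (((-s : ℝ) : ℂ) - (t : ℂ) * c)).re < 0 ∧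
      ∃ N : ℝ, 0 < N ∧
        ((((1 - s : ℝ) : ℂ) - (t : ℂ) * c) / (((-s : ℝ) : ℂ) - (t : ℂ) * c)).im =
          t * c.im / N := by
  have hN : 0 < Complex.normSq (((-s : ℝ) : ℂ) - (t : ℂ) * c) := by
    rw [Complex.normSq_pos]
    intro h0
    have := congrArg Complex.im h0
    simp at this
    tauto
  constructor
  · rw [Complex.div_re, ← add_div, div_neg_iff]
    refine Or.inr ⟨?_, hN⟩
    simp
    nlinarith
  · refine ⟨_, hN, ?_⟩
    rw [Complex.div_im, ← sub_div]
    congr 1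
    simp
    ring

lemma arg_bounds_of_pos {w : ℂ} (h1 : w.re < 0) (h2 : 0 < w.im) :
    Real.pi / 2 < w.arg ∧ w.arg < Real.pi := by
  constructor
  · by_contra h
    push Not at h
    rcases Complex.arg_le_pi_div_two_iff.1 h with h | h <;> linarith
  · refine lt_of_le_of_ne (Complex.arg_le_pi _) fun h => ?_
    rw [Complex.arg_eq_pi_iff] at h
    linarith [h.2]

lemma arg_bounds_of_neg {w : ℂ} (h1 : w.re < 0) (h2 : w.im < 0) :
    -Real.pi < w.arg ∧ w.arg < -(Real.pi / 2) := by
  constructor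
  · exact Complex.neg_pi_lt_arg _
  · by_contra h
    push Not at h
    rcases Complex.neg_pi_div_two_le_arg_iff.1 h with h | h <;> linarith

/-- At an inner point of the segment the ratio is a negative real. Moving off by ± t d puts it above
or below the branch cut, with arguments in (π/2, π) and (-π, -π/2). The crude bounds on the
difference suffice because `wind` only takes multiples of 2π. -/
lemma ang_jump {p q d : Plane} {s : ℝ} (hpq : p ≠ q) (hs0 : 0 < s) (hs1 : s < 1)
    (hd : (toC d / toC (q - p)).im ≠ 0) :
    ∀ᶠ t in 𝓝[>] (0 : ℝ), AffineMap.lineMap p q s + t • d ∉ segment ℝ p q ∧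
      AffineMap.lineMap p q s - t • d ∉ segment ℝ p q ∧
      Real.pi < |ang p q (AffineMap.lineMap p q s + t • d) -
        ang p q (AffineMap.lineMap p q s - t • d)| ∧
      |ang p q (AffineMap.lineMap p q s + t • d) -
        ang p q (AffineMap.lineMap p q s - t • d)| < 2 * Real.pi := by
  set c := toC d / toC (q - p) with hc
  have hneg : ∀ᶠ t in 𝓝 (0 : ℝ),
      -(s * (1 - s)) + t * c.re * (2 * s - 1) + t ^ 2 * (c.re ^ 2 + c.im ^ 2) < 0 := by
    have hcont : Continuous fun t : ℝ =>
      -(s * (1 - s)) + t * c.re * (2 * s - 1) + t ^ 2 * (c.re ^ 2 + c.im ^ 2) := by fun_prop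
    refine hcont.continuousAt.eventually_lt continuousAt_const ?_
    have : 0 < s * (1 - s) := mul_pos hs0 (by linarith)
    simpa using this
  have hneg' : ∀ᶠ t in 𝓝 (0 : ℝ),
      -(s * (1 - s)) + (-t) * c.re * (2 * s - 1) + (-t) ^ 2 * (c.re ^ 2 + c.im ^ 2) < 0 := by
    have : Tendsto (fun t : ℝ => -t) (𝓝 0) (𝓝 0) := by
      simpa using (continuous_neg (G := ℝ)).tendsto 0
    exact this.eventually hneg
  filter_upwards [nhdsWithin_le_nhds hneg, nhdsWithin_le_nhds hneg', self_mem_nhdsWithin]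
    with t h1 h2 ht
  have ht : 0 < t := ht
  obtain ⟨a1, N, hN, a2⟩ := ratio_signs hd ht.ne' h1
  obtain ⟨b1, M, hM, b2⟩ := ratio_signs hd (neg_ne_zero.2 ht.ne') h2
  have e1 := ratio_lineMap_add (d := d) hpq s t
  have e2 := ratio_lineMap_add (d := d) hpq s (-t)
  rw [← hc, neg_smul, ← sub_eq_add_neg] at e2
  rw [← hc] at e1
  refine ⟨fun h => ?_, fun h => ?_, ?_⟩
  · have := ratio_im_eq_zero h
    rw [e1, a2] at this
    have : t * c.im ≠ 0 := mul_ne_zero ht.ne' hd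
    simp_all
  · have := ratio_im_eq_zero h
    rw [e2, b2] at this
    have : -t * c.im ≠ 0 := mul_ne_zero (neg_ne_zero.2 ht.ne') hd
    simp_all
  · unfold ang
    rw [e1, e2]
    have hpi := Real.pi_pos
    rcases lt_or_gt_of_ne hd with hd | hd
    · have a3 := arg_bounds_of_neg a1
        (by rw [a2]; exact div_neg_of_neg_of_pos (mul_neg_of_pos_of_neg ht hd) hN)
      have b3 := arg_bounds_of_pos b1
        (by rw [b2]; exact div_pos (mul_pos_of_neg_of_neg (by linarith) hd) hM)
      rw [abs_sub_comm, abs_of_pos (by linarith)]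
      constructor <;> linarith
    · have a3 := arg_bounds_of_pos a1
        (by rw [a2]; exact div_pos (mul_pos ht hd) hN)
      have b3 := arg_bounds_of_neg b1
        (by rw [b2]; exact div_neg_of_neg_of_pos (mul_neg_of_neg_of_pos (by linarith) hd) hM)
      rw [abs_of_pos (by linarith)]
      constructor <;> linarith

/-- The winding number jumps by one across an edge. -/
lemma wind_jump (P : Polygon Plane n) {i : Fin n} {q d : Plane}
    (hne : P i ≠ P (finRotate n i))
    (hq : q ∈ openSegment ℝ (P i) (P (finRotate n i)))
    (hqj : ∀ j, j ≠ i → q ∉ segment ℝ (P j) (P (finRotate n j)))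
    (hd : (toC d / toC (P (finRotate n i) - P i)).im ≠ 0) :
    ∀ᶠ t in 𝓝[>] (0 : ℝ), q + t • d ∉ P.boundary ℝ ∧ q - t • d ∉ P.boundary ℝ ∧
      |P.wind (q + t • d) - P.wind (q - t • d)| = 2 * Real.pi := by
  rw [openSegment_eq_image_lineMap] at hq
  obtain ⟨s, ⟨hs0, hs1⟩, rfl⟩ := hq
  set q := AffineMap.lineMap (P i) (P (finRotate n i)) s with hq
  -- The other edges contribute continuously at `q`, so their change is below 1 for small `t`. The
  -- total change then lies strictly between 0 and 4π in absolute value, and as a multiple of 2π it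
  -- is ±2π.
  set rest : Plane → ℝ := fun z =>
    ∑ j ∈ Finset.univ.erase i, ang (P j) (P (finRotate n j)) z with hrest
  have hplus : Tendsto (fun t : ℝ => q + t • d) (𝓝[>] 0) (𝓝 q) := by
    have : Tendsto (fun t : ℝ => q + t • d) (𝓝 0) (𝓝 (q + (0 : ℝ) • d)) :=
      Continuous.tendsto (by fun_prop) 0
    rw [zero_smul, add_zero] at this
    exact this.mono_left nhdsWithin_le_nhds
  have hminus : Tendsto (fun t : ℝ => q - t • d) (𝓝[>] 0) (𝓝 q) := by
    have : Tendsto (fun t : ℝ => q - t • d) (𝓝 0) (𝓝 (q - (0 : ℝ) • d)) :=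
      Continuous.tendsto (by fun_prop) 0
    rw [zero_smul, sub_zero] at this
    exact this.mono_left nhdsWithin_le_nhds
  have hcont : ContinuousAt rest q := by
    refine tendsto_finsetSum _ fun j hj => continuousAt_ang (hqj j (Finset.ne_of_mem_erase hj))
  have hnear : ∀ᶠ z in 𝓝 q, ∀ j, j ≠ i → z ∉ segment ℝ (P j) (P (finRotate n j)) := by
    rw [eventually_all]
    intro j
    by_cases hj : j = i
    · simp [hj]
    · filter_upwards [(isClosed_segment _ _).isOpen_compl.mem_nhds (hqj j hj)] with z hz _
      exact hz
  have hsmall := (hcont.tendsto.comp hplus).sub (hcont.tendsto.comp hminus)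
  rw [sub_self] at hsmall
  have hsmall' := Metric.tendsto_nhds.1 hsmall 1 one_pos
  filter_upwards [ang_jump hne hs0 hs1 hd, hplus.eventually hnear, hminus.eventually hnear,
    hsmall'] with t ⟨h1, h2, h3, h4⟩ h5 h6 h7
  have hoff : ∀ z, z ∉ segment ℝ (P i) (P (finRotate n i)) →
      (∀ j, j ≠ i → z ∉ segment ℝ (P j) (P (finRotate n j))) → z ∉ P.boundary ℝ := by
    intro z hz hz' h
    obtain ⟨j, hj⟩ := (mem_boundary P).1 h
    by_cases hji : j = i
    · subst hji; exact hz hj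
    · exact hz' j hji hj
  have o1 := hoff _ h1 h5
  have o2 := hoff _ h2 h6
  refine ⟨o1, o2, ?_⟩
  have hw : ∀ z, P.wind z = ang (P i) (P (finRotate n i)) z + rest z := fun z =>
    (Finset.add_sum_erase _ _ (Finset.mem_univ i)).symm
  obtain ⟨k, hk⟩ := wind_eq_int_mul P o1
  obtain ⟨k', hk'⟩ := wind_eq_int_mul P o2
  rw [Real.dist_eq, sub_zero] at h7
  have e : P.wind (q + t • d) - P.wind (q - t • d) =
    (ang (P i) (P (finRotate n i)) (q + t • d) - ang (P i) (P (finRotate n i)) (q - t • d)) +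
      (rest (q + t • d) - rest (q - t • d)) := by rw [hw, hw]; ring
  have hpi := Real.pi_gt_three
  have b1 : 0 < |P.wind (q + t • d) - P.wind (q - t • d)| := by
    rw [e]
    have := abs_sub_abs_le_abs_add (ang (P i) (P (finRotate n i)) (q + t • d) -
      ang (P i) (P (finRotate n i)) (q - t • d)) (rest (q + t • d) - rest (q - t • d))
    simp only [Function.comp] at h7
    linarith
  have b2 : |P.wind (q + t • d) - P.wind (q - t • d)| < 2 * (2 * Real.pi) := by
    rw [e]
    have := abs_add_le (ang (P i) (P (finRotate n i)) (q + t • d) -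
      ang (P i) (P (finRotate n i)) (q - t • d)) (rest (q + t • d) - rest (q - t • d))
    simp only [Function.comp] at h7
    linarith
  rw [hk, hk', ← mul_sub, abs_mul, abs_of_pos Real.two_pi_pos] at b1 b2 ⊢
  have b3 : 0 < |(k : ℝ) - k'| := by
    by_contra h; push Not at h; nlinarith [Real.two_pi_pos]
  have b4 : |(k : ℝ) - k'| < 2 := by
    by_contra h; push Not at h; nlinarith [Real.two_pi_pos]
  have b5 : |(k : ℝ) - k'| = 1 := by
    have c3 : 0 < |k - k'| := by exact_mod_cast b3
    have c4 : |k - k'| < 2 := by exact_mod_cast b4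
    have : |k - k'| = 1 := by omega
    exact_mod_cast this
  rw [b5, mul_one]

end Polygon

namespace Polygon

open Set Filter Topology

variable {n : ℕ}

/-! ### Polar coordinates and sectors -/

/-- The point with polar coordinates `r`, `θ` with respect to `p`. -/
noncomputable def polar (p : Plane) (r θ : ℝ) : Plane :=
  p + toC.symm (r * Complex.exp (θ * Complex.I))

lemma continuous_polar (p : Plane) : Continuous fun x : ℝ × ℝ => polar p x.1 x.2 := by
  unfold polar
  refine continuous_const.add (toC.symm.continuous.comp ?_)
  fun_prop

lemma toC_polar_sub (p : Plane) (r θ : ℝ) :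
    toC (polar p r θ - p) = r * Complex.exp (θ * Complex.I) := by
  simp only [polar, add_sub_cancel_left, LinearIsometryEquiv.apply_symm_apply]

lemma dist_polar (p : Plane) {r : ℝ} (hr : 0 ≤ r) (θ : ℝ) : dist (polar p r θ) p = r := by
  rw [dist_eq_norm, ← toC.norm_map, toC_polar_sub, norm_mul, Complex.norm_exp_ofReal_mul_I,
    mul_one, Complex.norm_real, Real.norm_of_nonneg hr]

lemma polar_self (p z : Plane) : polar p (dist z p) (toC (z - p)).arg = z := by
  have : dist z p = ‖toC (z - p)‖ := by rw [toC.norm_map, dist_eq_norm]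
  rw [polar, this, Complex.norm_mul_exp_arg_mul_I, LinearIsometryEquiv.symm_apply_apply]
  abel

lemma polar_add_two_pi (p : Plane) (r θ : ℝ) : polar p r (θ + 2 * Real.pi) = polar p r θ := by
  unfold polar
  congr 3
  rw [Complex.ofReal_add, add_mul, Complex.exp_add]
  push_cast
  rw [Complex.exp_two_pi_mul_I, mul_one]

lemma polar_inj {p : Plane} {r r' θ θ' : ℝ} (hr : 0 < r) (hr' : 0 < r')
    (h : polar p r θ = polar p r' θ') : ∃ k : ℤ, θ = θ' + k * (2 * Real.pi) := by
  have h1 : r = r' := by rw [← dist_polar p hr.le θ, ← dist_polar p hr'.le θ', h]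
  have h2 : toC (polar p r θ - p) = toC (polar p r' θ' - p) := by rw [h]
  rw [toC_polar_sub, toC_polar_sub, ← h1] at h2
  have h3 := mul_left_cancel₀ (by exact_mod_cast hr.ne') h2
  rw [Complex.exp_eq_exp_iff_exists_int] at h3
  obtain ⟨k, hk⟩ := h3
  refine ⟨k, ?_⟩
  have := congrArg Complex.im hk
  simpa using this

lemma mem_segment_iff_polar {p q z : Plane} (hzp : dist z p ≤ dist q p) (hpq : p ≠ q) :
    z ∈ segment ℝ p q ↔ z = polar p (dist z p) (toC (q - p)).arg := by
  have hpos : 0 < dist q p := dist_pos.2 hpq.symm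
  have hq : toC (q - p) = (dist q p : ℂ) * Complex.exp ((toC (q - p)).arg * Complex.I) := by
    rw [← toC_polar_sub, polar_self]
  constructor
  · intro hz
    rw [segment_eq_image_lineMap] at hz
    obtain ⟨s, ⟨hs0, hs1⟩, rfl⟩ := hz
    have e : AffineMap.lineMap p q s - p = s • (q - p) := by
      rw [AffineMap.lineMap_apply_module]; module
    have hd : dist (AffineMap.lineMap p q s) p = s * dist q p := by
      rw [dist_eq_norm, e, norm_smul, Real.norm_of_nonneg hs0, dist_eq_norm]
    rw [← sub_left_inj (a := p)]
    apply toC.injective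
    rw [toC_polar_sub, e, map_smul, hd, Complex.real_smul]
    push_cast
    rw [mul_assoc, ← hq]
  · intro hz
    have e : z - p = (dist z p / dist q p) • (q - p) := by
      apply toC.injective
      rw [map_smul, Complex.real_smul, hq]
      conv_lhs => rw [hz, toC_polar_sub]
      have : (dist q p : ℂ) ≠ 0 := by exact_mod_cast hpos.ne'
      push_cast
      field_simp
    rw [segment_eq_image_lineMap]
    refine ⟨dist z p / dist q p, ⟨by positivity, (div_le_one hpos).2 hzp⟩, ?_⟩
    rw [AffineMap.lineMap_apply, vsub_eq_sub, vadd_eq_add, ← e]; abel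

lemma isPreconnected_polar_image (p : Plane) {s t : Set ℝ} (hs : IsPreconnected s)
    (ht : IsPreconnected t) : IsPreconnected ((fun x : ℝ × ℝ => polar p x.1 x.2) '' s ×ˢ t) :=
  (hs.prod ht).image _ (continuous_polar p).continuousOn

lemma polar_mem_closure_sector {p : Plane} {ε α β r θ : ℝ} (hε : 0 < ε) (hαβ : α < β)
    (hr : r ∈ Icc 0 ε) (hθ : θ ∈ Icc α β) :
    polar p r θ ∈ closure ((fun x : ℝ × ℝ => polar p x.1 x.2) '' Ioo 0 ε ×ˢ Ioo α β) := by
  apply image_closure_subset_closure_image (continuous_polar p)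
  refine ⟨(r, θ), ?_, rfl⟩
  rw [closure_prod_eq, closure_Ioo hε.ne, closure_Ioo hαβ.ne]
  exact ⟨hr, hθ⟩

/-- In polar coordinates about `p` the segments are rays at angles α < β, and the rest of the disc
is the image of two rectangles, with angles in (α, β) and in (β, α + 2π). Both rectangles are
connected and have both rays as limits. -/
lemma sectors_of_arg_lt {p q₁ q₂ : Plane} {ε : ℝ} (hε : 0 < ε) (h₁ : ε ≤ dist q₁ p)
    (h₂ : ε ≤ dist q₂ p) (harg : (toC (q₁ - p)).arg < (toC (q₂ - p)).arg) :
    ∃ S₁ S₂ : Set Plane, IsPreconnected S₁ ∧ IsPreconnected S₂ ∧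
      S₁ ∪ S₂ = Metric.ball p ε \ (segment ℝ p q₁ ∪ segment ℝ p q₂) ∧
      Metric.ball p ε ∩ (segment ℝ p q₁ ∪ segment ℝ p q₂) ⊆ closure S₁ ∧
      Metric.ball p ε ∩ (segment ℝ p q₁ ∪ segment ℝ p q₂) ⊆ closure S₂ := by
  set α := (toC (q₁ - p)).arg with hα
  set β := (toC (q₂ - p)).arg with hβ
  have hpi := Real.pi_pos
  have hα1 : -Real.pi < α := Complex.neg_pi_lt_arg _
  have hβ1 : β ≤ Real.pi := Complex.arg_le_pi _
  have hp₁ : p ≠ q₁ := (dist_pos.1 (hε.trans_le h₁)).symm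
  have hp₂ : p ≠ q₂ := (dist_pos.1 (hε.trans_le h₂)).symm
  have hS₁ : ∀ z ∈ Metric.ball p ε, (z ∈ segment ℝ p q₁ ↔ z = polar p (dist z p) α) :=
    fun z hz => mem_segment_iff_polar ((Metric.mem_ball.1 hz).le.trans h₁) hp₁
  have hS₂ : ∀ z ∈ Metric.ball p ε, (z ∈ segment ℝ p q₂ ↔ z = polar p (dist z p) β) :=
    fun z hz => mem_segment_iff_polar ((Metric.mem_ball.1 hz).le.trans h₂) hp₂
  refine ⟨(fun x : ℝ × ℝ => polar p x.1 x.2) '' Ioo 0 ε ×ˢ Ioo α β,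
    (fun x : ℝ × ℝ => polar p x.1 x.2) '' Ioo 0 ε ×ˢ Ioo β (α + 2 * Real.pi),
    isPreconnected_polar_image p isPreconnected_Ioo isPreconnected_Ioo,
    isPreconnected_polar_image p isPreconnected_Ioo isPreconnected_Ioo, ?_, ?_, ?_⟩
  · apply Subset.antisymm
    · have key : ∀ r θ, r ∈ Ioo 0 ε → θ ∈ Ioo α (α + 2 * Real.pi) → θ ≠ β → polar p r θ ∈
          Metric.ball p ε \ (segment ℝ p q₁ ∪ segment ℝ p q₂) := by
        intro r θ hr hθ hne
        have hd := dist_polar p hr.1.le θ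
        have hb : polar p r θ ∈ Metric.ball p ε := by rw [Metric.mem_ball, hd]; exact hr.2
        refine ⟨hb, ?_⟩
        have hint : ∀ k : ℤ, (-1 : ℝ) < k → (k : ℝ) < 1 → k = 0 := by
          intro k h1 h2
          have h1' : -1 < k := by exact_mod_cast h1
          have h2' : k < 1 := by exact_mod_cast h2
          omega
        rintro (h | h)
        · rw [hS₁ _ hb, hd] at h
          obtain ⟨k, hk⟩ := polar_inj hr.1 hr.1 h
          have : k = 0 := hint k (by nlinarith [hθ.1, hθ.2]) (by nlinarith [hθ.1, hθ.2])
          subst this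
          have := hθ.1
          simp at hk
          linarith
        · rw [hS₂ _ hb, hd] at h
          obtain ⟨k, hk⟩ := polar_inj hr.1 hr.1 h
          have : k = 0 := hint k (by nlinarith [hθ.1, hθ.2]) (by nlinarith [hθ.1, hθ.2])
          subst this
          simp at hk
          exact hne hk
      rintro z (⟨⟨r, θ⟩, ⟨hr, hθ⟩, rfl⟩ | ⟨⟨r, θ⟩, ⟨hr, hθ⟩, rfl⟩)
      · exact key r θ hr ⟨hθ.1, by linarith [hθ.2]⟩ hθ.2.ne
      · exact key r θ hr ⟨by linarith [hθ.1], hθ.2⟩ hθ.1.ne'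
    · rintro z ⟨hz, hzs⟩
      have hz1 : z ∉ segment ℝ p q₁ := fun h => hzs (Or.inl h)
      have hz2 : z ∉ segment ℝ p q₂ := fun h => hzs (Or.inr h)
      rw [hS₁ z hz] at hz1
      rw [hS₂ z hz] at hz2
      have hzp : z ≠ p := by
        rintro rfl
        exact hzs (Or.inl (left_mem_segment _ _ _))
      have hr : dist z p ∈ Ioo 0 ε := ⟨dist_pos.2 hzp, hz⟩
      have hself := polar_self p z
      set φ := (toC (z - p)).arg with hφ
      have hφ1 : -Real.pi < φ := Complex.neg_pi_lt_arg _
      have hφ2 : φ ≤ Real.pi := Complex.arg_le_pi _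
      have n1 : φ ≠ α := fun h => hz1 (by rw [← h, hself])
      have n2 : φ ≠ β := fun h => hz2 (by rw [← h, hself])
      rcases lt_or_gt_of_ne n1 with h | h
      -- A principal argument below α lands in the second range of angles only after a full turn.
      · refine Or.inr ⟨(dist z p, φ + 2 * Real.pi), ⟨hr, ?_, ?_⟩, ?_⟩
        · change β < φ + 2 * Real.pi
          linarith
        · change φ + 2 * Real.pi < _
          linarith
        · change polar p _ (φ + 2 * Real.pi) = z
          rw [polar_add_two_pi, hself]
      rcases lt_or_gt_of_ne n2 with h' | h'
      · exact Or.inl ⟨(dist z p, φ), ⟨hr, h, h'⟩, hself⟩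
      · refine Or.inr ⟨(dist z p, φ), ⟨hr, h', ?_⟩, hself⟩
        change φ < α + 2 * Real.pi
        linarith
  · rintro z ⟨hz, hzs⟩
    have hr : dist z p ∈ Icc 0 ε := ⟨dist_nonneg, (Metric.mem_ball.1 hz).le⟩
    rcases hzs with h | h
    · rw [hS₁ z hz] at h
      rw [h]
      exact polar_mem_closure_sector hε harg hr ⟨le_rfl, harg.le⟩
    · rw [hS₂ z hz] at h
      rw [h]
      exact polar_mem_closure_sector hε harg hr ⟨harg.le, le_rfl⟩
  · rintro z ⟨hz, hzs⟩
    have hr : dist z p ∈ Icc 0 ε := ⟨dist_nonneg, (Metric.mem_ball.1 hz).le⟩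
    have hlt : β < α + 2 * Real.pi := by linarith
    rcases hzs with h | h
    · rw [hS₁ z hz] at h
      rw [h, ← polar_add_two_pi]
      exact polar_mem_closure_sector hε hlt hr ⟨hlt.le, le_rfl⟩
    · rw [hS₂ z hz] at h
      rw [h]
      exact polar_mem_closure_sector hε hlt hr ⟨le_rfl, hlt.le⟩

/-- Two segments with only their end point `p` in common cut a small disc around `p` into two
connected sectors. -/
lemma sectors {p q₁ q₂ : Plane} {ε : ℝ} (hε : 0 < ε) (h₁ : ε ≤ dist q₁ p)
    (h₂ : ε ≤ dist q₂ p) (hinter : segment ℝ p q₁ ∩ segment ℝ p q₂ = {p}) :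
    ∃ S₁ S₂ : Set Plane, IsPreconnected S₁ ∧ IsPreconnected S₂ ∧
      S₁ ∪ S₂ = Metric.ball p ε \ (segment ℝ p q₁ ∪ segment ℝ p q₂) ∧
      Metric.ball p ε ∩ (segment ℝ p q₁ ∪ segment ℝ p q₂) ⊆ closure S₁ ∧
      Metric.ball p ε ∩ (segment ℝ p q₁ ∪ segment ℝ p q₂) ⊆ closure S₂ := by
  rcases lt_trichotomy (toC (q₁ - p)).arg (toC (q₂ - p)).arg with h | h | h
  · exact sectors_of_arg_lt hε h₁ h₂ h
  · exfalso
    have hp₁ : p ≠ q₁ := (dist_pos.1 (hε.trans_le h₁)).symm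
    have hp₂ : p ≠ q₂ := (dist_pos.1 (hε.trans_le h₂)).symm
    set z := polar p ε (toC (q₁ - p)).arg with hz
    have hd : dist z p = ε := dist_polar p hε.le _
    have m1 : z ∈ segment ℝ p q₁ :=
      (mem_segment_iff_polar (by rw [hd]; exact h₁) hp₁).2 (by rw [hd])
    have m2 : z ∈ segment ℝ p q₂ :=
      (mem_segment_iff_polar (by rw [hd]; exact h₂) hp₂).2 (by rw [hd, ← h])
    have : z ∈ ({p} : Set Plane) := by rw [← hinter]; exact ⟨m1, m2⟩
    rw [mem_singleton_iff] at this
    rw [this, dist_self] at hd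
    exact hε.ne hd
  · rw [union_comm (segment ℝ p q₁)]
    exact sectors_of_arg_lt hε h₂ h₁ h

/-! ### Components of the complement of a locally two-sided connected closed set -/

/-- Near each of its points, the set divides the plane into two connected sides, each of which
accumulates at all points of the set. -/
def LocallyTwoSided (C : Set Plane) : Prop :=
  ∀ p ∈ C, ∃ B : Set Plane, IsOpen B ∧ p ∈ B ∧ ∃ S₁ S₂ : Set Plane,
    IsPreconnected S₁ ∧ IsPreconnected S₂ ∧ S₁ ∪ S₂ = B \ C ∧
    B ∩ C ⊆ closure S₁ ∧ B ∩ C ⊆ closure S₂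

/-- Accumulating at `p`, the component meets `B` off `C`, hence meets one of the two sides. This
side is connected and misses `C`, so the component swallows it. -/
lemma side_subset_component {C O B S₁ S₂ : Set Plane} {z p : Plane}
    (hO : O = connectedComponentIn Cᶜ z) (hB : IsOpen B) (hpB : p ∈ B)
    (h₁ : IsPreconnected S₁) (h₂ : IsPreconnected S₂) (h : S₁ ∪ S₂ = B \ C)
    (hp : p ∈ closure O) : S₁ ⊆ O ∨ S₂ ⊆ O := by
  obtain ⟨y, hyB, hyO⟩ := mem_closure_iff.1 hp B hB hpB
  have hsub : ∀ S, IsPreconnected S → S ⊆ S₁ ∪ S₂ → y ∈ S → S ⊆ O := by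
    intro S hS hSub hy
    rw [hO] at hyO ⊢
    rw [connectedComponentIn_eq hyO]
    exact hS.subset_connectedComponentIn hy fun w hw => (h ▸ hSub hw : w ∈ B \ C).2
  have hyC : y ∉ C := by
    rw [hO] at hyO
    exact connectedComponentIn_subset _ _ hyO
  have hy : y ∈ S₁ ∪ S₂ := by rw [h]; exact ⟨hyB, hyC⟩
  rcases hy with hy | hy
  · exact Or.inl (hsub _ h₁ subset_union_left hy)
  · exact Or.inr (hsub _ h₂ subset_union_right hy)

/-- The points of `C` in the closure of a component form a closed subset of `C`. It is also open in
`C`, since the local side inside the component accumulates at all nearby points of `C`.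
Connectedness of `C` leaves only the empty case, in which the component would be clopen and thus the
whole plane. -/
lemma subset_closure_component {C : Set Plane} (hC : IsClosed C) (hconn : IsPreconnected C)
    (hne : C.Nonempty) (hloc : LocallyTwoSided C) {z : Plane} (hz : z ∉ C) :
    C ⊆ closure (connectedComponentIn Cᶜ z) := by
  set O := connectedComponentIn Cᶜ z with hO
  have hOopen : IsOpen O := hC.isOpen_compl.connectedComponentIn
  have hzO : z ∈ O := mem_connectedComponentIn hz
  have hmeet : (C ∩ closure O).Nonempty := by
    by_contra hcon
    rw [not_nonempty_iff_eq_empty] at hcon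
    have h1 : closure O ⊆ O :=
      isPreconnected_connectedComponentIn.closure.subset_connectedComponentIn
        (subset_closure hzO) fun y hy hyC => by
          have : y ∈ C ∩ closure O := ⟨hyC, hy⟩
          rw [hcon] at this; exact this
    have h2 : IsClopen O := ⟨closure_subset_iff_isClosed.1 h1, hOopen⟩
    rcases isClopen_iff.1 h2 with h | h
    · rw [h] at hzO; exact hzO
    · obtain ⟨c, hc⟩ := hne
      have : c ∈ O := by rw [h]; trivial
      exact connectedComponentIn_subset _ _ this hc
  choose! B hBo hpB S₁ S₂ h₁ h₂ h hc₁ hc₂ using hloc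
  have hBsub : ∀ p ∈ C ∩ closure O, B p ∩ C ⊆ closure O := by
    rintro p ⟨hpC, hpO⟩
    rcases side_subset_component hO (hBo p hpC) (hpB p hpC) (h₁ p hpC) (h₂ p hpC) (h p hpC) hpO
      with h | h
    · exact (hc₁ p hpC).trans (closure_mono h)
    · exact (hc₂ p hpC).trans (closure_mono h)
  have := isPreconnected_iff_subset_of_disjoint.1 hconn (⋃ p ∈ C ∩ closure O, B p)
    (closure O)ᶜ (isOpen_biUnion fun p hp => hBo p hp.1) isClosed_closure.isOpen_compl
    (fun p hp => by
      by_cases hpO : p ∈ closure O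
      · exact Or.inl (mem_biUnion (⟨hp, hpO⟩ : p ∈ C ∩ closure O) (hpB p hp))
      · exact Or.inr hpO)
    (by
      ext y
      simp only [mem_inter_iff, mem_empty_iff_false, iff_false]
      rintro ⟨hyC, hyU, hyO⟩
      obtain ⟨p, hp, hyp⟩ := mem_iUnion₂.1 hyU
      exact hyO (hBsub p hp ⟨hyp, hyC⟩))
  rcases this with h | h
  · intro y hy
    obtain ⟨p, hp, hyp⟩ := mem_iUnion₂.1 (h hy)
    exact hBsub p hp ⟨hyp, hy⟩
  · obtain ⟨c, hcC, hcO⟩ := hmeet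
    exact absurd hcO (h hcC)

end Polygon

namespace Polygon

open Set Filter Topology

/-! ### The Jordan curve theorem for simple polygons -/

variable {n : ℕ}

lemma finRotate_val (i : Fin n) :
    (finRotate n i).val = if i.val + 1 = n then 0 else i.val + 1 := by
  obtain ⟨m, rfl⟩ : ∃ m, n = m + 1 := ⟨n - 1, by have := i.2; omega⟩
  rw [coe_finRotate]
  by_cases h : i = Fin.last m
  · simp [h]
  · have : i.val ≠ m := fun h' => h (Fin.ext h')
    simp [h, this]

lemma btw_iff_val {a b c : Fin n} : btw a b c ↔
    (a.val ≤ b.val ∧ b.val ≤ c.val ∨ b.val ≤ c.val ∧ c.val ≤ a.val ∨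
      c.val ≤ a.val ∧ a.val ≤ b.val) := Iff.rfl

lemma sbtw_iff_val {a b c : Fin n} : sbtw a b c ↔
    (a.val < b.val ∧ b.val < c.val ∨ b.val < c.val ∧ c.val < a.val ∨
      c.val < a.val ∧ a.val < b.val) := Iff.rfl

lemma finRotate_ne_self (h : 2 ≤ n) (i : Fin n) : finRotate n i ≠ i := by
  intro h'
  have := congrArg Fin.val h'
  rw [finRotate_val] at this
  split_ifs at this <;> omega

namespace IsSimple

variable {P : Polygon Plane n}

lemma vertex_ne (hP : P.IsSimple) {i j : Fin n} (h : i ≠ j) : P i ≠ P j :=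
  fun h' => h (hP.injective h')

lemma edge_ne (hP : P.IsSimple) (i : Fin n) : P i ≠ P (finRotate n i) :=
  hP.vertex_ne (finRotate_ne_self (by have := hP.three_le; omega) i).symm

lemma eq_vertex_of_mem_consecutive (hP : P.IsSimple) {i : Fin n} {z : Plane}
    (h₁ : z ∈ segment ℝ (P i) (P (finRotate n i)))
    (h₂ : z ∈ segment ℝ (P (finRotate n i)) (P (finRotate n (finRotate n i)))) :
    z = P (finRotate n i) := by
  have := hP.consecutive i
  rw [edgeSet_eq, edgeSet_eq] at this
  have h : z ∈ ({P (finRotate n i)} : Set Plane) := by rw [← this]; exact ⟨h₁, h₂⟩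
  exact h

/-- A point on two distinct edges is the common vertex of two consecutive edges. -/
lemma eq_vertex_of_mem_edges (hP : P.IsSimple) {i j : Fin n} (hij : i ≠ j) {z : Plane}
    (hi : z ∈ segment ℝ (P i) (P (finRotate n i)))
    (hj : z ∈ segment ℝ (P j) (P (finRotate n j))) :
    (j = finRotate n i ∧ z = P j) ∨ (i = finRotate n j ∧ z = P i) := by
  by_cases h1 : j = finRotate n i
  · subst h1; exact Or.inl ⟨rfl, hP.eq_vertex_of_mem_consecutive hi hj⟩
  by_cases h2 : i = finRotate n j
  · subst h2; exact Or.inr ⟨rfl, hP.eq_vertex_of_mem_consecutive hj hi⟩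
  have := hP.nonconsecutive i j hij.symm h1 h2
  rw [edgeSet_eq, edgeSet_eq] at this
  exact absurd hj (disjoint_left.1 this hi)

/-- A vertex lies only on its two edges. -/
lemma vertex_mem_edge (hP : P.IsSimple) {i j : Fin n}
    (h : P i ∈ segment ℝ (P j) (P (finRotate n j))) : i = j ∨ i = finRotate n j := by
  by_contra hcon
  push Not at hcon
  rcases hP.eq_vertex_of_mem_edges hcon.1 (left_mem_segment _ _ _) h with ⟨-, h'⟩ | ⟨h', -⟩
  · exact hcon.1 (hP.injective h')
  · exact hcon.2 h'

lemma vertex_notMem_openSegment_edge (hP : P.IsSimple) (i j : Fin n) :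
    P i ∉ openSegment ℝ (P j) (P (finRotate n j)) := by
  intro h
  rcases hP.vertex_mem_edge (openSegment_subset_segment _ _ _ h) with h' | h'
  · rw [h', left_mem_openSegment_iff] at h; exact hP.edge_ne j h
  · rw [← h', right_mem_openSegment_iff, h'] at h; exact hP.edge_ne j h

/-- A point in the open edge `i` lies on no other edge. -/
lemma notMem_other_edge (hP : P.IsSimple) {i j : Fin n} (hij : j ≠ i) {z : Plane}
    (hz : z ∈ openSegment ℝ (P i) (P (finRotate n i))) :
    z ∉ segment ℝ (P j) (P (finRotate n j)) := by
  intro h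
  rcases hP.eq_vertex_of_mem_edges hij h (openSegment_subset_segment _ _ _ hz) with
    ⟨-, h'⟩ | ⟨-, h'⟩ <;> exact hP.vertex_notMem_openSegment_edge _ _ (h' ▸ hz)

end IsSimple

lemma mem_segment_cases {p q z : Plane} (h : z ∈ segment ℝ p q) :
    z = p ∨ z = q ∨ z ∈ openSegment ℝ p q := by
  rw [← insert_endpoints_openSegment] at h
  exact h

lemma segment_split {p q z : Plane} (h : z ∈ openSegment ℝ p q) (hpq : p ≠ q) :
    segment ℝ p q = segment ℝ z p ∪ segment ℝ z q ∧ segment ℝ z p ∩ segment ℝ z q = {z} := by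
  have hz := openSegment_subset_segment _ _ _ h
  rw [openSegment_eq_image_lineMap] at h
  obtain ⟨s, ⟨hs0, hs1⟩, hs⟩ := h
  have hs' : z = p + s • (q - p) := by rw [← hs, AffineMap.lineMap_apply_module]; module
  constructor
  · apply Subset.antisymm
    · intro w hw
      rw [segment_eq_image_lineMap] at hw
      obtain ⟨t, ⟨ht0, ht1⟩, ht⟩ := hw
      have hw' : w = p + t • (q - p) := by rw [← ht, AffineMap.lineMap_apply_module]; module
      rcases le_total t s with hts | hts
      · left
        rw [segment_symm, segment_eq_image_lineMap]
        refine ⟨t / s, ⟨by positivity, (div_le_one hs0).2 hts⟩, ?_⟩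
        have : t / s * s = t := by field_simp
        rw [AffineMap.lineMap_apply_module, hs', hw']
        nth_rewrite 3 [← this]
        module
      · right
        have h1s : 0 < 1 - s := by linarith
        rw [segment_eq_image_lineMap]
        refine ⟨(t - s) / (1 - s), ⟨div_nonneg (by linarith) h1s.le,
          (div_le_one h1s).2 (by linarith)⟩, ?_⟩
        have : t = (t - s) / (1 - s) * (1 - s) + s := by field_simp; ring
        rw [AffineMap.lineMap_apply_module, hs', hw']
        generalize (t - s) / (1 - s) = c at this
        rw [this]
        module
    · exact union_subset ((convex_segment p q).segment_subset hz (left_mem_segment _ _ _))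
        ((convex_segment p q).segment_subset hz (right_mem_segment _ _ _))
  · apply Subset.antisymm
    · rintro w ⟨h1, h2⟩
      rw [segment_eq_image_lineMap] at h1 h2
      obtain ⟨t, ⟨ht0, -⟩, ht⟩ := h1
      obtain ⟨t', ⟨ht0', -⟩, ht'⟩ := h2
      have e1 : w = z + (-(t * s)) • (q - p) := by
        rw [← ht, AffineMap.lineMap_apply_module, hs']; module
      have e2 : w = z + (t' * (1 - s)) • (q - p) := by
        rw [← ht', AffineMap.lineMap_apply_module, hs']; module
      have e3 : (-(t * s)) • (q - p) = (t' * (1 - s)) • (q - p) := by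
        have := e1.symm.trans e2
        exact add_left_cancel this
      have e4 := smul_left_injective ℝ (sub_ne_zero.2 hpq.symm) e3
      have e5 : t * s = 0 := by
        have : 0 ≤ t' * (1 - s) := mul_nonneg ht0' (by linarith)
        have : 0 ≤ t * s := by positivity
        have e6 : -(t * s) = t' * (1 - s) := e4
        linarith
      rw [e1, e5]; simp
    · rintro w rfl
      exact ⟨left_mem_segment _ _ _, left_mem_segment _ _ _⟩

/-- Near each of its points, the boundary consists of two segments. -/
lemma IsSimple.exists_local_segments {P : Polygon Plane n} (hP : P.IsSimple) {p : Plane}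
    (hp : p ∈ P.boundary ℝ) : ∃ q₁ q₂ : Plane, q₁ ≠ p ∧ q₂ ≠ p ∧
      segment ℝ p q₁ ∩ segment ℝ p q₂ = {p} ∧ ∃ ε > 0, ∀ z ∈ Metric.ball p ε,
        (z ∈ P.boundary ℝ ↔ z ∈ segment ℝ p q₁ ∪ segment ℝ p q₂) := by
  have hball : ∀ J : Set (Fin n), (∀ j ∈ J, p ∉ segment ℝ (P j) (P (finRotate n j))) →
      ∃ ε > 0, ∀ z ∈ Metric.ball p ε, ∀ j ∈ J, z ∉ segment ℝ (P j) (P (finRotate n j)) := by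
    intro J hJ
    have : ∀ᶠ z in 𝓝 p, ∀ j, j ∈ J → z ∉ segment ℝ (P j) (P (finRotate n j)) := by
      rw [eventually_all]
      intro j
      by_cases hj : j ∈ J
      · filter_upwards [(isClosed_segment _ _).isOpen_compl.mem_nhds (hJ j hj)] with z hz _
        exact hz
      · simp [hj]
    exact Metric.eventually_nhds_iff_ball.1 this
  by_cases hv : ∃ i, p = P (finRotate n i)
  · obtain ⟨i, rfl⟩ := hv
    obtain ⟨ε, hε, h⟩ := hball {j | j ≠ i ∧ j ≠ finRotate n i} (by
      rintro j ⟨h1, h2⟩ h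
      rcases hP.vertex_mem_edge h with h | h
      · exact h2 h.symm
      · exact h1 ((finRotate n).injective h).symm)
    refine ⟨P i, P (finRotate n (finRotate n i)), hP.edge_ne i, (hP.edge_ne _).symm, ?_, ε, hε, ?_⟩
    · have := hP.consecutive i
      rwa [edgeSet_eq, edgeSet_eq, segment_symm] at this
    · intro z hz
      rw [mem_boundary, segment_symm ℝ _ (P i)]
      constructor
      · rintro ⟨j, hj⟩
        by_cases h1 : j = i
        · subst h1; exact Or.inl hj
        by_cases h2 : j = finRotate n i
        · subst h2; exact Or.inr hj
        exact absurd hj (h z hz j ⟨h1, h2⟩)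
      · rintro (h | h)
        · exact ⟨_, h⟩
        · exact ⟨_, h⟩
  · push Not at hv
    obtain ⟨i, hi⟩ := (mem_boundary P).1 hp
    have hpo : p ∈ openSegment ℝ (P i) (P (finRotate n i)) := by
      rcases mem_segment_cases hi with h | h | h
      · exact absurd (by rw [h, Equiv.apply_symm_apply]) (hv ((finRotate n).symm i))
      · exact absurd h (hv i)
      · exact h
    obtain ⟨ε, hε, h⟩ := hball {j | j ≠ i} fun j hj => hP.notMem_other_edge hj hpo
    obtain ⟨e1, e2⟩ := segment_split hpo (hP.edge_ne i)
    refine ⟨P i, P (finRotate n i), ?_, ?_, e2, ε, hε, ?_⟩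
    · rintro h
      exact hv ((finRotate n).symm i) (by rw [Equiv.apply_symm_apply, h])
    · exact fun h => hv i h.symm
    · intro z hz
      rw [mem_boundary, ← e1]
      constructor
      · rintro ⟨j, hj⟩
        by_cases h1 : j = i
        · subst h1; exact hj
        exact absurd hj (h z hz j h1)
      · exact fun h => ⟨_, h⟩

lemma IsSimple.locallyTwoSided {P : Polygon Plane n} (hP : P.IsSimple) :
    LocallyTwoSided (P.boundary ℝ) := by
  intro p hp
  obtain ⟨q₁, q₂, h₁, h₂, hinter, ε, hε, hloc⟩ := hP.exists_local_segments hp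
  set δ := min ε (min (dist q₁ p) (dist q₂ p)) with hδ
  have hδ0 : 0 < δ := lt_min hε (lt_min (dist_pos.2 h₁) (dist_pos.2 h₂))
  have hδε : δ ≤ ε := min_le_left _ _
  obtain ⟨S₁, S₂, c₁, c₂, hu, hc₁, hc₂⟩ := sectors hδ0
    ((min_le_right _ _).trans (min_le_left _ _)) ((min_le_right _ _).trans (min_le_right _ _))
    hinter
  have hiff : ∀ z ∈ Metric.ball p δ,
      (z ∈ P.boundary ℝ ↔ z ∈ segment ℝ p q₁ ∪ segment ℝ p q₂) :=
    fun z hz => hloc z (Metric.ball_subset_ball hδε hz)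
  have hsub : Metric.ball p δ ∩ P.boundary ℝ ⊆
      Metric.ball p δ ∩ (segment ℝ p q₁ ∪ segment ℝ p q₂) :=
    fun z hz => ⟨hz.1, (hiff z hz.1).1 hz.2⟩
  refine ⟨Metric.ball p δ, Metric.isOpen_ball, Metric.mem_ball_self hδ0, S₁, S₂, c₁, c₂, ?_,
    hsub.trans hc₁, hsub.trans hc₂⟩
  rw [hu]
  ext z
  constructor
  · exact fun h => ⟨h.1, fun h' => h.2 ((hiff z h.1).1 h')⟩
  · exact fun h => ⟨h.1, fun h' => h.2 ((hiff z h.1).2 h')⟩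

lemma isPreconnected_segment (p q : Plane) : IsPreconnected (segment ℝ p q) :=
  (convex_segment p q).isPreconnected

lemma isPreconnected_boundary (P : Polygon Plane n) : IsPreconnected (P.boundary ℝ) := by
  unfold boundary
  refine IsPreconnected.iUnion_of_reflTransGen
    (fun i => by rw [edgeSet_eq]; exact isPreconnected_segment _ _) ?_
  set r : Fin n → Fin n → Prop := fun i j => (P.edgeSet ℝ i ∩ P.edgeSet ℝ j).Nonempty with hr
  have hstep : ∀ i, r i (finRotate n i) := fun i => ⟨P (finRotate n i), by
    rw [edgeSet_eq, edgeSet_eq]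
    exact ⟨right_mem_segment _ _ _, left_mem_segment _ _ _⟩⟩
  have hsymm : ∀ i j, r i j → r j i := fun i j h => by
    change Set.Nonempty (_ ∩ _); rw [inter_comm]; exact h
  have h0 : ∀ k (hk : k < n), Relation.ReflTransGen r ⟨0, by omega⟩ ⟨k, hk⟩ := by
    intro k
    induction k with
    | zero => intro _; exact Relation.ReflTransGen.refl
    | succ k ih =>
      intro hk
      refine (ih (by omega)).tail ?_
      have := hstep ⟨k, by omega⟩
      have e : finRotate n ⟨k, by omega⟩ = ⟨k + 1, hk⟩ := by
        apply Fin.ext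
        rw [finRotate_val]
        simp only
        split_ifs <;> omega
      rwa [e] at this
  have hs : Std.Symm r := ⟨hsymm⟩
  intro i j
  have h1 := h0 i i.2
  have h2 := h0 j j.2
  exact (Relation.ReflTransGen.stdSymm.symm _ _ h1).trans h2

lemma isPreconnected_norm_gt (R : ℝ) (hR : 0 ≤ R) : IsPreconnected {z : Plane | R < ‖z‖} := by
  have : {z : Plane | R < ‖z‖} =
      (fun x : ℝ × ℝ => polar 0 x.1 x.2) '' Ioi R ×ˢ (univ : Set ℝ) := by
    ext z
    constructor
    · intro hz
      exact ⟨(dist z 0, _), ⟨by rw [mem_Ioi, dist_zero_right]; exact hz, trivial⟩, polar_self 0 z⟩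
    · rintro ⟨⟨r, θ⟩, ⟨hr, -⟩, rfl⟩
      have hr : R < r := hr
      have := dist_polar 0 (hR.trans hr.le) θ
      rw [dist_zero_right] at this
      change R < ‖polar 0 r θ‖
      rw [this]; exact hr
  rw [this]
  exact isPreconnected_polar_image 0 isPreconnected_Ioi isPreconnected_univ

lemma exists_transversal {v : Plane} (hv : v ≠ 0) : ∃ d : Plane, (toC d / toC v).im ≠ 0 := by
  refine ⟨toC.symm (Complex.I * toC v), ?_⟩
  rw [LinearIsometryEquiv.apply_symm_apply, mul_div_cancel_right₀ _ (toC_ne_zero.2 hv)]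
  simp

/-- The Jordan curve theorem for simple polygons, together with the values of the winding
number. -/
lemma IsSimple.jordan {P : Polygon Plane n} (hP : P.IsSimple) :
    ∃ E : Set Plane, IsPreconnected E ∧ E ⊆ (P.boundary ℝ)ᶜ ∧ P.boundary ℝ ⊆ closure E ∧
      ∀ z ∉ P.boundary ℝ,
      (z ∈ E ∧ P.wind z = 0 ∧
        ¬ Bornology.IsBounded (connectedComponentIn (P.boundary ℝ)ᶜ z)) ∨
      (z ∉ E ∧ |P.wind z| = 2 * Real.pi ∧
        Bornology.IsBounded (connectedComponentIn (P.boundary ℝ)ᶜ z)) := by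
  set C := P.boundary ℝ with hC
  have i : Fin n := ⟨0, by have := hP.three_le; omega⟩
  obtain ⟨R', hR'⟩ := exists_wind_eq_zero_of_norm_gt P
  set R := max R' 0
  have hR0 : 0 ≤ R := le_max_right _ _
  have hR : ∀ z, R < ‖z‖ → z ∉ C ∧ P.wind z = 0 := fun z hz => hR' z ((le_max_left _ _).trans_lt hz)
  obtain ⟨z₀, hz₀⟩ := NormedSpace.exists_lt_norm ℝ Plane R
  set O := connectedComponentIn Cᶜ
  have hfar : {z : Plane | R < ‖z‖} ⊆ O z₀ :=
    (isPreconnected_norm_gt R hR0).subset_connectedComponentIn hz₀ fun z hz => (hR z hz).1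
  have hwind : ∀ z, ∀ y ∈ O z, ∀ y' ∈ O z, P.wind y = P.wind y' := fun z y hy y' hy' =>
    wind_eq_of_isPreconnected P isPreconnected_connectedComponentIn
      (disjoint_left.2 fun w hw hwC => connectedComponentIn_subset Cᶜ z hw hwC) hy hy'
  have hunb : ¬ Bornology.IsBounded (O z₀) := by
    intro hb
    obtain ⟨M, hM⟩ := hb.exists_norm_le
    obtain ⟨y, hy⟩ := NormedSpace.exists_lt_norm ℝ Plane (max M R)
    have := hM y (hfar ((le_max_right _ _).trans_lt hy))
    exact absurd ((le_max_left _ _).trans_lt hy) (not_lt.2 this)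
  have hcl : ∀ z ∉ C, C ⊆ closure (O z) := fun z hz =>
    subset_closure_component (isClosed_boundary P) (isPreconnected_boundary P)
      ⟨_, vertex_mem_boundary P i⟩ hP.locallyTwoSided hz
  -- the two sides at the midpoint of an edge
  set m := midpoint ℝ (P i) (P (finRotate n i))
  have hm : m ∈ openSegment ℝ (P i) (P (finRotate n i)) := by
    rw [openSegment_eq_image_lineMap]
    exact ⟨1 / 2, ⟨by norm_num, by norm_num⟩, by
      change AffineMap.lineMap _ _ _ = AffineMap.lineMap _ _ _
      congr 1; norm_num⟩
  have hmC : m ∈ C := (mem_boundary P).2 ⟨i, openSegment_subset_segment _ _ _ hm⟩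
  obtain ⟨B, hB, hmB, T₁, T₂, t₁, t₂, hT, -, -⟩ := hP.locallyTwoSided m hmC
  obtain ⟨d, hd⟩ := exists_transversal (sub_ne_zero.2 (hP.edge_ne i).symm)
  have hjump := wind_jump P (hP.edge_ne i) hm (fun j hj => hP.notMem_other_edge hj hm) hd
  have hBev : ∀ᶠ t in 𝓝[>] (0 : ℝ), m + t • d ∈ B ∧ m - t • d ∈ B := by
    have h1 : Tendsto (fun t : ℝ => m + t • d) (𝓝 0) (𝓝 (m + (0 : ℝ) • d)) :=
      Continuous.tendsto (by fun_prop) 0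
    have h2 : Tendsto (fun t : ℝ => m - t • d) (𝓝 0) (𝓝 (m - (0 : ℝ) • d)) :=
      Continuous.tendsto (by fun_prop) 0
    rw [zero_smul, add_zero] at h1
    rw [zero_smul, sub_zero] at h2
    exact ((h1.eventually (hB.mem_nhds hmB)).and
      (h2.eventually (hB.mem_nhds hmB))).filter_mono nhdsWithin_le_nhds
  obtain ⟨t, ⟨ht1, ht2, ht3⟩, ht4, ht5⟩ := (hjump.and hBev).exists
  -- Every component accumulates at the midpoint `m`, so it contains one of the two sides there:
  -- there are at most two components.
  have hside : ∀ z ∉ C, T₁ ⊆ O z ∨ T₂ ⊆ O z := fun z hz =>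
    side_subset_component rfl hB hmB t₁ t₂ hT (hcl z hz hmC)
  have hTC : ∀ S, S ⊆ T₁ ∪ T₂ → Disjoint S C := fun S hS =>
    disjoint_left.2 fun w hw => by
      have := hS hw
      rw [hT] at this
      exact this.2
  have hpi := Real.pi_pos
  have hdiff : ∃ s₁ ∈ T₁, ∃ s₂ ∈ T₂, |P.wind s₁ - P.wind s₂| = 2 * Real.pi := by
    have m1 : m + t • d ∈ T₁ ∪ T₂ := by rw [hT]; exact ⟨ht4, ht1⟩
    have m2 : m - t • d ∈ T₁ ∪ T₂ := by rw [hT]; exact ⟨ht5, ht2⟩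
    rcases m1 with m1 | m1 <;> rcases m2 with m2 | m2
    · rw [wind_eq_of_isPreconnected P t₁ (hTC _ subset_union_left) m1 m2, sub_self, abs_zero] at ht3
      linarith
    · exact ⟨_, m1, _, m2, ht3⟩
    · exact ⟨_, m2, _, m1, by rw [abs_sub_comm]; exact ht3⟩
    · rw [wind_eq_of_isPreconnected P t₂ (hTC _ subset_union_right) m1 m2, sub_self, abs_zero]
        at ht3
      linarith
  -- A component containing `T₁` is the one that reaches infinity. One containing `T₂` has winding
  -- number ±2π, so it has no points in the far region, where the winding number is zero. The sides
  -- are quantified again because either may be the outer one.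
  have main : ∀ T₁ T₂ : Set Plane, T₁ ⊆ O z₀ → (∀ z ∉ C, T₁ ⊆ O z ∨ T₂ ⊆ O z) →
      (∃ s₁ ∈ T₁, ∃ s₂ ∈ T₂, |P.wind s₁ - P.wind s₂| = 2 * Real.pi) → ∀ z ∉ C,
      (z ∈ O z₀ ∧ P.wind z = 0 ∧ ¬ Bornology.IsBounded (O z)) ∨
      (z ∉ O z₀ ∧ |P.wind z| = 2 * Real.pi ∧ Bornology.IsBounded (O z)) := by
    rintro T₁ T₂ hT₁ hside ⟨s₁, hs₁, s₂, hs₂, hs⟩ z hz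
    have w0 : ∀ y ∈ O z₀, P.wind y = 0 := fun y hy => by
      rw [hwind z₀ y hy z₀ (hfar hz₀), (hR z₀ hz₀).2]
    have hzz : z ∈ O z := mem_connectedComponentIn hz
    rcases hside z hz with h | h
    · left
      have e : O z = O z₀ := by
        have e1 : O z₀ = O s₁ := connectedComponentIn_eq (hT₁ hs₁)
        have e2 : O z = O s₁ := connectedComponentIn_eq (h hs₁)
        rw [e1, e2]
      exact ⟨e ▸ hzz, w0 z (e ▸ hzz), by rw [e]; exact hunb⟩
    · right
      have wz : |P.wind z| = 2 * Real.pi := by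
        rw [w0 s₁ (hT₁ hs₁), zero_sub, abs_neg] at hs
        rw [hwind z z hzz s₂ (h hs₂)]; exact hs
      refine ⟨fun hz' => ?_, wz, ?_⟩
      · rw [w0 z hz', abs_zero] at wz; linarith
      · by_contra hnb
        have : ∃ y ∈ O z, R < ‖y‖ := by
          by_contra hcon
          push Not at hcon
          exact hnb (isBounded_iff_forall_norm_le.2 ⟨R, hcon⟩)
        obtain ⟨y, hy, hyR⟩ := this
        rw [hwind z z hzz y hy, (hR y hyR).2, abs_zero] at wz
        linarith
  refine ⟨O z₀, isPreconnected_connectedComponentIn, connectedComponentIn_subset _ _, hcl z₀ (hR z₀ hz₀).1, ?_⟩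
  rcases hside z₀ (hR z₀ hz₀).1 with h | h
  · exact main T₁ T₂ h hside hdiff
  · refine main T₂ T₁ h (fun z hz => (hside z hz).symm) ?_
    obtain ⟨s₁, hs₁, s₂, hs₂, hs⟩ := hdiff
    exact ⟨s₂, hs₂, s₁, hs₁, by rw [abs_sub_comm]; exact hs⟩

/-- The points that are not in the exterior. -/
def body (P : Polygon Plane n) : Set Plane := P.exteriorᶜ

lemma boundary_subset_body (P : Polygon Plane n) : P.boundary ℝ ⊆ P.body :=
  fun _ hz h => h.1 hz

/-! ### The exterior in terms of the winding number -/

namespace IsSimple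

variable {P : Polygon Plane n}

/-- This trades unboundedness of a component for a number that is additive under division of the
polygon. -/
lemma mem_exterior_iff (hP : P.IsSimple) {z : Plane} (hz : z ∉ P.boundary ℝ) :
    z ∈ P.exterior ↔ P.wind z = 0 := by
  obtain ⟨E, -, -, -, hE⟩ := hP.jordan
  have hpi := Real.pi_pos
  rcases hE z hz with ⟨-, h1, h2⟩ | ⟨-, h1, h2⟩
  · exact ⟨fun _ => h1, fun _ => ⟨hz, h2⟩⟩
  · refine ⟨fun h => absurd h2 h.2, fun h => ?_⟩
    rw [h, abs_zero] at h1; linarith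

lemma wind_cases (hP : P.IsSimple) {z : Plane} (hz : z ∉ P.boundary ℝ) :
    P.wind z = 0 ∨ P.wind z = 2 * Real.pi ∨ P.wind z = -(2 * Real.pi) := by
  obtain ⟨E, -, -, -, hE⟩ := hP.jordan
  rcases hE z hz with ⟨-, h1, h2⟩ | ⟨-, h1, h2⟩
  · exact Or.inl h1
  · exact Or.inr (eq_or_eq_neg_of_abs_eq h1)

lemma exterior_connected (hP : P.IsSimple) :
    IsPreconnected P.exterior ∧ P.boundary ℝ ⊆ closure P.exterior := by
  obtain ⟨E, h1, h0, h2, hE⟩ := hP.jordan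
  have : P.exterior = E := by
    ext z
    constructor
    · intro hz
      rcases hE z hz.1 with ⟨h3, -⟩ | ⟨-, -, h3⟩
      · exact h3
      · exact absurd h3 hz.2
    · intro hz
      rcases hE z (h0 hz) with ⟨-, -, h3⟩ | ⟨h3, -⟩
      · exact ⟨h0 hz, h3⟩
      · exact absurd hz h3
  rw [this]
  exact ⟨h1, h2⟩

lemma isClosed_body (hP : P.IsSimple) : IsClosed P.body := by
  rw [body, isClosed_compl_iff, isOpen_iff_mem_nhds]
  intro z hz
  filter_upwards [eventually_wind_eq P hz.1] with y hy
  rw [hP.mem_exterior_iff hy.1, hy.2]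
  exact (hP.mem_exterior_iff hz.1).1 hz

end IsSimple

end Polygon

namespace Polygon

open Set Filter Topology

/-! ### Dividing a polygon along a diagonal -/

variable {n k l : ℕ}

/-- The increasing enumeration of the vertices between `a` and `b` in the cyclic order. -/
structure IsArc (a b : Fin n) (f : Fin k → Fin n) : Prop where
  strictMono : StrictMono f
  mem_iff : ∀ w, (∃ i, f i = w) ↔ btw a w b

namespace IsArc

variable {a b : Fin n} {f : Fin k → Fin n}

lemma btw_apply (hf : IsArc a b f) (i : Fin k) : btw a (f i) b := (hf.mem_iff _).1 ⟨i, rfl⟩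

lemma injective (hf : IsArc a b f) : Function.Injective f := hf.strictMono.injective

/-- If `b < a`, the increasing enumeration starts at 0 rather than at `a`. The cyclic successor is
still right, since the last index then enumerates `n - 1`. Hence the case distinction on the last
index. -/
lemma rotate (hf : IsArc a b f) (hab : a ≠ b) (i : Fin k) :
    f (finRotate k i) = if f i = b then a else finRotate n (f i) := by
  set y := if f i = b then a else finRotate n (f i) with hy
  have hab' : a.val ≠ b.val := fun h => hab (Fin.ext h)
  have hx := btw_iff_val.1 (hf.btw_apply i)
  have hz := btw_iff_val.1 (hf.btw_apply (finRotate k i))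
  have hyv : y.val = if (f i).val = b.val then a.val else
      if (f i).val + 1 = n then 0 else (f i).val + 1 := by
    rw [hy, apply_ite Fin.val, finRotate_val]
    simp only [Fin.ext_iff]
  have ha := a.2
  have hb := b.2
  have hfi := (f i).2
  have hyb : btw a y b := by
    rw [btw_iff_val]; split_ifs at hyv <;> omega
  have hyb' := btw_iff_val.1 hyb
  apply Fin.ext
  have hmono : ∀ i j : Fin k, i.val ≤ j.val → (f i).val ≤ (f j).val := fun i j h =>
    hf.strictMono.monotone h
  have hσ := finRotate_val i
  have hik := i.2
  by_cases hlast : i.val + 1 = k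
  · rw [if_pos hlast] at hσ
    have hmin : ∀ w, btw a w b → (f (finRotate k i)).val ≤ w.val := by
      intro w hw
      obtain ⟨j, rfl⟩ := (hf.mem_iff w).2 hw
      exact hmono _ _ (by omega)
    have hmax : ∀ w, btw a w b → w.val ≤ (f i).val := by
      intro w hw
      obtain ⟨j, rfl⟩ := (hf.mem_iff w).2 hw
      exact hmono _ _ (by have := j.2; omega)
    have h1 := hmin a (btw_iff_val.2 (by omega))
    have h2 := hmax b (btw_iff_val.2 (by omega))
    have h3 : b.val < a.val → (f (finRotate k i)).val ≤ 0 := fun h =>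
      hmin ⟨0, by omega⟩ (btw_iff_val.2 (by simp only; omega))
    have h4 : b.val < a.val → n - 1 ≤ (f i).val := fun h =>
      hmax ⟨n - 1, by omega⟩ (btw_iff_val.2 (by simp only; omega))
    split_ifs at hyv <;> omega
  · rw [if_neg hlast] at hσ
    have h1 : (f i).val < (f (finRotate k i)).val := hf.strictMono (Fin.lt_def.2 (by omega))
    obtain ⟨j, hj⟩ := (hf.mem_iff y).2 hyb
    have h2 : y.val ≤ (f i).val ∨ (f (finRotate k i)).val ≤ y.val := by
      rw [← hj]
      rcases le_or_gt j.val i.val with h | h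
      · exact Or.inl (hmono _ _ h)
      · exact Or.inr (hmono _ _ (by omega))
    have h3 := (f (finRotate k i)).2
    split_ifs at hyv <;> omega

end IsArc

/-- The polygon with vertices `P (f 0), P (f 1), …`. -/
def comp (P : Polygon Plane n) (f : Fin k → Fin n) : Polygon Plane k := ⟨fun i => P (f i)⟩

@[simp] lemma comp_apply (P : Polygon Plane n) (f : Fin k → Fin n) (i : Fin k) :
    (P.comp f) i = P (f i) := rfl

/-- A diagonal: a chord whose relative interior misses the boundary. -/
structure IsDiagonal (P : Polygon Plane n) (a b : Fin n) : Prop where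
  ne : a ≠ b
  ne_rotate : b ≠ finRotate n a
  ne_rotate' : a ≠ finRotate n b
  disjoint_boundary : Disjoint (openSegment ℝ (P a) (P b)) (P.boundary ℝ)
  disjoint_exterior : Disjoint (openSegment ℝ (P a) (P b)) P.exterior

lemma IsDiagonal.symm {P : Polygon Plane n} {a b : Fin n} (h : P.IsDiagonal a b) :
    P.IsDiagonal b a :=
  ⟨h.ne.symm, h.ne_rotate', h.ne_rotate, by rw [openSegment_symm]; exact h.disjoint_boundary,
    by rw [openSegment_symm]; exact h.disjoint_exterior⟩

variable {P : Polygon Plane n} {a b : Fin n} {f : Fin k → Fin n} {g : Fin l → Fin n}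

lemma mem_segment_diagonal (hd : P.IsDiagonal a b) {z : Plane}
    (hz : z ∈ segment ℝ (P a) (P b)) (hzC : z ∈ P.boundary ℝ) : z = P a ∨ z = P b := by
  rcases mem_segment_cases hz with h | h | h
  · exact Or.inl h
  · exact Or.inr h
  · exact absurd hzC (disjoint_left.1 hd.disjoint_boundary h)

lemma segment_diagonal_subset_body (hd : P.IsDiagonal a b) :
    segment ℝ (P a) (P b) ⊆ P.body := by
  intro z hz
  rcases mem_segment_cases hz with h | h | h
  · rw [h]; exact boundary_subset_body _ (vertex_mem_boundary _ _)
  · rw [h]; exact boundary_subset_body _ (vertex_mem_boundary _ _)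
  · exact disjoint_left.1 hd.disjoint_exterior h

lemma mem_boundary_comp (hf : IsArc a b f) (hab : a ≠ b) {z : Plane} :
    z ∈ (P.comp f).boundary ℝ ↔ z ∈ segment ℝ (P a) (P b) ∨
      ∃ w, btw a w b ∧ w ≠ b ∧ z ∈ segment ℝ (P w) (P (finRotate n w)) := by
  rw [mem_boundary]
  simp only [comp_apply]
  constructor
  · rintro ⟨i, hi⟩
    rw [hf.rotate hab] at hi
    split_ifs at hi with h
    · rw [h, segment_symm] at hi; exact Or.inl hi
    · exact Or.inr ⟨f i, hf.btw_apply i, h, hi⟩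
  · rintro (h | ⟨w, h1, h2, h3⟩)
    · obtain ⟨i, hi⟩ := (hf.mem_iff b).2 (btw_refl_right a b)
      exact ⟨i, by rw [hf.rotate hab, if_pos hi, hi, segment_symm]; exact h⟩
    · obtain ⟨i, rfl⟩ := (hf.mem_iff w).2 h1
      exact ⟨i, by rw [hf.rotate hab, if_neg h2]; exact h3⟩

lemma btw_or_btw_swap (a w b : Fin n) : btw a w b ∨ btw b w a := btw_total a w b

lemma eq_or_eq_of_btw_of_btw {a w b : Fin n} (h₁ : btw a w b) (h₂ : btw b w a) (hab : a ≠ b) :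
    w = a ∨ w = b := by
  have hab' : a.val ≠ b.val := fun h => hab (Fin.ext h)
  rw [btw_iff_val] at h₁ h₂
  rw [Fin.ext_iff, Fin.ext_iff]
  omega

lemma boundary_subset_union (hf : IsArc a b f) (hg : IsArc b a g) (hab : a ≠ b) :
    P.boundary ℝ ⊆ (P.comp f).boundary ℝ ∪ (P.comp g).boundary ℝ := by
  intro z hz
  obtain ⟨w, hw⟩ := (mem_boundary P).1 hz
  rw [mem_union, mem_boundary_comp hf hab, mem_boundary_comp hg hab.symm]
  by_cases hwb : w = b
  · exact Or.inr (Or.inr ⟨w, hwb ▸ btw_refl_left b a, hwb ▸ hab.symm, hw⟩)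
  by_cases hwa : w = a
  · exact Or.inl (Or.inr ⟨w, hwa ▸ btw_refl_left a b, hwb, hw⟩)
  rcases btw_or_btw_swap a w b with h | h
  · exact Or.inl (Or.inr ⟨w, h, hwb, hw⟩)
  · exact Or.inr (Or.inr ⟨w, h, hwa, hw⟩)

lemma boundary_comp_subset (hf : IsArc a b f) (hab : a ≠ b) :
    (P.comp f).boundary ℝ ⊆ P.boundary ℝ ∪ segment ℝ (P a) (P b) := by
  intro z hz
  rcases (mem_boundary_comp hf hab).1 hz with h | ⟨w, -, -, h⟩
  · exact Or.inr h
  · exact Or.inl ((mem_boundary P).2 ⟨w, h⟩)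

lemma segment_subset_boundary_comp (hf : IsArc a b f) (hab : a ≠ b) :
    segment ℝ (P a) (P b) ⊆ (P.comp f).boundary ℝ :=
  fun _ hz => (mem_boundary_comp hf hab).2 (Or.inl hz)

lemma wind_comp (hf : IsArc a b f) (hab : a ≠ b) (z : Plane) :
    (P.comp f).wind z = ang (P b) (P a) z +
      ∑ w ∈ Finset.univ.filter (fun w => (∃ i, f i = w) ∧ w ≠ b),
        ang (P w) (P (finRotate n w)) z := by
  classical
  obtain ⟨j, hj⟩ := (hf.mem_iff b).2 (btw_refl_right a b)
  unfold wind
  rw [← Finset.add_sum_erase _ _ (Finset.mem_univ j)]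
  simp only [comp_apply]
  congr 1
  · rw [hf.rotate hab, if_pos hj, hj]
  · refine Finset.sum_bij (fun i _ => f i) ?_ ?_ ?_ ?_
    · intro i hi
      rw [Finset.mem_filter]
      exact ⟨Finset.mem_univ _, ⟨i, rfl⟩, fun h =>
        Finset.ne_of_mem_erase hi (hf.injective (h.trans hj.symm))⟩
    · exact fun i _ j _ h => hf.injective h
    · intro w hw
      obtain ⟨-, ⟨i, rfl⟩, h⟩ := Finset.mem_filter.1 hw
      exact ⟨i, Finset.mem_erase.2 ⟨fun h' => h (by rw [h', hj]), Finset.mem_univ _⟩, rfl⟩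
    · intro i hi
      have : f i ≠ b := fun h => Finset.ne_of_mem_erase hi (hf.injective (h.trans hj.symm))
      rw [hf.rotate hab, if_neg this]

/-- Every edge of `P` belongs to exactly one part, and the dividing segment is traversed once in
each direction. -/
lemma wind_eq_add (hf : IsArc a b f) (hg : IsArc b a g) (hab : a ≠ b) {z : Plane}
    (hz : z ∉ segment ℝ (P a) (P b)) :
    P.wind z = (P.comp f).wind z + (P.comp g).wind z := by
  classical
  rw [wind_comp hf hab, wind_comp hg hab.symm]
  have h1 := ang_add_ang_swap hz
  have h2 : P.wind z = ∑ w ∈ Finset.univ.filter (fun w => (∃ i, f i = w) ∧ w ≠ b),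
        ang (P w) (P (finRotate n w)) z +
      ∑ w ∈ Finset.univ.filter (fun w => (∃ i, g i = w) ∧ w ≠ a),
        ang (P w) (P (finRotate n w)) z := by
    unfold wind
    rw [← Finset.sum_filter_add_sum_filter_not Finset.univ (fun w => (∃ i, f i = w) ∧ w ≠ b)]
    congr 1
    apply Finset.sum_congr _ fun _ _ => rfl
    apply Finset.filter_congr
    intro w _
    rw [hf.mem_iff, hg.mem_iff]
    have hab' : a.val ≠ b.val := fun h => hab (Fin.ext h)
    rw [btw_iff_val, btw_iff_val, Ne, Ne, Fin.ext_iff, Fin.ext_iff]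
    omega
  rw [h2]; linarith

lemma three_le_of_arc (hP : P.IsSimple) (hd : P.IsDiagonal a b) (hf : IsArc a b f) : 3 ≤ k := by
  have hab' : a.val ≠ b.val := fun h => hd.ne (Fin.ext h)
  have h1 := hd.ne_rotate
  have h2 := hd.ne_rotate'
  rw [Ne, Fin.ext_iff, finRotate_val] at h1 h2
  have ha := a.2
  have hb := b.2
  obtain ⟨i, hi⟩ := (hf.mem_iff a).2 (btw_refl_left a b)
  obtain ⟨j, hj⟩ := (hf.mem_iff b).2 (btw_refl_right a b)
  obtain ⟨m, hm⟩ := (hf.mem_iff (finRotate n a)).2 (by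
    rw [btw_iff_val, finRotate_val]; split_ifs at h1 h2 ⊢ <;> omega)
  have h3 : i ≠ j := by rintro rfl; exact hd.ne (hi.symm.trans hj)
  have h4 : m ≠ j := by rintro rfl; exact hd.ne_rotate (hj.symm.trans hm)
  have h5 : m ≠ i := by
    rintro rfl
    exact finRotate_ne_self (by have := hP.three_le; omega) a (hm.symm.trans hi)
  have := i.2
  have := j.2
  have := m.2
  rw [Ne, Fin.ext_iff] at h3 h4 h5
  omega

/-- Dividing a simple polygon along a diagonal yields a simple polygon. -/
lemma IsSimple.comp (hP : P.IsSimple) (hd : P.IsDiagonal a b) (hf : IsArc a b f) :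
    (P.comp f).IsSimple := by
  have hab := hd.ne
  have hrot := hf.rotate hab
  -- The dividing diagonal is the only new edge. It can meet an old edge only in `P a` or `P b`, and
  -- then only if that vertex is an end of the old edge.
  have hseg : ∀ w z, z ∈ segment ℝ (P b) (P a) → z ∈ segment ℝ (P w) (P (finRotate n w)) →
      (z = P a ∧ (a = w ∨ a = finRotate n w)) ∨ (z = P b ∧ (b = w ∨ b = finRotate n w)) := by
    intro w z h1 h2
    rw [segment_symm] at h1
    rcases mem_segment_diagonal hd h1 ((mem_boundary P).2 ⟨w, h2⟩) with h | h
    · exact Or.inl ⟨h, hP.vertex_mem_edge (h ▸ h2)⟩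
    · exact Or.inr ⟨h, hP.vertex_mem_edge (h ▸ h2)⟩
  have hnon : ∀ i j : Fin k, f i = b → j ≠ i → j ≠ finRotate k i → i ≠ finRotate k j →
      Disjoint (segment ℝ (P (f i)) (P (f (finRotate k i))))
        (segment ℝ (P (f j)) (P (f (finRotate k j)))) := by
    intro i j hib h1 h2 h3
    have hjb : f j ≠ b := fun h => h1 (hf.injective (h.trans hib.symm))
    have hja : f j ≠ a := fun h => h2 (hf.injective (by rw [hrot, if_pos hib, h]))
    have e1 : finRotate n (f j) ≠ a := by
      intro h
      have : f (finRotate k j) = f (finRotate k i) := by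
        rw [hrot j, hrot i, if_pos hib, if_neg hjb, h]
      exact h1 ((finRotate k).injective (hf.injective this))
    have e2 : finRotate n (f j) ≠ b := by
      intro h
      have : f (finRotate k j) = f i := by rw [hrot j, if_neg hjb, h, hib]
      exact h3 (hf.injective this).symm
    rw [hrot i, if_pos hib, hrot j, if_neg hjb, hib, disjoint_left]
    intro z hz1 hz2
    rcases hseg _ z hz1 hz2 with ⟨-, h | h⟩ | ⟨-, h | h⟩
    · exact hja h.symm
    · exact e1 h.symm
    · exact hjb h.symm
    · exact e2 h.symm
  refine ⟨three_le_of_arc hP hd hf, fun i j h => hf.injective (hP.injective h), ?_, ?_⟩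
  · intro i
    rw [edgeSet_eq, edgeSet_eq]
    simp only [comp_apply]
    apply Subset.antisymm
    swap
    · rintro z rfl
      exact ⟨right_mem_segment _ _ _, left_mem_segment _ _ _⟩
    rintro z ⟨h1, h2⟩
    rw [mem_singleton_iff]
    rw [hrot (finRotate k i)] at h2
    rw [hrot i] at h1 h2 ⊢
    by_cases hib : f i = b
    · simp only [if_pos hib, if_neg hab] at h1 h2 ⊢
      rw [hib] at h1
      rcases hseg _ z h1 h2 with ⟨h, -⟩ | ⟨-, h | h⟩
      · exact h
      · exact absurd h.symm hab
      · exact absurd h hd.ne_rotate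
    · simp only [if_neg hib] at h1 h2 ⊢
      by_cases hb : finRotate n (f i) = b
      · rw [if_pos hb, hb] at h2
        rw [hb] at h1 ⊢
        rw [← hb] at h1
        rcases hseg _ z h2 h1 with ⟨-, h | h⟩ | ⟨h, -⟩
        · exact absurd (by rw [← hb, ← h]) hd.ne_rotate
        · exact absurd (h.trans hb) hab
        · exact h
      · rw [if_neg hb] at h2
        exact hP.eq_vertex_of_mem_consecutive h1 h2
  · intro i j h1 h2 h3
    rw [edgeSet_eq, edgeSet_eq]
    simp only [comp_apply]
    by_cases hib : f i = b
    · exact hnon i j hib h1 h2 h3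
    by_cases hjb : f j = b
    · exact (hnon j i hjb h1.symm h3 h2).symm
    rw [hrot i, if_neg hib, hrot j, if_neg hjb]
    have := hP.nonconsecutive (f i) (f j) (fun h => h1 (hf.injective h))
      (fun h => h2 (hf.injective (by rw [hrot i, if_neg hib, h])))
      (fun h => h3 (hf.injective (by rw [hrot j, if_neg hjb, h])))
    rwa [edgeSet_eq, edgeSet_eq] at this

/-- The exterior of `P` is connected and misses the boundary of the part, because the diagonal lies
in the body. So the winding number of the part is constant on it, with the value zero taken at a far
point. -/
lemma exterior_subset_exterior_comp (hP : P.IsSimple) (hd : P.IsDiagonal a b)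
    (hf : IsArc a b f) : P.exterior ⊆ (P.comp f).exterior := by
  have hR := hP.comp hd hf
  have hdisj : Disjoint P.exterior ((P.comp f).boundary ℝ) := by
    rw [disjoint_left]
    intro z hz hz'
    rcases boundary_comp_subset hf hd.ne hz' with h | h
    · exact hz.1 h
    · exact segment_diagonal_subset_body hd h hz
  obtain ⟨M₁, hM₁⟩ := exists_wind_eq_zero_of_norm_gt P
  obtain ⟨M₂, hM₂⟩ := exists_wind_eq_zero_of_norm_gt (P.comp f)
  obtain ⟨y, hy⟩ := NormedSpace.exists_lt_norm ℝ Plane (max M₁ M₂)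
  have y1 := hM₁ y ((le_max_left _ _).trans_lt hy)
  have y2 := hM₂ y ((le_max_right _ _).trans_lt hy)
  have hyE : y ∈ P.exterior := (hP.mem_exterior_iff y1.1).2 y1.2
  intro z hz
  rw [hR.mem_exterior_iff (disjoint_left.1 hdisj hz), ← y2.2]
  exact wind_eq_of_isPreconnected _ hP.exterior_connected.1 hdisj hz hyE

lemma body_comp_subset (hP : P.IsSimple) (hd : P.IsDiagonal a b) (hf : IsArc a b f) :
    (P.comp f).body ⊆ P.body :=
  compl_subset_compl.2 (exterior_subset_exterior_comp hP hd hf)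

/-- A boundary point of `P` is a limit of the exterior of `P`, hence of that of the part. Off the
boundary of the part it would then be exterior itself, as the winding number of the part is locally
constant there. -/
lemma body_comp_inter_boundary (hP : P.IsSimple) (hd : P.IsDiagonal a b) (hf : IsArc a b f)
    {z : Plane} (hz : z ∈ P.boundary ℝ) (hzf : z ∈ (P.comp f).body) :
    z ∈ (P.comp f).boundary ℝ := by
  by_contra hcon
  apply hzf
  have h1 : z ∈ closure (P.comp f).exterior :=
    closure_mono (exterior_subset_exterior_comp hP hd hf) (hP.exterior_connected.2 hz)
  obtain ⟨y, hy, hyE⟩ := (mem_closure_iff_frequently.1 h1).and_eventually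
    (eventually_wind_eq _ hcon) |>.exists
  rw [(hP.comp hd hf).mem_exterior_iff hcon, ← hyE.2]
  exact ((hP.comp hd hf).mem_exterior_iff hyE.1).1 hy

/-- The two parts of a divided polygon meet only in the dividing diagonal. -/
lemma body_comp_inter (hP : P.IsSimple) (hd : P.IsDiagonal a b) (hf : IsArc a b f)
    (hg : IsArc b a g) {z : Plane} (h₁ : z ∈ (P.comp f).body) (h₂ : z ∈ (P.comp g).body) :
    z ∈ segment ℝ (P a) (P b) := by
  have hab := hd.ne
  by_contra hz
  by_cases hzC : z ∈ P.boundary ℝ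
  -- Here the point lies on an edge from each of the two arcs. Distinct edges share only a vertex,
  -- which belongs to both closed arcs and so is `P a` or `P b`.
  · have m1 := body_comp_inter_boundary hP hd hf hzC h₁
    have m2 := body_comp_inter_boundary hP hd.symm hg hzC h₂
    rcases (mem_boundary_comp hf hab).1 m1 with h | ⟨w, w1, w2, w3⟩
    · exact hz h
    rcases (mem_boundary_comp hg hab.symm).1 m2 with h | ⟨w', w1', w2', w3'⟩
    · exact hz (by rwa [segment_symm])
    have key : ∀ v, btw a v b → btw b v a → z ≠ P v := by
      rintro v h1 h2 rfl
      rcases eq_or_eq_of_btw_of_btw h1 h2 hab with rfl | rfl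
      · exact hz (left_mem_segment _ _ _)
      · exact hz (right_mem_segment _ _ _)
    have next : ∀ a b w : Fin n, btw a w b → w ≠ b → btw a (finRotate n w) b := by
      intro a b w h1 h2
      have := a.2
      have := b.2
      have := w.2
      rw [Ne, Fin.ext_iff] at h2
      rw [btw_iff_val] at h1 ⊢
      rw [finRotate_val]
      split_ifs <;> omega
    have hne : w ≠ w' := by
      rintro rfl
      rcases eq_or_eq_of_btw_of_btw w1 w1' hab with h | h
      · exact w2' h
      · exact w2 h
    rcases hP.eq_vertex_of_mem_edges hne w3 w3' with ⟨h, h'⟩ | ⟨h, h'⟩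
    · exact key w' (h ▸ next a b w w1 w2) w1' h'
    · exact key w w1 (h ▸ next b a w' w1' w2') h'
  · have m1 : z ∉ (P.comp f).boundary ℝ := fun h =>
      (boundary_comp_subset hf hab h).elim hzC hz
    have m2 : z ∉ (P.comp g).boundary ℝ := fun h =>
      (boundary_comp_subset hg hab.symm h).elim hzC (by rwa [segment_symm])
    have w1 : (P.comp f).wind z ≠ 0 := fun h =>
      h₁ (((hP.comp hd hf).mem_exterior_iff m1).2 h)
    have w2 : (P.comp g).wind z ≠ 0 := fun h =>
      h₂ (((hP.comp hd.symm hg).mem_exterior_iff m2).2 h)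
    have w0 : P.wind z ≠ 0 := fun h => h₁
      (exterior_subset_exterior_comp hP hd hf ((hP.mem_exterior_iff hzC).2 h))
    have hadd := wind_eq_add hf hg hab hz
    have hpi := Real.pi_pos
    -- All three winding numbers are ±2π, but that of `P` is the sum of the other two, which is 0 or
    -- ±4π.
    rcases hP.wind_cases hzC with h | h | h <;>
      rcases (hP.comp hd hf).wind_cases m1 with h' | h' | h' <;>
      rcases (hP.comp hd.symm hg).wind_cases m2 with h'' | h'' | h'' <;>
      first
        | exact w0 h
        | exact w1 h'
        | exact w2 h''
        | (rw [h, h', h''] at hadd; linarith)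

lemma body_subset_union (hP : P.IsSimple) (hd : P.IsDiagonal a b) (hf : IsArc a b f)
    (hg : IsArc b a g) : P.body ⊆ (P.comp f).body ∪ (P.comp g).body := by
  have hab := hd.ne
  intro z hz
  by_cases hzs : z ∈ segment ℝ (P a) (P b)
  · exact Or.inl (boundary_subset_body _ (segment_subset_boundary_comp hf hab hzs))
  by_cases hzC : z ∈ P.boundary ℝ
  · exact (boundary_subset_union hf hg hab hzC).imp (fun h => boundary_subset_body _ h)
      (fun h => boundary_subset_body _ h)
  by_contra hcon
  rw [mem_union, not_or, body, body, notMem_compl_iff, notMem_compl_iff] at hcon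
  obtain ⟨h1, h2⟩ := hcon
  apply hz
  rw [hP.mem_exterior_iff hzC, wind_eq_add hf hg hab hzs,
    ((hP.comp hd hf).mem_exterior_iff h1.1).1 h1,
    ((hP.comp hd.symm hg).mem_exterior_iff h2.1).1 h2, add_zero]

/-! ### Visibility and the parts of a divided polygon -/

lemma mutuallyVisible_iff {p q : Plane} : P.MutuallyVisible p q ↔ segment ℝ p q ⊆ P.body :=
  subset_compl_iff_disjoint_right.symm

/-- A segment in the polygon from one part to the other part meets the diagonal. -/
lemma exists_mem_diagonal (hP : P.IsSimple) (hd : P.IsDiagonal a b) (hf : IsArc a b f)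
    (hg : IsArc b a g) {p q : Plane} (hp : p ∈ (P.comp f).body) (hq : q ∈ (P.comp g).body)
    (hpq : segment ℝ p q ⊆ P.body) : (segment ℝ p q ∩ segment ℝ (P a) (P b)).Nonempty := by
  obtain ⟨z, hz, hz1, hz2⟩ := isPreconnected_closed_iff.1 (isPreconnected_segment p q) _ _
    (hP.comp hd hf).isClosed_body (hP.comp hd.symm hg).isClosed_body
    (hpq.trans (body_subset_union hP hd hf hg)) ⟨p, left_mem_segment _ _ _, hp⟩
    ⟨q, right_mem_segment _ _ _, hq⟩
  exact ⟨z, hz, body_comp_inter hP hd hf hg hz1 hz2⟩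

/-- Segments between two points of a part which lie in the polygon lie in that part. -/
lemma segment_subset_body_comp (hP : P.IsSimple) (hd : P.IsDiagonal a b) (hf : IsArc a b f)
    (hg : IsArc b a g) {p q : Plane} (hp : p ∈ (P.comp f).body) (hq : q ∈ (P.comp f).body)
    (hpq : segment ℝ p q ⊆ P.body) : segment ℝ p q ⊆ (P.comp f).body := by
  intro z hz
  rcases body_subset_union hP hd hf hg (hpq hz) with h | h
  · exact h
  -- If the segment left the part at `z`, it would meet the diagonal on both sides of `z`, at `x`
  -- and `y`. By convexity the diagonal would then contain `z`.
  by_contra hcon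
  have hzs : z ∉ segment ℝ (P a) (P b) := fun h' =>
    hcon (boundary_subset_body _ (segment_subset_boundary_comp hf hd.ne h'))
  have sub1 : segment ℝ p z ⊆ segment ℝ p q :=
    (convex_segment p q).segment_subset (left_mem_segment _ _ _) hz
  have sub2 : segment ℝ q z ⊆ segment ℝ p q :=
    (convex_segment p q).segment_subset (right_mem_segment _ _ _) hz
  obtain ⟨x, hx, hxs⟩ := exists_mem_diagonal hP hd hf hg hp h (sub1.trans hpq)
  obtain ⟨y, hy, hys⟩ := exists_mem_diagonal hP hd hf hg hq h (sub2.trans hpq)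
  apply hzs
  apply (convex_segment (P a) (P b)).segment_subset hys hxs
  rw [mem_segment_iff_wbtw] at hx hy hz ⊢
  exact (hz.trans_left_right hx).symm.trans_left_right hy

end Polygon

namespace Polygon

open Set Filter Topology

/-! ### Existence of a diagonal -/

variable {n : ℕ}

lemma exists_coordinates {e₁ e₂ : Plane} (h : ∀ s t : ℝ, s • e₁ + t • e₂ = 0 → s = 0 ∧ t = 0) :
    ∃ A B : Plane →ₗ[ℝ] ℝ, A e₁ = 1 ∧ A e₂ = 0 ∧ B e₁ = 0 ∧ B e₂ = 1 ∧
      ∀ x, x = A x • e₁ + B x • e₂ := by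
  have hli : LinearIndependent ℝ ![e₁, e₂] := LinearIndependent.pair_iff.2 h
  set b := basisOfLinearIndependentOfCardEqFinrank hli (by simp)
  have hb : ⇑b = ![e₁, e₂] := coe_basisOfLinearIndependentOfCardEqFinrank _ _
  have b0 : b 0 = e₁ := by rw [hb]; rfl
  have b1 : b 1 = e₂ := by rw [hb]; rfl
  refine ⟨b.coord 0, b.coord 1, ?_, ?_, ?_, ?_, ?_⟩
  · rw [← b0]; simp
  · rw [← b1]; simp
  · rw [← b0]; simp
  · rw [← b1]; simp
  · intro x
    have := b.sum_repr x
    rw [Fin.sum_univ_two, b0, b1] at this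
    exact this.symm

/-- With `A`, `B` as coordinates about `v`, the point `m` lies in the triangle `A, B > 0`, `A + B ≤
1`, while `p` lies below the line `A + B = 1` but outside the closed cone. So the segment must enter
through one of the two sides at `v`; `A + B ≤ 1` persists by convexity. -/
lemma exists_exit_point (A B : Plane →ₗ[ℝ] ℝ) {v p q m : Plane} (hm : m ∈ segment ℝ p q)
    (hA : 0 < A (m - v)) (hB : 0 < B (m - v)) (hs : A (m - v) + B (m - v) ≤ 1)
    (hp : A (p - v) + B (p - v) ≤ 1) (hneg : A (p - v) < 0 ∨ B (p - v) < 0) :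
    ∃ m' ∈ openSegment ℝ p q,
      (A (m' - v) = 0 ∧ 0 ≤ B (m' - v) ∧ B (m' - v) ≤ 1) ∨
      (B (m' - v) = 0 ∧ 0 ≤ A (m' - v) ∧ A (m' - v) ≤ 1) := by
  rw [segment_eq_image_lineMap] at hm
  obtain ⟨c, ⟨hc0, hc1⟩, hc⟩ := hm
  have hmp : m = p + c • (q - p) := by rw [← hc, AffineMap.lineMap_apply_module]; module
  have hc0' : 0 < c := by
    rcases hc0.eq_or_lt with h | h
    · exfalso
      rw [← h, zero_smul, add_zero] at hmp
      subst hmp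
      rcases hneg with h | h <;> linarith
    · exact h
  have hopen : ∀ τ : ℝ, 0 < τ → τ < 1 → p + τ • (m - p) ∈ openSegment ℝ p q := by
    intro τ h0 h1
    rw [openSegment_eq_image_lineMap]
    refine ⟨τ * c, ⟨by positivity, by nlinarith⟩, ?_⟩
    rw [AffineMap.lineMap_apply_module, hmp]; module
  have hlin : ∀ (L : Plane →ₗ[ℝ] ℝ) (τ : ℝ), L (p + τ • (m - p) - v) =
      L (p - v) + τ * (L (m - v) - L (p - v)) := by
    intro L τ
    have : p + τ • (m - p) - v = (p - v) + τ • ((m - v) - (p - v)) := by module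
    rw [this, map_add, map_smul, map_sub L (m - v), smul_eq_mul]
  set a₀ := A (p - v)
  set a₁ := A (m - v)
  set b₀ := B (p - v)
  set b₁ := B (m - v)
  -- the last parameter at which a coordinate is not positive
  have key : ∃ τ : ℝ, 0 < τ ∧ τ < 1 ∧
      ((a₀ + τ * (a₁ - a₀) = 0 ∧ 0 ≤ b₀ + τ * (b₁ - b₀)) ∨
       (b₀ + τ * (b₁ - b₀) = 0 ∧ 0 ≤ a₀ + τ * (a₁ - a₀))) := by
    have step : ∀ a₀ a₁ b₀ b₁ : ℝ, 0 < a₁ → 0 < b₁ → a₀ < 0 → b₀ * a₁ ≥ a₀ * b₁ →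
        ∃ τ : ℝ, 0 < τ ∧ τ < 1 ∧ a₀ + τ * (a₁ - a₀) = 0 ∧ 0 ≤ b₀ + τ * (b₁ - b₀) := by
      intro a₀ a₁ b₀ b₁ ha hb ha0 h
      have hpos : 0 < a₁ - a₀ := by linarith
      refine ⟨-a₀ / (a₁ - a₀), div_pos (by linarith) hpos, (div_lt_one hpos).2 (by linarith), ?_, ?_⟩
      · field_simp; ring
      · have : b₀ + -a₀ / (a₁ - a₀) * (b₁ - b₀) = (b₀ * a₁ - a₀ * b₁) / (a₁ - a₀) := by
          field_simp; ring
        rw [this]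
        exact div_nonneg (by linarith) hpos.le
    -- The comparison decides which coordinate is the last to become positive on the way from `p` to
    -- `m`.
    rcases le_total (a₀ * b₁) (b₀ * a₁) with h | h
    · have ha0 : a₀ < 0 := by
        rcases hneg with h' | h'
        · exact h'
        · by_contra hcon
          push Not at hcon
          nlinarith [mul_nonneg hcon hB.le, mul_neg_of_neg_of_pos h' hA]
      obtain ⟨τ, h1, h2, h3, h4⟩ := step a₀ a₁ b₀ b₁ hA hB ha0 h
      exact ⟨τ, h1, h2, Or.inl ⟨h3, h4⟩⟩
    · have hb0 : b₀ < 0 := by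
        rcases hneg with h' | h'
        · by_contra hcon
          push Not at hcon
          nlinarith [mul_nonneg hcon hA.le, mul_neg_of_neg_of_pos h' hB]
        · exact h'
      obtain ⟨τ, h1, h2, h3, h4⟩ := step b₀ b₁ a₀ a₁ hB hA hb0 h
      exact ⟨τ, h1, h2, Or.inr ⟨h3, h4⟩⟩
  obtain ⟨τ, h0, h1, h⟩ := key
  have hsum : (a₀ + τ * (a₁ - a₀)) + (b₀ + τ * (b₁ - b₀)) ≤ 1 := by nlinarith
  refine ⟨_, hopen τ h0 h1, ?_⟩
  rw [hlin, hlin]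
  rcases h with ⟨h2, h3⟩ | ⟨h2, h3⟩
  · exact Or.inl ⟨h2, h3, by linarith⟩
  · exact Or.inr ⟨h2, h3, by linarith⟩

lemma im_ne_zero_of_independent {e₁ e₂ : Plane}
    (h : ∀ s t : ℝ, s • e₁ + t • e₂ = 0 → s = 0 ∧ t = 0) :
    (toC e₁ / toC e₂).im ≠ 0 := by
  intro him
  have he₂ : e₂ ≠ 0 := by
    rintro rfl
    exact one_ne_zero (h 0 1 (by simp)).2
  set r := (toC e₁ / toC e₂).re
  have h1 : toC e₁ / toC e₂ = (r : ℂ) := by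
    apply Complex.ext
    · simp [r]
    · rw [him, Complex.ofReal_im]
  rw [div_eq_iff (toC_ne_zero.2 he₂), ← Complex.real_smul, ← map_smul] at h1
  have h2 := toC.injective h1
  exact one_ne_zero (h 1 (-r) (by rw [h2]; module)).1

lemma ball_lineMap_tendsto (v d : Plane) {ε : ℝ} (hε : 0 < ε) :
    ∀ᶠ t in 𝓝[>] (0 : ℝ), v + t • d ∈ Metric.ball v ε := by
  have h1 : Tendsto (fun t : ℝ => v + t • d) (𝓝 0) (𝓝 (v + (0 : ℝ) • d)) :=
    Continuous.tendsto (by fun_prop) 0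
  rw [zero_smul, add_zero] at h1
  exact (h1.eventually (Metric.ball_mem_nhds v hε)).filter_mono nhdsWithin_le_nhds

/-- Near a vertex whose boundary angle lies in the half plane `0 ≤ B`, and which is adjacent to
the exterior in the half plane `B < 0`, the points inside of the angle are not in the exterior. -/
lemma exists_wind_ne_zero {P : Polygon Plane n} (hP : P.IsSimple) {j : Fin n} {v e e' : Plane}
    (hj : openSegment ℝ (P j) (P (finRotate n j)) = openSegment ℝ v (v + e))
    (him : (toC e' / toC (P (finRotate n j) - P j)).im ≠ 0)
    {A B : Plane →ₗ[ℝ] ℝ} (hAe : A e = 1) (hAe' : A e' = 0) (hBe : B e = 0) (hBe' : B e' = 1)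
    {ε : ℝ} (hε : 0 < ε) (hloc : ∀ z ∈ Metric.ball v ε, z ∈ P.boundary ℝ → 0 ≤ B (z - v))
    {o : Plane} (ho : o ∈ Metric.ball v ε) (hoB : B (o - v) < 0) (how : P.wind o = 0)
    {δ : ℝ} (hδ : 0 < δ) :
    ∃ m, 0 < A (m - v) ∧ 0 < B (m - v) ∧ A (m - v) + B (m - v) < δ ∧ P.wind m ≠ 0 := by
  have hρ : ∀ᶠ ρ in 𝓝[>] (0 : ℝ), v + ρ • e ∈ Metric.ball v ε ∧ ρ < 1 ∧ ρ < δ ∧ 0 < ρ :=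
    (ball_lineMap_tendsto v e hε).and
      (((eventually_lt_nhds one_pos).filter_mono nhdsWithin_le_nhds).and
        (((eventually_lt_nhds hδ).filter_mono nhdsWithin_le_nhds).and self_mem_nhdsWithin))
  obtain ⟨ρ, hρ1, hρ2, hρ3, hρ4⟩ := hρ.exists
  set q := v + ρ • e with hq
  have hqo : q ∈ openSegment ℝ (P j) (P (finRotate n j)) := by
    rw [hj, openSegment_eq_image_lineMap]
    exact ⟨ρ, ⟨hρ4, hρ2⟩, by rw [AffineMap.lineMap_apply_module, hq]; module⟩
  have hjump := wind_jump P (hP.edge_ne j) hqo (fun i hi => hP.notMem_other_edge hi hqo) him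
  obtain ⟨ε', hε', hball⟩ := Metric.isOpen_iff.1 Metric.isOpen_ball q hρ1
  have hsmall : ∀ᶠ t in 𝓝[>] (0 : ℝ), t < δ - ρ :=
    (eventually_lt_nhds (by linarith)).filter_mono nhdsWithin_le_nhds
  obtain ⟨t, ⟨⟨t1, t2, t3⟩, t4, t5⟩, t6⟩ :=
    ((hjump.and ((ball_lineMap_tendsto q (-e') hε').and hsmall)).and self_mem_nhdsWithin).exists
  have t6 : 0 < t := t6
  rw [smul_neg, ← sub_eq_add_neg] at t4
  have t4' := hball t4
  -- This half disc misses the boundary and contains both `o` and `q - t • e'`, so the winding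
  -- number vanishes at the latter. The jump across the edge makes it nonzero at `q + t • e'`.
  set H : Set Plane := Metric.ball v ε ∩ {z | B z < B v} with hH
  have hHc : Convex ℝ H := (convex_ball v ε).inter (convex_halfSpace_lt B.isLinear _)
  have hHd : Disjoint H (P.boundary ℝ) := by
    rw [disjoint_left]
    rintro z ⟨hz1, hz2⟩ hz3
    have := hloc z hz1 hz3
    rw [map_sub] at this
    have hz2 : B z < B v := hz2
    linarith
  have w0 : P.wind (q - t • e') = 0 := by
    rw [← how]
    apply wind_eq_of_isPreconnected P hHc.isPreconnected hHd
    · refine ⟨t4', ?_⟩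
      change B _ < B v
      rw [hq]
      simp only [map_sub, map_add, map_smul, hBe, hBe', smul_eq_mul]
      linarith
    · rw [map_sub] at hoB
      exact ⟨ho, by change B o < B v; linarith⟩
  rw [w0, sub_zero] at t3
  have eA : A (q + t • e' - v) = ρ := by
    rw [hq]; simp only [map_sub, map_add, map_smul, hAe, hAe', smul_eq_mul]; ring
  have eB : B (q + t • e' - v) = t := by
    rw [hq]; simp only [map_sub, map_add, map_smul, hBe, hBe', smul_eq_mul]; ring
  refine ⟨q + t • e', by rw [eA]; exact hρ4, by rw [eB]; exact t6, by rw [eA, eB]; linarith, ?_⟩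
  intro h
  rw [h, abs_zero] at t3
  linarith [Real.pi_pos]

lemma norm_le_of_mem_boundary {P : Polygon Plane n} {M : ℝ} (hM : ∀ i, ‖P i‖ ≤ M) {z : Plane}
    (hz : z ∈ P.boundary ℝ) : ‖z‖ ≤ M := by
  obtain ⟨i, hi⟩ := (mem_boundary P).1 hz
  have := (convex_closedBall (0 : Plane) M).segment_subset
    (mem_closedBall_zero_iff.2 (hM i)) (mem_closedBall_zero_iff.2 (hM (finRotate n i))) hi
  exact mem_closedBall_zero_iff.1 this

lemma wind_eq_zero_of_norm_gt {P : Polygon Plane n} {M : ℝ} (hM0 : 0 ≤ M) (hM : ∀ i, ‖P i‖ ≤ M)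
    {z : Plane} (hz : M < ‖z‖) : P.wind z = 0 := by
  obtain ⟨R, hR⟩ := exists_wind_eq_zero_of_norm_gt P
  obtain ⟨y, hy⟩ := NormedSpace.exists_lt_norm ℝ Plane (max M R)
  rw [← (hR y ((le_max_right _ _).trans_lt hy)).2]
  refine wind_eq_of_isPreconnected P (isPreconnected_norm_gt M hM0) ?_ hz
    ((le_max_left _ _).trans_lt hy)
  rw [disjoint_left]
  intro x hx hxC
  exact not_lt.2 (norm_le_of_mem_boundary hM hxC) hx

lemma rotate_rotate_ne (h : 3 ≤ n) (i : Fin n) : finRotate n (finRotate n i) ≠ i := by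
  rw [Ne, Fin.ext_iff, finRotate_val, finRotate_val]
  have := i.2
  split_ifs <;> omega

lemma rotate_rotate_rotate_ne (h : 4 ≤ n) (i : Fin n) :
    finRotate n (finRotate n (finRotate n i)) ≠ i := by
  rw [Ne, Fin.ext_iff, finRotate_val, finRotate_val, finRotate_val]
  have := i.2
  split_ifs <;> omega

/-- At a vertex of maximal norm the two edges are not collinear. -/
lemma IsSimple.independent_of_norm_max {P : Polygon Plane n} (hP : P.IsSimple) (i : Fin n)
    (hmax : ∀ j, ‖P j‖ ≤ ‖P (finRotate n i)‖) (s t : ℝ)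
    (h : s • (P i - P (finRotate n i)) +
      t • (P (finRotate n (finRotate n i)) - P (finRotate n i)) = 0) : s = 0 ∧ t = 0 := by
  have hn := hP.three_le
  have hiw := rotate_rotate_ne hn i
  set v := P (finRotate n i)
  set u := P i
  set w := P (finRotate n (finRotate n i)) with hw
  have huv : u - v ≠ 0 := sub_ne_zero.2 (hP.edge_ne i)
  have hwv : w - v ≠ 0 := sub_ne_zero.2 (hP.edge_ne _).symm
  have huw : u ≠ w := hP.vertex_ne hiw.symm
  have hst : s = 0 ↔ t = 0 := by
    constructor
    · rintro rfl
      rw [zero_smul, zero_add, smul_eq_zero] at h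
      exact h.resolve_right hwv
    · rintro rfl
      rw [zero_smul, add_zero, smul_eq_zero] at h
      exact h.resolve_right huv
  by_contra hcon
  have hs : s ≠ 0 := fun h' => hcon ⟨h', hst.1 h'⟩
  have ht : t ≠ 0 := fun h' => hs (hst.2 h')
  set c := -t / s with hc
  have hc0 : c ≠ 0 := div_ne_zero (neg_ne_zero.2 ht) hs
  have hu : u - v = c • (w - v) := by
    have : s • (u - v) = (-t) • (w - v) := by
      rw [neg_smul]; exact eq_neg_of_add_eq_zero_left h
    rw [hc, div_eq_inv_mul, mul_smul, ← this, smul_smul, inv_mul_cancel₀ hs, one_smul]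
  have hu' : u = v + c • (w - v) := by rw [← hu]; abel
  -- Opposite directions put `v` strictly between `u` and `w`, contradicting maximality of its norm
  -- by strict convexity. Equal directions put one of the two neighbours on the edge of the other.
  rcases lt_or_gt_of_ne hc0 with hneg | hpos
  · have hv : v = (1 / (1 - c)) • u + (-c / (1 - c)) • w := by
      have h1 : 1 - c ≠ 0 := by linarith
      have e1 : (1 / (1 - c)) * c + (-c / (1 - c)) = 0 := by field_simp; ring
      have e2 : 1 / (1 - c) + -c / (1 - c) = 1 := by field_simp; ring
      rw [hu']
      generalize 1 / (1 - c) = x at *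
      generalize -c / (1 - c) = y at *
      have : x • (v + c • (w - v)) + y • w = (x + y) • v + (x * c + y) • (w - v) := by module
      rw [this, e1, e2]; simp
    have := norm_combo_lt_of_ne (hmax i) (hmax (finRotate n (finRotate n i))) huw
      (a := 1 / (1 - c)) (b := -c / (1 - c)) (by apply div_pos <;> linarith)
      (by apply div_pos <;> linarith) (by
        have h1 : 1 - c ≠ 0 := by linarith
        field_simp; ring)
    rw [← hv] at this
    exact lt_irrefl _ this
  · rcases le_total c 1 with h1 | h1
    · have : P i ∈ segment ℝ (P (finRotate n i)) (P (finRotate n (finRotate n i))) := by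
        rw [segment_eq_image_lineMap]
        exact ⟨c, ⟨hpos.le, h1⟩, by
          rw [AffineMap.lineMap_apply_module]
          change _ = u
          rw [hu']; module⟩
      rcases hP.vertex_mem_edge this with h | h
      · exact finRotate_ne_self (by omega) i h.symm
      · exact hiw h.symm
    · have : P (finRotate n (finRotate n i)) ∈ segment ℝ (P i) (P (finRotate n i)) := by
        rw [segment_symm, segment_eq_image_lineMap]
        refine ⟨c⁻¹, ⟨by positivity, inv_le_one_of_one_le₀ h1⟩, ?_⟩
        rw [AffineMap.lineMap_apply_module]
        change (1 - c⁻¹) • v + c⁻¹ • u = w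
        have e : (1 - c⁻¹) • v + c⁻¹ • u = v + c⁻¹ • (u - v) := by module
        rw [e, hu, smul_smul, inv_mul_cancel₀ hc0, one_smul]; abel
      rcases hP.vertex_mem_edge this with h | h
      · exact hiw h
      · exact finRotate_ne_self (by omega) _ h

/-- Otherwise `(1 + a + b) • v = a • u + b • w`, which has norm at most `(a + b) * ‖v‖`. Thus the
outward direction at a vertex of maximal norm leaves the cone of its two edges. -/
lemma maximal_vertex_direction {u v w : Plane} (hu : ‖u‖ ≤ ‖v‖) (hw : ‖w‖ ≤ ‖v‖) (hv : v ≠ 0)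
    {a b : ℝ} (h : v = a • (u - v) + b • (w - v)) : a < 0 ∨ b < 0 := by
  by_contra hcon
  push Not at hcon
  obtain ⟨ha, hb⟩ := hcon
  have hpos : 0 < 1 + (a + b) := by linarith
  have e : (2 + (a + b)) • v = (1 : ℝ) • v + a • u + b • w := by
    have h2 : (2 + (a + b)) • v = (1 + (a + b)) • v + v := by module
    rw [h2]
    nth_rewrite 2 [h]
    module
  have h1 : ‖(2 + (a + b)) • v‖ ≤ ‖v‖ + a * ‖v‖ + b * ‖v‖ := by
    rw [e]
    refine (norm_add_le _ _).trans (add_le_add ((norm_add_le _ _).trans (add_le_add ?_ ?_)) ?_)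
    · rw [one_smul]
    · rw [norm_smul, Real.norm_of_nonneg ha]; gcongr
    · rw [norm_smul, Real.norm_of_nonneg hb]; gcongr
  rw [norm_smul, Real.norm_of_nonneg (by linarith)] at h1
  have := norm_pos_iff.2 hv
  nlinarith

/-- A simple polygon with at least four vertices has a diagonal. -/
lemma IsSimple.exists_diagonal {P : Polygon Plane n} (hP : P.IsSimple) (hn : 4 ≤ n) :
    ∃ a b, P.IsDiagonal a b := by
  have i₀ : Fin n := ⟨0, by omega⟩
  -- Let `v` have maximal norm, with neighbours `u` and `w`, and let `A`, `B` be the coordinates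
  -- along its edges. If the triangle contains no further vertex, then `u` and `w` are joined by a
  -- diagonal; otherwise `v` is joined to a further vertex of the triangle with the least level `A +
  -- B`.
  obtain ⟨i', -, hi'⟩ := Finset.exists_max_image Finset.univ (fun j => ‖P j‖) ⟨i₀, Finset.mem_univ _⟩
  obtain ⟨i, rfl⟩ := (finRotate n).surjective i'
  have hmax : ∀ j, ‖P j‖ ≤ ‖P (finRotate n i)‖ := fun j => hi' j (Finset.mem_univ _)
  have hind := hP.independent_of_norm_max i hmax
  set v := P (finRotate n i) with hv
  set u := P i with hu
  set w := P (finRotate n (finRotate n i)) with hw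
  obtain ⟨A, B, hA1, hA2, hB1, hB2, hAB⟩ := exists_coordinates hind
  have hiw := rotate_rotate_ne (by omega) i
  have hii := finRotate_ne_self (by omega) i
  have hv0 : v ≠ 0 := by
    intro h0
    have h1 := hmax i
    rw [h0, norm_zero, norm_le_zero_iff] at h1
    exact hP.edge_ne i (h1.trans h0.symm)
  have hedge1 : ∀ m ∈ segment ℝ (P i) (P (finRotate n i)), B (m - v) = 0 := by
    intro m hm
    rw [segment_eq_image_lineMap] at hm
    obtain ⟨t, -, rfl⟩ := hm
    have : AffineMap.lineMap (P i) (P (finRotate n i)) t - v = (1 - t) • (u - v) := by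
      rw [AffineMap.lineMap_apply_module, ← hv, ← hu]; module
    rw [this, map_smul, hB1, smul_zero]
  have hedge2 : ∀ m ∈ segment ℝ (P (finRotate n i)) (P (finRotate n (finRotate n i))),
      A (m - v) = 0 := by
    intro m hm
    rw [segment_eq_image_lineMap] at hm
    obtain ⟨t, -, rfl⟩ := hm
    have : AffineMap.lineMap (P (finRotate n i)) (P (finRotate n (finRotate n i))) t - v =
        t • (w - v) := by
      rw [AffineMap.lineMap_apply_module, ← hv, ← hw]; module
    rw [this, map_smul, hA2, smul_zero]
  have hcoord : ∀ m, m = v + (A (m - v) • (u - v) + B (m - v) • (w - v)) := fun m => by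
    rw [← hAB]; abel
  have hmem1 : ∀ m, B (m - v) = 0 → 0 ≤ A (m - v) → A (m - v) ≤ 1 →
      m ∈ segment ℝ (P i) (P (finRotate n i)) := by
    intro m h1 h2 h3
    rw [segment_symm, segment_eq_image_lineMap]
    refine ⟨_, ⟨h2, h3⟩, ?_⟩
    rw [AffineMap.lineMap_apply_module]
    conv_rhs => rw [hcoord m, h1]
    module
  have hmem2 : ∀ m, A (m - v) = 0 → 0 ≤ B (m - v) → B (m - v) ≤ 1 →
      m ∈ segment ℝ (P (finRotate n i)) (P (finRotate n (finRotate n i))) := by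
    intro m h1 h2 h3
    rw [segment_eq_image_lineMap]
    refine ⟨_, ⟨h2, h3⟩, ?_⟩
    rw [AffineMap.lineMap_apply_module]
    conv_rhs => rw [hcoord m, h1]
    module
  -- no edge leaves the triangle through its two sides at `v`
  have hX : ∀ j p q m, j ≠ i → j ≠ finRotate n i →
      openSegment ℝ (P j) (P (finRotate n j)) = openSegment ℝ p q → m ∈ segment ℝ p q →
      0 < A (m - v) → 0 < B (m - v) → A (m - v) + B (m - v) ≤ 1 →
      A (p - v) + B (p - v) ≤ 1 → (A (p - v) < 0 ∨ B (p - v) < 0) → False := by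
    intro j p q m hj1 hj2 hpq hm h1 h2 h3 h4 h5
    obtain ⟨m', hm', h⟩ := exists_exit_point A B hm h1 h2 h3 h4 h5
    rw [← hpq] at hm'
    rcases h with ⟨h6, h7, h8⟩ | ⟨h6, h7, h8⟩
    · exact hP.notMem_other_edge hj2.symm hm' (hmem2 m' h6 h7 h8)
    · exact hP.notMem_other_edge hj1.symm hm' (hmem1 m' h6 h7 h8)
  -- An edge through `m` has an end at no higher level `A + B` than `m`. By the hypothesis on
  -- vertices this end lies outside the cone, so the edge would cross a side of the triangle at `v`.
  have hfree : ∀ m, 0 < A (m - v) → 0 < B (m - v) → A (m - v) + B (m - v) ≤ 1 →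
      (∀ x, x ≠ i → x ≠ finRotate n i → x ≠ finRotate n (finRotate n i) →
        A (P x - v) + B (P x - v) ≤ A (m - v) + B (m - v) →
          A (P x - v) < 0 ∨ B (P x - v) < 0) → m ∉ P.boundary ℝ := by
    intro m h1 h2 h3 hH hm
    obtain ⟨j, hj⟩ := (mem_boundary P).1 hm
    have hj1 : j ≠ i := by rintro rfl; exact h2.ne' (hedge1 m hj)
    have hj2 : j ≠ finRotate n i := by rintro rfl; exact h1.ne' (hedge2 m hj)
    -- an end point of the edge other than the three vertices of the triangle leads outside
    have main : ∀ x y, openSegment ℝ (P j) (P (finRotate n j)) = openSegment ℝ (P x) (P y) →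
        m ∈ segment ℝ (P x) (P y) → x ≠ finRotate n i → y ≠ finRotate n i →
        ¬ ((x = i ∧ y = finRotate n (finRotate n i)) ∨
            (y = i ∧ x = finRotate n (finRotate n i))) → x ≠ y →
        A (P x - v) + B (P x - v) ≤ A (m - v) + B (m - v) → False := by
      intro x y hxy hmxy hx hy hnot hne hle
      by_cases hxx : x ≠ i ∧ x ≠ finRotate n (finRotate n i)
      · exact hX j _ _ m hj1 hj2 hxy hmxy h1 h2 h3 (hle.trans h3) (hH x hxx.1 hx hxx.2 hle)
      -- The low end is `u` or `w`, so `m` has level 1 too and the whole edge lies on the line `A +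
      -- B = 1`. Its other end is then neither `u` nor `w` and serves instead.
      · have hsx : A (P x - v) + B (P x - v) = 1 ∧ P x ≠ m := by
          by_cases hxi : x = i
          · subst hxi
            exact ⟨by rw [hA1, hB1, add_zero], by rintro rfl; rw [hB1] at h2; exact lt_irrefl _ h2⟩
          · have : x = finRotate n (finRotate n i) := by
              by_contra h; exact hxx ⟨hxi, h⟩
            subst this
            exact ⟨by rw [hA2, hB2, zero_add], by rintro rfl; rw [hA2] at h1; exact lt_irrefl _ h1⟩
        obtain ⟨hsx1, hxm⟩ := hsx
        have hsy : A (P y - v) + B (P y - v) = 1 := by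
          rw [segment_eq_image_lineMap] at hmxy
          obtain ⟨c, ⟨hc0, hc1⟩, hc⟩ := hmxy
          have hc0' : c ≠ 0 := by
            rintro rfl
            rw [AffineMap.lineMap_apply_zero] at hc
            exact hxm hc
          have e : m - v = (P x - v) + c • ((P y - v) - (P x - v)) := by
            rw [← hc, AffineMap.lineMap_apply_module]; module
          have eA : A (m - v) = A (P x - v) + c * (A (P y - v) - A (P x - v)) := by
            rw [e]; simp only [map_add, map_smul, map_sub, smul_eq_mul]
          have eB : B (m - v) = B (P x - v) + c * (B (P y - v) - B (P x - v)) := by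
            rw [e]; simp only [map_add, map_smul, map_sub, smul_eq_mul]
          have : c * (A (P y - v) + B (P y - v) - 1) = 0 := by
            have hm1 : A (m - v) + B (m - v) = 1 := by linarith
            rw [eA, eB] at hm1
            linear_combination hm1 - (1 - c) * hsx1
          have := (mul_eq_zero.1 this).resolve_left hc0'
          linarith
        have hyy : y ≠ i ∧ y ≠ finRotate n (finRotate n i) := by
          constructor
          · rintro rfl
            apply hnot
            right
            refine ⟨rfl, ?_⟩
            by_contra h
            exact hxx ⟨hne, h⟩
          · rintro rfl
            apply hnot
            left
            refine ⟨?_, rfl⟩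
            by_contra h
            exact hxx ⟨h, hne⟩
        refine hX j _ _ m hj1 hj2 (by rw [hxy, openSegment_symm]) (by rwa [segment_symm])
          h1 h2 h3 hsy.le (hH y hyy.1 hy hyy.2 ?_)
        linarith
    have hj3 : finRotate n j ≠ finRotate n i := fun h => hj1 ((finRotate n).injective h)
    have hjn : j ≠ finRotate n j := (finRotate_ne_self (by omega) j).symm
    have hnot1 : ¬ (j = i ∧ finRotate n j = finRotate n (finRotate n i)) := fun h => hj1 h.1
    have hnot2 : ¬ (finRotate n j = i ∧ j = finRotate n (finRotate n i)) := by
      rintro ⟨h, rfl⟩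
      exact rotate_rotate_rotate_ne hn i h
    have hends : A (P j - v) + B (P j - v) ≤ A (m - v) + B (m - v) ∨
        A (P (finRotate n j) - v) + B (P (finRotate n j) - v) ≤ A (m - v) + B (m - v) := by
      by_contra hcon
      push Not at hcon
      have hconv : Convex ℝ {z : Plane | A (m - v) + B (m - v) + (A + B) v < (A + B) z} :=
        convex_halfSpace_gt (A + B).isLinear _
      have hmem : ∀ z : Plane, A (m - v) + B (m - v) < A (z - v) + B (z - v) →
          z ∈ {z : Plane | A (m - v) + B (m - v) + (A + B) v < (A + B) z} := by
        intro z hz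
        change A (m - v) + B (m - v) + (A + B) v < (A + B) z
        rw [map_sub A z, map_sub B z] at hz
        rw [LinearMap.add_apply, LinearMap.add_apply]
        linarith
      have := hconv.segment_subset (hmem _ hcon.1) (hmem _ hcon.2) hj
      have : A (m - v) + B (m - v) + (A + B) v < (A + B) m := this
      rw [map_sub, map_sub, LinearMap.add_apply, LinearMap.add_apply] at this
      linarith
    rcases hends with h | h
    · exact main j (finRotate n j) rfl hj hj2 hj3 (by tauto) hjn h
    · exact main (finRotate n j) j (openSegment_symm _ _ _) (by rwa [segment_symm]) hj3 hj2
        (by tauto) hjn.symm h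
  -- near `v`, the points in the angle are not in the exterior
  have hwind : ∀ δ > 0, ∃ m, 0 < A (m - v) ∧ 0 < B (m - v) ∧ A (m - v) + B (m - v) < δ ∧
      P.wind m ≠ 0 := by
    intro δ hδ
    have hnear : ∀ᶠ z in 𝓝 v, ∀ j, j ≠ i ∧ j ≠ finRotate n i →
        z ∉ segment ℝ (P j) (P (finRotate n j)) := by
      rw [eventually_all]
      intro j
      by_cases hj : j ≠ i ∧ j ≠ finRotate n i
      · have : v ∉ segment ℝ (P j) (P (finRotate n j)) := by
          intro h
          rcases hP.vertex_mem_edge h with h | h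
          · exact hj.2 h.symm
          · exact hj.1 ((finRotate n).injective h).symm
        filter_upwards [(isClosed_segment _ _).isOpen_compl.mem_nhds this] with z hz _
        exact hz
      · simp only [hj, false_imp_iff, eventually_true]
    obtain ⟨ε, hε, hball⟩ := Metric.eventually_nhds_iff_ball.1 hnear
    have hloc : ∀ z ∈ Metric.ball v ε, z ∈ P.boundary ℝ → 0 ≤ A (z - v) ∧ 0 ≤ B (z - v) := by
      intro z hz hzC
      obtain ⟨j, hj⟩ := (mem_boundary P).1 hzC
      by_cases h1 : j = i
      · subst h1
        refine ⟨?_, (hedge1 z hj).ge⟩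
        rw [segment_eq_image_lineMap] at hj
        obtain ⟨t, ⟨ht0, ht1⟩, rfl⟩ := hj
        have : AffineMap.lineMap (P j) (P (finRotate n j)) t - v = (1 - t) • (u - v) := by
          rw [AffineMap.lineMap_apply_module, ← hv, ← hu]; module
        rw [this, map_smul, hA1, smul_eq_mul]
        linarith
      by_cases h2 : j = finRotate n i
      · subst h2
        refine ⟨(hedge2 z hj).ge, ?_⟩
        rw [segment_eq_image_lineMap] at hj
        obtain ⟨t, ⟨ht0, ht1⟩, rfl⟩ := hj
        have : AffineMap.lineMap (P (finRotate n i)) (P (finRotate n (finRotate n i))) t - v =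
            t • (w - v) := by
          rw [AffineMap.lineMap_apply_module, ← hv, ← hw]; module
        rw [this, map_smul, hB2, smul_eq_mul]
        linarith
      exact absurd hj (hball z hz j ⟨h1, h2⟩)
    obtain ⟨τ, hτ1, hτ2⟩ : ∃ τ : ℝ, v + τ • v ∈ Metric.ball v ε ∧ 0 < τ :=
      ((ball_lineMap_tendsto v v hε).and (self_mem_nhdsWithin (s := Ioi (0 : ℝ)))).exists
    have how : P.wind (v + τ • v) = 0 := by
      refine wind_eq_zero_of_norm_gt (norm_nonneg v) hmax ?_
      have : v + τ • v = (1 + τ) • v := by module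
      rw [this, norm_smul, Real.norm_of_nonneg (by linarith)]
      have := norm_pos_iff.2 hv0
      nlinarith
    have hov : v + τ • v - v = τ • v := by abel
    -- The exterior point `v + τ • v` has a negative coordinate. Crossing the edge at `v` on which
    -- that coordinate vanishes leads into the cone.
    rcases maximal_vertex_direction (hmax i) (hmax _) hv0 (hAB v) with h | h
    · obtain ⟨m, h1, h2, h3, h4⟩ := exists_wind_ne_zero hP (j := finRotate n i) (v := v)
        (e := w - v) (e' := u - v) (A := B) (B := A) (by rw [← hv, ← hw]; congr 1; abel)
        (im_ne_zero_of_independent hind) hB2 hB1 hA2 hA1 hε (fun z hz hzC => (hloc z hz hzC).1)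
        hτ1 (by rw [hov, map_smul, smul_eq_mul]; exact mul_neg_of_pos_of_neg hτ2 h) how hδ
      exact ⟨m, h2, h1, by linarith, h4⟩
    · refine exists_wind_ne_zero hP (j := i) (v := v)
        (e := u - v) (e' := w - v) (A := A) (B := B)
        (by rw [← hv, ← hu, openSegment_symm]; congr 1; abel)
        (im_ne_zero_of_independent fun s t hst => ?_) hA1 hA2 hB1 hB2 hε
        (fun z hz hzC => (hloc z hz hzC).2)
        hτ1 (by rw [hov, map_smul, smul_eq_mul]; exact mul_neg_of_pos_of_neg hτ2 h) how hδ
      have := hind (-t) s (by rw [← hst]; module)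
      exact ⟨this.2, neg_eq_zero.1 this.1⟩
  -- a convex region at `v` that misses the boundary misses the exterior
  have hinside : ∀ K : Set Plane, Convex ℝ K → Disjoint K (P.boundary ℝ) →
      (∃ δ > 0, ∀ m, 0 < A (m - v) → 0 < B (m - v) → A (m - v) + B (m - v) < δ → m ∈ K) →
      Disjoint K P.exterior := by
    rintro K hK hKd ⟨δ, hδ, hKδ⟩
    obtain ⟨m, h1, h2, h3, h4⟩ := hwind δ hδ
    rw [disjoint_left]
    intro z hz hzE
    apply h4
    rw [wind_eq_of_isPreconnected P hK.isPreconnected hKd (hKδ m h1 h2 h3) hz]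
    exact (hP.mem_exterior_iff hzE.1).1 hzE
  -- The region closed at level 1 contains the open segment from `u` to `w`. The strict variant
  -- below is for the segment from `v` to a vertex `P x`, whose own level has to be left out.
  have hKconv : ∀ c, Convex ℝ {m : Plane | 0 < A (m - v) ∧ 0 < B (m - v) ∧
      A (m - v) + B (m - v) ≤ c} := by
    intro c
    have h1 := convex_halfSpace_gt (𝕜 := ℝ) A.isLinear (A v)
    have h2 := convex_halfSpace_gt (𝕜 := ℝ) B.isLinear (B v)
    have h3 := convex_halfSpace_le (𝕜 := ℝ) (A + B).isLinear (c + A v + B v)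
    have e : {m : Plane | 0 < A (m - v) ∧ 0 < B (m - v) ∧ A (m - v) + B (m - v) ≤ c} =
        {m | A v < A m} ∩ ({m | B v < B m} ∩ {m | (A + B) m ≤ c + A v + B v}) := by
      ext m
      simp only [map_sub, mem_ofPred_eq, mem_inter_iff, LinearMap.add_apply, sub_pos]
      constructor <;> rintro ⟨h1, h2, h3⟩ <;> exact ⟨h1, h2, by linarith⟩
    rw [e]
    exact h1.inter (h2.inter h3)
  have hKconv' : ∀ c, Convex ℝ {m : Plane | 0 < A (m - v) ∧ 0 < B (m - v) ∧
      A (m - v) + B (m - v) < c} := by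
    intro c
    have h1 := convex_halfSpace_gt (𝕜 := ℝ) A.isLinear (A v)
    have h2 := convex_halfSpace_gt (𝕜 := ℝ) B.isLinear (B v)
    have h3 := convex_halfSpace_lt (𝕜 := ℝ) (A + B).isLinear (c + A v + B v)
    have e : {m : Plane | 0 < A (m - v) ∧ 0 < B (m - v) ∧ A (m - v) + B (m - v) < c} =
        {m | A v < A m} ∩ ({m | B v < B m} ∩ {m | (A + B) m < c + A v + B v}) := by
      ext m
      simp only [map_sub, mem_ofPred_eq, mem_inter_iff, LinearMap.add_apply, sub_pos]
      constructor <;> rintro ⟨h1, h2, h3⟩ <;> exact ⟨h1, h2, by linarith⟩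
    rw [e]
    exact h1.inter (h2.inter h3)
  set T : Finset (Fin n) := Finset.univ.filter fun x => x ≠ i ∧ x ≠ finRotate n i ∧
    x ≠ finRotate n (finRotate n i) ∧ 0 ≤ A (P x - v) ∧ 0 ≤ B (P x - v) ∧
      A (P x - v) + B (P x - v) ≤ 1 with hT
  rcases T.eq_empty_or_nonempty with hemp | hne
  · set K := {m : Plane | 0 < A (m - v) ∧ 0 < B (m - v) ∧ A (m - v) + B (m - v) ≤ 1} with hK
    have hKd : Disjoint K (P.boundary ℝ) := by
      rw [disjoint_left]
      rintro m ⟨h1, h2, h3⟩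
      apply hfree m h1 h2 h3
      intro x hx1 hx2 hx3 hx4
      by_contra hcon
      push Not at hcon
      have : x ∈ T := by
        rw [hT, Finset.mem_filter]
        exact ⟨Finset.mem_univ _, hx1, hx2, hx3, hcon.1, hcon.2, hx4.trans h3⟩
      rw [hemp] at this
      exact absurd this (Finset.notMem_empty _)
    have hKE := hinside K (hKconv 1) hKd ⟨1, one_pos, fun m h1 h2 h3 => ⟨h1, h2, h3.le⟩⟩
    have hsub : openSegment ℝ (P i) (P (finRotate n (finRotate n i))) ⊆ K := by
      intro m hm
      rw [openSegment_eq_image_lineMap] at hm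
      obtain ⟨t, ⟨ht0, ht1⟩, rfl⟩ := hm
      have e : AffineMap.lineMap (P i) (P (finRotate n (finRotate n i))) t - v =
          (1 - t) • (u - v) + t • (w - v) := by
        rw [AffineMap.lineMap_apply_module, ← hu, ← hw]; module
      have eA : A ((1 - t) • (u - v) + t • (w - v)) = 1 - t := by
        rw [map_add, map_smul, map_smul, hA1, hA2]; simp
      have eB : B ((1 - t) • (u - v) + t • (w - v)) = t := by
        rw [map_add, map_smul, map_smul, hB1, hB2]; simp
      rw [hK, mem_ofPred_eq, e, eA, eB]
      exact ⟨by linarith, ht0, by linarith⟩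
    refine ⟨i, finRotate n (finRotate n i), hiw.symm, ?_, ?_, hKd.mono_left hsub,
      hKE.mono_left hsub⟩
    · exact finRotate_ne_self (by omega) _
    · exact (rotate_rotate_rotate_ne hn i).symm
  -- By minimality no further vertex of the triangle lies below the level of `P x`, so the smaller
  -- triangle cut off at that level is free of boundary points.
  · obtain ⟨x, hxT, hxmin⟩ := T.exists_min_image (fun x => A (P x - v) + B (P x - v)) hne
    rw [hT, Finset.mem_filter] at hxT
    obtain ⟨-, hx1, hx2, hx3, hx4, hx5, hx6⟩ := hxT
    set c := A (P x - v) + B (P x - v) with hc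
    have hxA : 0 < A (P x - v) := by
      refine lt_of_le_of_ne hx4 fun h => ?_
      rcases hP.vertex_mem_edge (hmem2 _ h.symm hx5 (by linarith)) with h | h
      · exact hx2 h
      · exact hx3 h
    have hxB : 0 < B (P x - v) := by
      refine lt_of_le_of_ne hx5 fun h => ?_
      rcases hP.vertex_mem_edge (hmem1 _ h.symm hx4 (by linarith)) with h | h
      · exact hx1 h
      · exact hx2 h
    set K := {m : Plane | 0 < A (m - v) ∧ 0 < B (m - v) ∧ A (m - v) + B (m - v) < c} with hK
    have hKd : Disjoint K (P.boundary ℝ) := by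
      rw [disjoint_left]
      rintro m ⟨h1, h2, h3⟩
      apply hfree m h1 h2 (by linarith)
      intro y hy1 hy2 hy3 hy4
      by_contra hcon
      push Not at hcon
      have : y ∈ T := by
        rw [hT, Finset.mem_filter]
        exact ⟨Finset.mem_univ _, hy1, hy2, hy3, hcon.1, hcon.2, by linarith⟩
      have := hxmin y this
      linarith
    have hKE := hinside K (hKconv' c) hKd ⟨c, by linarith, fun m h1 h2 h3 => ⟨h1, h2, h3⟩⟩
    have hsub : openSegment ℝ (P (finRotate n i)) (P x) ⊆ K := by
      intro m hm
      rw [openSegment_eq_image_lineMap] at hm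
      obtain ⟨t, ⟨ht0, ht1⟩, rfl⟩ := hm
      have e : AffineMap.lineMap (P (finRotate n i)) (P x) t - v = t • (P x - v) := by
        rw [AffineMap.lineMap_apply_module, ← hv]; module
      rw [hK, mem_ofPred_eq, e, map_smul, map_smul, smul_eq_mul, smul_eq_mul]
      exact ⟨by positivity, by positivity, by nlinarith⟩
    refine ⟨finRotate n i, x, Ne.symm hx2, hx3, ?_, hKd.mono_left hsub, hKE.mono_left hsub⟩
    exact fun h => hx1 ((finRotate n).injective h).symm

end Polygon

namespace Polygon

open Set Filter Topology

/-! ### Uncrossed chords are diagonals -/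

variable {n k l : ℕ}

lemma exists_arc (a b : Fin n) : ∃ k, ∃ f : Fin k → Fin n, IsArc a b f := by
  classical
  set S := Finset.univ.filter fun w : Fin n => btw a w b with hS
  refine ⟨S.card, S.orderEmbOfFin rfl, (S.orderEmbOfFin rfl).strictMono, fun w => ?_⟩
  have : w ∈ range (S.orderEmbOfFin rfl) ↔ w ∈ (S : Set (Fin n)) := by
    rw [Finset.range_orderEmbOfFin]
  rw [← mem_range, this, hS]
  simp

lemma sbtw_map {f : Fin k → Fin n} (hf : StrictMono f) {i j m : Fin k} :
    sbtw (f i) (f j) (f m) ↔ sbtw i j m := by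
  change (f i < f j ∧ f j < f m ∨ f j < f m ∧ f m < f i ∨ f m < f i ∧ f i < f j) ↔
    (i < j ∧ j < m ∨ j < m ∧ m < i ∨ m < i ∧ i < j)
  simp only [hf.lt_iff_lt]

lemma btw_map {f : Fin k → Fin n} (hf : StrictMono f) {i j m : Fin k} :
    btw (f i) (f j) (f m) ↔ btw i j m := by
  rw [btw_iff_not_sbtw, btw_iff_not_sbtw, sbtw_map hf]

variable {P : Polygon Plane n} {a b : Fin n} {f : Fin k → Fin n} {g : Fin l → Fin n}

lemma IsDiagonal.isChord (hd : P.IsDiagonal a b) : P.IsChord a b :=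
  ⟨⟨hd.ne, mutuallyVisible_iff.2 (segment_diagonal_subset_body hd)⟩, hd.ne_rotate, hd.ne_rotate'⟩

lemma IsChord.symm {x y : Fin n} (h : P.IsChord x y) : P.IsChord y x :=
  ⟨h.1.symm, h.2.2, h.2.1⟩

lemma adj_rotate (hP : P.IsSimple) (i : Fin n) : P.visibilityGraph.Adj i (finRotate n i) :=
  ⟨(finRotate_ne_self (by have := hP.three_le; omega) i).symm, mutuallyVisible_iff.2 fun _ hz =>
    boundary_subset_body P ((mem_boundary P).2 ⟨i, hz⟩)⟩

lemma vertex_mem_body_comp (f : Fin k → Fin n) (i : Fin k) : P (f i) ∈ (P.comp f).body :=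
  boundary_subset_body _ (vertex_mem_boundary (P.comp f) i)

lemma ne_rotate_of_comp (hd : P.IsDiagonal a b) (hf : IsArc a b f) {i j : Fin k}
    (h : j ≠ finRotate k i) : f j ≠ finRotate n (f i) := by
  intro h'
  by_cases hb : f i = b
  · have h1 := hf.btw_apply j
    rw [h', hb, btw_iff_val, finRotate_val] at h1
    have h2 := hd.ne_rotate'
    rw [Ne, Fin.ext_iff, finRotate_val] at h2
    have h3 := hd.ne
    rw [Ne, Fin.ext_iff] at h3
    have := a.2
    have := b.2
    split_ifs at h1 h2 <;> omega
  · exact h (hf.injective (by rw [hf.rotate hd.ne, if_neg hb, h']))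

/-- The body of a part meets the boundary of `P` only in the boundary of the part, so the open
diagonal of the part cannot touch the boundary of `P`. -/
lemma IsDiagonal.of_comp (hP : P.IsSimple) (hd : P.IsDiagonal a b) (hf : IsArc a b f)
    {i j : Fin k} (h : (P.comp f).IsDiagonal i j) : P.IsDiagonal (f i) (f j) := by
  have hbody : openSegment ℝ (P (f i)) (P (f j)) ⊆ (P.comp f).body := fun z hz =>
    disjoint_left.1 h.disjoint_exterior hz
  refine ⟨fun h' => h.ne (hf.injective h'), ne_rotate_of_comp hd hf h.ne_rotate,
    ne_rotate_of_comp hd hf h.ne_rotate', ?_, ?_⟩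
  · rw [disjoint_left]
    intro z hz hzC
    exact disjoint_left.1 h.disjoint_boundary hz
      (body_comp_inter_boundary hP hd hf hzC (hbody hz))
  · rw [disjoint_left]
    exact fun z hz => body_comp_subset hP hd hf (hbody hz)

lemma card_lt_of_arc (hd : P.IsDiagonal a b) (hf : IsArc a b f) : k < n := by
  have := Fintype.card_lt_of_injective_not_surjective f hf.injective fun hs => by
    obtain ⟨i, hi⟩ := hs (finRotate n b)
    have h1 := hf.btw_apply i
    rw [hi, btw_iff_val, finRotate_val] at h1
    have h2 := hd.ne_rotate'
    rw [Ne, Fin.ext_iff, finRotate_val] at h2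
    have h3 := hd.ne
    rw [Ne, Fin.ext_iff] at h3
    have := a.2
    have := b.2
    split_ifs at h1 h2 <;> omega
  simpa using this

/-- Two vertices that are not adjacent on the boundary are joined by a diagonal or separated by
one. -/
lemma IsSimple.isDiagonal_or_separated (hP : P.IsSimple) {x y : Fin n} (hxy : x ≠ y)
    (h₁ : y ≠ finRotate n x) (h₂ : x ≠ finRotate n y) :
    P.IsDiagonal x y ∨ ∃ u v, P.IsDiagonal u v ∧ sbtw x u y ∧ sbtw y v x := by
  induction n using Nat.strong_induction_on with
  | _ n ih =>
  have hn : 4 ≤ n := by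
    have := hP.three_le
    rw [Ne, Fin.ext_iff, finRotate_val] at h₁ h₂
    rw [Ne, Fin.ext_iff] at hxy
    have := x.2
    have := y.2
    split_ifs at h₁ h₂ <;> omega
  -- If both vertices lie in the same part, induction applies to that part: its diagonals are
  -- diagonals of `P` and its cyclic order is inherited. The pair `a`, `b` itself is excluded
  -- because it becomes consecutive there.
  have main : ∀ a b, P.IsDiagonal a b → btw a x b → btw a y b → ¬ (x = b ∧ y = a) →
      ¬ (y = b ∧ x = a) →
      P.IsDiagonal x y ∨ ∃ u v, P.IsDiagonal u v ∧ sbtw x u y ∧ sbtw y v x := by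
    intro a b hd hx hy n1 n2
    obtain ⟨k, f, hf⟩ := exists_arc a b
    obtain ⟨x', rfl⟩ := (hf.mem_iff x).2 hx
    obtain ⟨y', rfl⟩ := (hf.mem_iff y).2 hy
    have step : ∀ x' y' : Fin k, ¬ (f x' = b ∧ f y' = a) → f y' ≠ finRotate n (f x') →
        y' ≠ finRotate k x' := by
      rintro x' y' n1 h₁ rfl
      rw [hf.rotate hd.ne] at n1 h₁
      split_ifs at n1 h₁ with h
      · exact n1 ⟨h, rfl⟩
      · exact h₁ rfl
    rcases ih k (card_lt_of_arc hd hf) (hP.comp hd hf) (x := x') (y := y')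
      (fun h => hxy (congrArg f h)) (step _ _ n1 h₁) (step _ _ n2 h₂) with h | ⟨u, v, h, h3, h4⟩
    · exact Or.inl (hd.of_comp hP hf h)
    · exact Or.inr ⟨f u, f v, hd.of_comp hP hf h, (sbtw_map hf.strictMono).2 h3,
        (sbtw_map hf.strictMono).2 h4⟩
  obtain ⟨a, b, hd⟩ := hP.exists_diagonal hn
  by_cases e1 : x = a ∧ y = b
  · rw [e1.1, e1.2]; exact Or.inl hd
  by_cases e2 : x = b ∧ y = a
  · rw [e2.1, e2.2]; exact Or.inl hd.symm
  by_cases c1 : sbtw x a y ∧ sbtw y b x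
  · exact Or.inr ⟨a, b, hd, c1⟩
  by_cases c2 : sbtw x b y ∧ sbtw y a x
  · exact Or.inr ⟨b, a, hd.symm, c2⟩
  have hcase : (btw a x b ∧ btw a y b) ∨ (btw b x a ∧ btw b y a) := by
    have h3 := hd.ne
    rw [Ne, Fin.ext_iff] at h3 hxy
    simp only [Fin.ext_iff, sbtw_iff_val, btw_iff_val] at *
    omega
  rcases hcase with ⟨hx, hy⟩ | ⟨hx, hy⟩
  · exact main a b hd hx hy (fun h => e2 h) (fun h => e1 h.symm)
  · exact main b a hd.symm hx hy (fun h => e1 h) (fun h => e2 h.symm)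

/-- Visible vertices on different sides of a diagonal see each other through the diagonal. -/
lemma segment_meets_diagonal (hP : P.IsSimple) (hd : P.IsDiagonal a b) {u v : Fin n}
    (hu : sbtw a u b) (hv : sbtw b v a) (huv : P.visibilityGraph.Adj u v) :
    (segment ℝ (P u) (P v) ∩ segment ℝ (P a) (P b)).Nonempty := by
  obtain ⟨k, f, hf⟩ := exists_arc a b
  obtain ⟨l, g, hg⟩ := exists_arc b a
  obtain ⟨i, rfl⟩ := (hf.mem_iff u).2 hu.btw
  obtain ⟨j, rfl⟩ := (hg.mem_iff v).2 hv.btw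
  exact exists_mem_diagonal hP hd hf hg (vertex_mem_body_comp f i) (vertex_mem_body_comp g j)
    (mutuallyVisible_iff.1 huv.2)

lemma isChord_of_separated {u v x y : Fin n} (hu : sbtw x u y) (hv : sbtw y v x)
    (huv : P.visibilityGraph.Adj u v) : P.IsChord u v := by
  refine ⟨huv, ?_, ?_⟩ <;>
  · rw [Ne, Fin.ext_iff, finRotate_val]
    rw [sbtw_iff_val] at hu hv
    have := x.2
    have := y.2
    have := u.2
    have := v.2
    split_ifs <;> omega

/-- Otherwise a diagonal separates `x` from `y`. The chord `xy` must meet it, so this diagonal is a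
chord crossing `xy`. -/
lemma IsUncrossedChord.isDiagonal (hP : P.IsSimple) {x y : Fin n}
    (h : P.IsUncrossedChord x y) : P.IsDiagonal x y := by
  rcases hP.isDiagonal_or_separated h.1.1.1 h.1.2.1 h.1.2.2 with h' | ⟨u, v, hd, hu, hv⟩
  · exact h'
  · exfalso
    refine h.2 u v hd.isChord ⟨?_, Or.inl ⟨hu, hv⟩⟩
    rw [inter_comm, segment_symm ℝ (P x)]
    refine segment_meets_diagonal hP hd ?_ ?_ h.1.1.symm
    · rw [sbtw_iff_val] at *; omega
    · rw [sbtw_iff_val] at *; omega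

lemma IsUncrossedChord.symm {x y : Fin n} (h : P.IsUncrossedChord x y) :
    P.IsUncrossedChord y x := by
  refine ⟨h.1.symm, fun u v huv hc => h.2 u v huv ⟨?_, ?_⟩⟩
  · rw [segment_symm ℝ (P x)]; exact hc.1
  · rcases hc.2 with ⟨h1, h2⟩ | ⟨h1, h2⟩
    · exact Or.inr ⟨h2, h1⟩
    · exact Or.inl ⟨h2, h1⟩

/-- An uncrossed chord is a diagonal, so vertices seeing each other from its two sides do so through
it, and this would be a crossing. -/
lemma IsUncrossedChord.not_adj (hP : P.IsSimple) {x y u v : Fin n}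
    (h : P.IsUncrossedChord x y) (hu : sbtw x u y) (hv : sbtw y v x) :
    ¬ P.visibilityGraph.Adj u v := fun huv =>
  h.2 u v (isChord_of_separated hu hv huv)
    ⟨segment_meets_diagonal hP (h.isDiagonal hP) hu hv huv, Or.inl ⟨hu, hv⟩⟩

/-! ### The graph of a cyclic sequence without two of its vertices -/

section Cycle

variable {V : Type*} {G : SimpleGraph V} {f : Fin k → V} {a b : Fin k}

lemma reachable_of_arc (hadj : ∀ i, G.Adj (f i) (f (finRotate k i))) {U : Set V}
    (hU : ∀ i, sbtw a i b → f i ∈ U) {i j : Fin k} (hi : sbtw a i b) (hj : sbtw a j b) :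
    (G.induce U).Reachable ⟨f i, hU i hi⟩ ⟨f j, hU j hj⟩ := by
  have ha := a.2
  have hb := b.2
  have hs : sbtw a (finRotate k a) b := by
    rw [sbtw_iff_val, finRotate_val] at *
    have := i.2
    split_ifs <;> omega
  -- The arc is walked from its first vertex, the successor of `a`. The number `d` counts the steps,
  -- and the second alternative covers indices past the wrap-around.
  have key : ∀ d : ℕ, ∀ i, ∀ hi : sbtw a i b,
      (i.val = a.val + 1 + d ∨ i.val < a.val ∧ i.val + k = a.val + 1 + d) →
      (G.induce U).Reachable ⟨f (finRotate k a), hU _ hs⟩ ⟨f i, hU i hi⟩ := by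
    intro d
    induction d with
    | zero =>
      intro i hi h
      have : i = finRotate k a := by
        rw [Fin.ext_iff, finRotate_val]
        have := i.2
        split_ifs <;> omega
      subst this
      rfl
    | succ d ih =>
      intro i hi h
      have hi2 := i.2
      have hi' := hi
      rw [sbtw_iff_val] at hi'
      obtain ⟨j, rfl⟩ := (finRotate k).surjective i
      have hj2 := j.2
      have hv := finRotate_val j
      have hjs : sbtw a j b := by
        rw [sbtw_iff_val]
        split_ifs at hv <;> omega
      refine (ih j hjs (by split_ifs at hv <;> omega)).trans ?_
      apply SimpleGraph.Adj.reachable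
      exact hadj j
  have hex : ∀ i : Fin k, ∃ d : ℕ, sbtw a i b →
      (i.val = a.val + 1 + d ∨ i.val < a.val ∧ i.val + k = a.val + 1 + d) := by
    intro i
    have := i.2
    by_cases h : a.val < i.val
    · exact ⟨i.val - (a.val + 1), fun _ => by omega⟩
    · refine ⟨i.val + k - (a.val + 1), fun h => ?_⟩
      rw [sbtw_iff_val] at h
      omega
  obtain ⟨d, hd⟩ := hex i
  obtain ⟨d', hd'⟩ := hex j
  exact (key d i hi (hd hi)).symm.trans (key d' j hj (hd' hj))

lemma ne_of_sbtw {a i b : Fin k} (h : sbtw a i b) : i ≠ a ∧ i ≠ b := by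
  rw [sbtw_iff_val] at h
  rw [Ne, Ne, Fin.ext_iff, Fin.ext_iff]
  omega

lemma sbtw_or_sbtw {a i b : Fin k} (hab : a ≠ b) (ha : i ≠ a) (hb : i ≠ b) :
    sbtw a i b ∨ sbtw b i a := by
  rw [Ne, Fin.ext_iff] at *
  rw [sbtw_iff_val, sbtw_iff_val]
  omega

lemma mem_range_diff_pair (hf : Function.Injective f) {i : Fin k} (ha : i ≠ a) (hb : i ≠ b) :
    f i ∈ range f \ {f a, f b} := by
  refine ⟨⟨i, rfl⟩, ?_⟩
  rintro (h | h)
  · exact ha (hf h)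
  · exact hb (hf h)

lemma mem_range_diff_of_sbtw (hf : Function.Injective f) {i : Fin k} (h : sbtw a i b) :
    f i ∈ range f \ {f a, f b} :=
  mem_range_diff_pair hf (ne_of_sbtw h).1 (ne_of_sbtw h).2

lemma mem_range_diff_of_sbtw' (hf : Function.Injective f) {i : Fin k} (h : sbtw b i a) :
    f i ∈ range f \ {f a, f b} :=
  mem_range_diff_pair hf (ne_of_sbtw h).2 (ne_of_sbtw h).1

/-- A cyclic sequence remains connected after the removal of two vertices that are adjacent in
the sequence, or that are separated by an edge. -/
lemma preconnected_of_link (hf : Function.Injective f)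
    (hadj : ∀ i, G.Adj (f i) (f (finRotate k i))) (hab : a ≠ b)
    (h : b = finRotate k a ∨ a = finRotate k b ∨
      ∃ u v, sbtw a u b ∧ sbtw b v a ∧ G.Adj (f u) (f v)) :
    (G.induce (range f \ {f a, f b})).Preconnected := by
  have r1 : ∀ i j, ∀ hi : sbtw a i b, ∀ hj : sbtw a j b,
      (G.induce (range f \ {f a, f b})).Reachable ⟨f i, mem_range_diff_of_sbtw hf hi⟩
        ⟨f j, mem_range_diff_of_sbtw hf hj⟩ := fun i j hi hj =>
    reachable_of_arc hadj (fun i hi => mem_range_diff_of_sbtw hf hi) hi hj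
  have r2 : ∀ i j, ∀ hi : sbtw b i a, ∀ hj : sbtw b j a,
      (G.induce (range f \ {f a, f b})).Reachable ⟨f i, mem_range_diff_of_sbtw' hf hi⟩
        ⟨f j, mem_range_diff_of_sbtw' hf hj⟩ := fun i j hi hj =>
    reachable_of_arc hadj (fun i hi => mem_range_diff_of_sbtw' hf hi) hi hj
  have r3 : ∀ i j, ∀ hi : sbtw a i b, ∀ hj : sbtw b j a,
      (G.induce (range f \ {f a, f b})).Reachable ⟨f i, mem_range_diff_of_sbtw hf hi⟩
        ⟨f j, mem_range_diff_of_sbtw' hf hj⟩ := by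
    intro i j hi hj
    rcases h with rfl | rfl | ⟨u, v, hu, hv, huv⟩
    · exfalso
      rw [sbtw_iff_val, finRotate_val] at hi
      have := a.2
      have := i.2
      split_ifs at hi <;> omega
    · exfalso
      rw [sbtw_iff_val, finRotate_val] at hj
      have := b.2
      have := j.2
      split_ifs at hj <;> omega
    · refine (r1 i u hi hu).trans (SimpleGraph.Reachable.trans ?_ (r2 v j hv hj))
      exact SimpleGraph.Adj.reachable (G := G.induce _) huv
  rintro ⟨x, hx⟩ ⟨y, hy⟩
  obtain ⟨i, rfl⟩ := hx.1
  obtain ⟨j, rfl⟩ := hy.1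
  have hi : sbtw a i b ∨ sbtw b i a := sbtw_or_sbtw hab
    (fun h => hx.2 (by simp [h])) (fun h => hx.2 (by simp [h]))
  have hj : sbtw a j b ∨ sbtw b j a := sbtw_or_sbtw hab
    (fun h => hy.2 (by simp [h])) (fun h => hy.2 (by simp [h]))
  rcases hi with hi | hi <;> rcases hj with hj | hj
  · exact r1 i j hi hj
  · exact r3 i j hi hj
  · exact (r3 j i hj hi).symm
  · exact r2 i j hi hj

/-- Without an edge between the two open arcs, only vertices of one arc are reachable from it. -/
lemma sbtw_of_reachable (hab : a ≠ b)
    (hno : ∀ u v, sbtw a u b → sbtw b v a → ¬ G.Adj (f u) (f v))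
    {x y : ↥(range f \ {f a, f b})} (h : (G.induce (range f \ {f a, f b})).Reachable x y)
    (hx : ∃ i, sbtw a i b ∧ f i = x) : ∃ i, sbtw a i b ∧ f i = y := by
  obtain ⟨w⟩ := h
  induction w with
  | nil => exact hx
  | @cons u v w huv _ ih =>
    apply ih
    obtain ⟨i, hi, hiu⟩ := hx
    obtain ⟨j, hj⟩ := v.2.1
    refine ⟨j, ?_, hj⟩
    have hadj : G.Adj (f i) (f j) := by rw [hiu, hj]; exact huv
    rcases sbtw_or_sbtw hab (i := j) (fun h => v.2.2 (by simp [← hj, h]))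
      (fun h => v.2.2 (by simp [← hj, h])) with h | h
    · exact h
    · exact absurd hadj (hno i j hi h)

lemma not_preconnected_of_separated (hf : Function.Injective f) (hab : a ≠ b)
    (ha : b ≠ finRotate k a) (hb : a ≠ finRotate k b)
    (hno : ∀ u v, sbtw a u b → sbtw b v a → ¬ G.Adj (f u) (f v)) :
    ¬ (G.induce (range f \ {f a, f b})).Preconnected := by
  intro hpre
  have h1 : sbtw a (finRotate k a) b := by
    rw [Ne, Fin.ext_iff] at *
    rw [sbtw_iff_val]
    rw [finRotate_val] at *
    have := a.2
    have := b.2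
    split_ifs at * <;> omega
  have h2 : sbtw b (finRotate k b) a := by
    rw [Ne, Fin.ext_iff] at *
    rw [sbtw_iff_val]
    rw [finRotate_val] at *
    have := a.2
    have := b.2
    split_ifs at * <;> omega
  obtain ⟨i, hi, hi'⟩ := sbtw_of_reachable hab hno
    (hpre ⟨_, mem_range_diff_of_sbtw hf h1⟩ ⟨_, mem_range_diff_of_sbtw' hf h2⟩) ⟨_, h1, rfl⟩
  have := hf hi'
  subst this
  exact hi.not_sbtw h2

end Cycle

/-- Bottleneck pairs are exactly the uncrossed chords. -/
lemma IsSimple.isBottleneckPair_iff (hP : P.IsSimple) (x y : Fin n) :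
    P.visibilityGraph.IsBottleneckPair x y ↔ P.IsUncrossedChord x y := by
  -- The full vertex set is the cyclic sequence enumerated by `id`, so that the lemmas on cyclic
  -- sequences serve both the whole graph and its pieces.
  have hset : ({x, y}ᶜ : Set (Fin n)) = range (id : Fin n → Fin n) \ {id x, id y} := by
    rw [range_id, compl_eq_univ_sdiff, id, id]
  unfold SimpleGraph.IsBottleneckPair
  rw [hset]
  constructor
  · rintro ⟨hadj, hcon⟩
    have hpre := preconnected_of_link (G := P.visibilityGraph) Function.injective_id
      (adj_rotate hP) hadj.1
    refine ⟨⟨hadj, fun h => hcon (hpre (Or.inl h)), fun h => hcon (hpre (Or.inr (Or.inl h)))⟩,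
      fun u v huv hc => hcon (hpre (Or.inr (Or.inr ?_)))⟩
    rcases hc.2 with ⟨h1, h2⟩ | ⟨h1, h2⟩
    · exact ⟨u, v, h1, h2, huv.1⟩
    · exact ⟨v, u, h1, h2, huv.1.symm⟩
  · intro h
    exact ⟨h.1.1, not_preconnected_of_separated Function.injective_id h.1.1.1 h.1.2.1 h.1.2.2
      fun u v hu hv => h.not_adj hP hu hv⟩

end Polygon

namespace Polygon

open Set Filter Topology

variable {n k l : ℕ} {P : Polygon Plane n} {f : Fin k → Fin n} {g : Fin l → Fin n}

/-! ### Crossings and intersections of open segments -/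

/-- A segment inside of a polygon does not cross an edge transversally. -/
lemma IsSimple.not_transversal (hP : P.IsSimple) {i : Fin n} {p q z : Plane}
    (hpq : segment ℝ p q ⊆ P.body) (hz : z ∈ openSegment ℝ p q)
    (hzi : z ∈ openSegment ℝ (P i) (P (finRotate n i))) :
    (toC (q - p) / toC (P (finRotate n i) - P i)).im = 0 := by
  by_contra him
  -- Just before and after `z` the segment is off the boundary and inside the body, with winding
  -- numbers ±2π. Their difference is 0 or ±4π, never the ±2π of a jump.
  have hjump := wind_jump P (hP.edge_ne i) hzi (fun j hj => hP.notMem_other_edge hj hzi) him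
  rw [openSegment_eq_image_lineMap] at hz
  obtain ⟨s, ⟨hs0, hs1⟩, rfl⟩ := hz
  have h1 : ∀ᶠ t in 𝓝[>] (0 : ℝ), t < s ∧ t < 1 - s :=
    ((eventually_lt_nhds hs0).and (eventually_lt_nhds (sub_pos.2 hs1))).filter_mono
      nhdsWithin_le_nhds
  obtain ⟨t, ⟨⟨t1, t2, t3⟩, t4, t5⟩, t6⟩ : ∃ t : ℝ, _ ∧ 0 < t :=
    ((hjump.and h1).and (self_mem_nhdsWithin (s := Ioi (0 : ℝ)))).exists
  have e : ∀ r : ℝ, AffineMap.lineMap p q s + r • (q - p) = AffineMap.lineMap p q (s + r) := by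
    intro r
    rw [AffineMap.lineMap_apply_module, AffineMap.lineMap_apply_module]; module
  have hb : ∀ r : ℝ, 0 ≤ s + r → s + r ≤ 1 →
      AffineMap.lineMap p q s + r • (q - p) ∉ P.exterior := by
    intro r h0 h1
    apply hpq
    rw [e, segment_eq_image_lineMap]
    exact ⟨_, ⟨h0, h1⟩, rfl⟩
  have b1 := hb t (by linarith) (by linarith)
  have b2 := hb (-t) (by linarith) (by linarith)
  rw [neg_smul, ← sub_eq_add_neg] at b2
  rw [hP.mem_exterior_iff t1] at b1
  rw [hP.mem_exterior_iff t2] at b2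
  have hpi := Real.pi_pos
  rcases hP.wind_cases t1 with h | h | h <;> rcases hP.wind_cases t2 with h' | h' | h'
  · exact b1 h
  · exact b1 h
  · exact b1 h
  · exact b2 h'
  · rw [h, h', sub_self, abs_zero] at t3; linarith
  · rw [h, h', abs_of_pos (by linarith)] at t3; linarith
  · exact b2 h'
  · rw [h, h', abs_of_neg (by linarith)] at t3; linarith
  · rw [h, h', sub_self, abs_zero] at t3; linarith

lemma openSegment_add_smul {p q : Plane} {t : ℝ} (h0 : 0 < t) (h1 : t < 1) :
    p + t • (q - p) ∈ openSegment ℝ p q := by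
  rw [openSegment_eq_image_lineMap]
  exact ⟨t, ⟨h0, h1⟩, by rw [AffineMap.lineMap_apply_module]; module⟩

lemma exists_add_smul_of_mem_openSegment {p q z : Plane} (h : z ∈ openSegment ℝ p q) :
    ∃ t : ℝ, 0 < t ∧ t < 1 ∧ z = p + t • (q - p) := by
  rw [openSegment_eq_image_lineMap] at h
  obtain ⟨t, ⟨h0, h1⟩, rfl⟩ := h
  exact ⟨t, h0, h1, by rw [AffineMap.lineMap_apply_module]; module⟩

/-- Overlapping parallel chords without third vertices on them coincide. -/
lemma eq_of_overlap (hP : P.IsSimple)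
    (H : ∀ u v w : Fin n, P.IsChord u v → w ≠ u → w ≠ v → P w ∉ openSegment ℝ (P u) (P v))
    {x y u v : Fin n} (hxy : P.IsChord x y) (huv : P.IsChord u v) {z : Plane}
    (hz : z ∈ openSegment ℝ (P u) (P v)) (hz' : z ∈ openSegment ℝ (P x) (P y)) {r : ℝ}
    (hr : 0 < r) (hpar : P v - P u = r • (P y - P x)) : u = x ∧ v = y := by
  obtain ⟨t, t0, t1, ht⟩ := exists_add_smul_of_mem_openSegment hz
  obtain ⟨s, s0, s1, hs⟩ := exists_add_smul_of_mem_openSegment hz'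
  -- Along the common line, `x`, `y` have coordinates 0, 1 and `u`, `v` have `s - t * r`, `s + (1 -
  -- t) * r`; both intervals contain `s` in their interior. If they differ, an end of one lies
  -- inside the other, which `H` forbids.
  set D := P y - P x with hD
  have hy : P y = P x + D := by rw [hD]; abel
  have hu : P u = P x + (s - t * r) • D := by
    have : P u = z - t • (P v - P u) := by rw [ht]; abel
    rw [this, hs, hpar]; module
  have hv : P v = P x + (s + (1 - t) * r) • D := by
    have : P v = P u + (P v - P u) := by abel
    rw [this, hpar, hu]; module
  have hmid : ∀ w (c : ℝ), P w = P x + c • D → 0 < c → c < 1 → False := by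
    intro w c hw h0 h1
    have hmem : P w ∈ openSegment ℝ (P x) (P y) := by
      rw [hw]; exact openSegment_add_smul h0 h1
    have hne := hP.vertex_ne hxy.1.1
    refine H x y w hxy ?_ ?_ hmem
    · rintro rfl; exact hne (left_mem_openSegment_iff.1 hmem)
    · rintro rfl; exact hne (right_mem_openSegment_iff.1 hmem)
  have hmid' : ∀ w (c : ℝ), P w = P x + c • D → s - t * r < c → c < s + (1 - t) * r → False := by
    intro w c hw h0 h1
    have hmem : P w ∈ openSegment ℝ (P u) (P v) := by
      have e : P w = P u + ((c - (s - t * r)) / r) • (P v - P u) := by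
        rw [hpar, smul_smul, div_mul_cancel₀ _ hr.ne', hw, hu]; module
      rw [e]
      apply openSegment_add_smul
      · exact div_pos (by linarith) hr
      · rw [div_lt_one hr]; linarith
    have hne := hP.vertex_ne huv.1.1
    refine H u v w huv ?_ ?_ hmem
    · rintro rfl; exact hne (left_mem_openSegment_iff.1 hmem)
    · rintro rfl; exact hne (right_mem_openSegment_iff.1 hmem)
  have h1 : s - t * r = 0 := by
    have hlt : s - t * r < s := by nlinarith
    by_contra hne
    rcases lt_or_gt_of_ne hne with h | h
    · exact hmid' x 0 (by simp) h (by nlinarith)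
    · exact hmid u _ hu h (by linarith)
  have h2 : s + (1 - t) * r = 1 := by
    have hlt : s < s + (1 - t) * r := by nlinarith
    by_contra hne
    rcases lt_or_gt_of_ne hne with h | h
    · exact hmid v _ hv (by linarith) h
    · exact hmid' y 1 (by rw [hy, one_smul]) (by linarith) h
  rw [h1, zero_smul, add_zero] at hu
  rw [h2, one_smul, ← hy] at hv
  exact ⟨hP.injective hu, hP.injective hv⟩

/-- The visible pair stays within the part between `x` and `y`, and the diagonal is an edge of that
part. -/
lemma not_transversal_diagonal (hP : P.IsSimple) {x y u v : Fin n} (hd : P.IsDiagonal x y)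
    (hu : btw x u y) (hv : btw x v y) (huv : P.visibilityGraph.Adj u v) {z : Plane}
    (hz : z ∈ openSegment ℝ (P u) (P v)) (hz' : z ∈ openSegment ℝ (P x) (P y)) :
    (toC (P v - P u) / toC (P x - P y)).im = 0 := by
  obtain ⟨k, f, hf⟩ := exists_arc x y
  obtain ⟨l, g, hg⟩ := exists_arc y x
  obtain ⟨i, rfl⟩ := (hf.mem_iff u).2 hu
  obtain ⟨j, rfl⟩ := (hf.mem_iff v).2 hv
  obtain ⟨e, he⟩ := (hf.mem_iff y).2 (btw_refl_right x y)
  have hsub := segment_subset_body_comp hP hd hf hg (vertex_mem_body_comp f i)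
    (vertex_mem_body_comp f j) (mutuallyVisible_iff.1 huv.2)
  have he' : f (finRotate k e) = x := by rw [hf.rotate hd.ne, if_pos he]
  have := (hP.comp hd hf).not_transversal (i := e) hsub hz (by
    rw [comp_apply, comp_apply, he, he', openSegment_symm]; exact hz')
  rwa [comp_apply, comp_apply, he, he'] at this

lemma exists_real_of_im_eq_zero {d e : Plane} (he : e ≠ 0) (h : (toC d / toC e).im = 0) :
    ∃ r : ℝ, d = r • e := by
  refine ⟨(toC d / toC e).re, toC.injective ?_⟩
  rw [map_smul, Complex.real_smul, ← div_eq_iff (toC_ne_zero.2 he)]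
  apply Complex.ext
  · simp only [Complex.ofReal_re]
  · rw [h, Complex.ofReal_im]

/-- If no chord passes through a third vertex, then an uncrossed chord is disjoint from all other
chords. -/
lemma IsUncrossedChord.disjoint (hP : P.IsSimple)
    (H : ∀ u v w : Fin n, P.IsChord u v → w ≠ u → w ≠ v → P w ∉ openSegment ℝ (P u) (P v))
    {x y u v : Fin n} (h : P.IsUncrossedChord x y) (huv : P.IsChord u v)
    (hne : s(u, v) ≠ s(x, y)) :
    Disjoint (openSegment ℝ (P u) (P v)) (openSegment ℝ (P x) (P y)) := by
  rw [disjoint_left]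
  intro z hz hz'
  have hd := h.isDiagonal hP
  -- No visibility edge joins the two open arcs, so `u` and `v` lie in one closed part, of which
  -- `xy` is an edge. Hence the two segments are parallel.
  have him : (toC (P v - P u) / toC (P y - P x)).im = 0 := by
    by_cases c1 : sbtw x u y ∧ sbtw y v x
    · exact absurd huv.1 (h.not_adj hP c1.1 c1.2)
    by_cases c2 : sbtw x v y ∧ sbtw y u x
    · exact absurd huv.1.symm (h.not_adj hP c2.1 c2.2)
    have hcase : (btw x u y ∧ btw x v y) ∨ (btw y u x ∧ btw y v x) := by
      have hxy := hd.ne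
      rw [Ne, Fin.ext_iff] at hxy
      simp only [sbtw_iff_val, btw_iff_val] at *
      omega
    rcases hcase with ⟨hu, hv⟩ | ⟨hu, hv⟩
    · have := not_transversal_diagonal hP hd hu hv huv.1 hz hz'
      rw [← neg_sub (P y), map_neg, div_neg, Complex.neg_im, neg_eq_zero] at this
      exact this
    · exact not_transversal_diagonal hP hd.symm hu hv huv.1 hz (by rwa [openSegment_symm])
  obtain ⟨r, hr⟩ := exists_real_of_im_eq_zero
    (sub_ne_zero.2 (hP.vertex_ne hd.ne.symm)) him
  rcases lt_trichotomy r 0 with h0 | h0 | h0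
  · have := eq_of_overlap hP H h.1 huv.symm (by rwa [openSegment_symm]) hz' (r := -r)
      (by linarith) (by rw [neg_smul, ← hr]; abel)
    apply hne
    rw [this.1, this.2, Sym2.eq_swap]
  · rw [h0, zero_smul, sub_eq_zero] at hr
    exact hP.vertex_ne huv.1.1 hr.symm
  · have := eq_of_overlap hP H h.1 huv hz hz' h0 hr
    apply hne
    rw [this.1, this.2]

lemma vertex_mem_openSegment_of_mem_segment
    {x y u : Fin n} (hx : P u ≠ P x) (hy : P u ≠ P y)
    (h : P u ∈ segment ℝ (P x) (P y)) : P u ∈ openSegment ℝ (P x) (P y) := by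
  rcases mem_segment_cases h with h | h | h
  · exact absurd h hx
  · exact absurd h hy
  · exact h

/-- Crossing chords share no end point, and none of them passes through an end of the other, so the
common point is interior to both. -/
lemma IsSimple.isUncrossedChord_of_disjoint (hP : P.IsSimple)
    (H : ∀ u v w : Fin n, P.IsChord u v → w ≠ u → w ≠ v → P w ∉ openSegment ℝ (P u) (P v))
    {x y : Fin n} (hxy : P.IsChord x y)
    (h : ∀ u v : Fin n, P.IsChord u v → s(u, v) ≠ s(x, y) →
      Disjoint (openSegment ℝ (P u) (P v)) (openSegment ℝ (P x) (P y))) :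
    P.IsUncrossedChord x y := by
  refine ⟨hxy, fun u v huv hc => ?_⟩
  obtain ⟨⟨z, hz1, hz2⟩, hc⟩ := hc
  have hne : u ≠ x ∧ u ≠ y ∧ v ≠ x ∧ v ≠ y := by
    rcases hc with ⟨h1, h2⟩ | ⟨h1, h2⟩
    · exact ⟨(ne_of_sbtw h1).1, (ne_of_sbtw h1).2, (ne_of_sbtw h2).2, (ne_of_sbtw h2).1⟩
    · exact ⟨(ne_of_sbtw h2).2, (ne_of_sbtw h2).1, (ne_of_sbtw h1).1, (ne_of_sbtw h1).2⟩
  obtain ⟨n1, n2, n3, n4⟩ := hne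
  have hout : ∀ a b c d, P.IsChord a b → c ≠ a → c ≠ b → d ≠ a → d ≠ b →
      z ∈ segment ℝ (P a) (P b) → z ∈ segment ℝ (P c) (P d) → z ∈ openSegment ℝ (P c) (P d) := by
    intro a b c d hab h1 h2 h3 h4 hz hz'
    rcases mem_segment_cases hz' with rfl | rfl | h
    · exact absurd (vertex_mem_openSegment_of_mem_segment (hP.vertex_ne h1) (hP.vertex_ne h2) hz)
        (H a b c hab h1 h2)
    · exact absurd (vertex_mem_openSegment_of_mem_segment (hP.vertex_ne h3) (hP.vertex_ne h4) hz)
        (H a b d hab h3 h4)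
    · exact h
  refine disjoint_left.1 (h u v huv ?_) (hout x y u v hxy n1 n2 n3 n4 hz2 hz1)
    (hout u v x y huv n1.symm n3.symm n2.symm n4.symm hz1 hz2)
  intro h
  rcases Sym2.eq_iff.1 h with ⟨h, -⟩ | ⟨h, -⟩
  · exact n1 h
  · exact n2 h

/-! ### Chords of a part of a divided polygon -/

/-- A segment inside `P` between two vertices of a part cannot leave the part, and conversely the
body of the part lies in that of `P`. -/
lemma comp_adj_iff (hP : P.IsSimple) {a b : Fin n} (hd : P.IsDiagonal a b) (hf : IsArc a b f)
    (i j : Fin k) :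
    (P.comp f).visibilityGraph.Adj i j ↔ P.visibilityGraph.Adj (f i) (f j) := by
  obtain ⟨l, g, hg⟩ := exists_arc b a
  change (i ≠ j ∧ (P.comp f).MutuallyVisible (P (f i)) (P (f j))) ↔
    (f i ≠ f j ∧ P.MutuallyVisible (P (f i)) (P (f j)))
  rw [mutuallyVisible_iff, mutuallyVisible_iff, hf.injective.ne_iff]
  refine and_congr_right fun _ => ⟨fun h => h.trans (body_comp_subset hP hd hf), fun h =>
    segment_subset_body_comp hP hd hf hg (vertex_mem_body_comp f i) (vertex_mem_body_comp f j) h⟩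

lemma comp_isChord (hP : P.IsSimple) {a b : Fin n} (hd : P.IsDiagonal a b) (hf : IsArc a b f)
    {i j : Fin k} (h : (P.comp f).IsChord i j) : P.IsChord (f i) (f j) :=
  ⟨(comp_adj_iff hP hd hf i j).1 h.1, ne_rotate_of_comp hd hf h.2.1, ne_rotate_of_comp hd hf h.2.2⟩

lemma isChord_of_comp (hP : P.IsSimple) {a b : Fin n} (hd : P.IsDiagonal a b)
    (hf : IsArc a b f) {i j : Fin k} (h : P.IsChord (f i) (f j))
    (h₁ : ¬ (f i = b ∧ f j = a)) (h₂ : ¬ (f j = b ∧ f i = a)) : (P.comp f).IsChord i j := by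
  have key : ∀ i j : Fin k, ¬ (f i = b ∧ f j = a) → f j ≠ finRotate n (f i) →
      j ≠ finRotate k i := by
    rintro i j h₁ h rfl
    rw [hf.rotate hd.ne] at h h₁
    split_ifs at h h₁ with hb
    · exact h₁ ⟨hb, rfl⟩
    · exact h rfl
  exact ⟨(comp_adj_iff hP hd hf i j).2 h.1, key i j h₁ h.2.1, key j i h₂ h.2.2⟩

lemma crosses_comp_iff (hf : StrictMono f) (u v x y : Fin k) :
    (P.comp f).Crosses u v x y ↔ P.Crosses (f u) (f v) (f x) (f y) := by
  unfold Crosses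
  rw [sbtw_map hf, sbtw_map hf, sbtw_map hf, sbtw_map hf]
  rfl

/-- The uncrossed chords of a part of a polygon divided along an uncrossed chord. -/
lemma comp_isUncrossedChord_iff (hP : P.IsSimple) {a b : Fin n} (hab : P.IsUncrossedChord a b)
    (hf : IsArc a b f) {i j : Fin k} (hij : (P.comp f).IsChord i j) :
    (P.comp f).IsUncrossedChord i j ↔ P.IsUncrossedChord (f i) (f j) := by
  have hd := hab.isDiagonal hP
  constructor
  · rintro ⟨-, h⟩
    refine ⟨comp_isChord hP hd hf hij, fun u v huv hc => ?_⟩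
    have hne := hd.ne
    rw [Ne, Fin.ext_iff] at hne
    have hi := hf.btw_apply i
    have hj := hf.btw_apply j
    -- The ends of a crossing chord are not on different sides of the uncrossed chord `ab`, so both
    -- lie in the part.
    have hpos : ∀ u v, P.visibilityGraph.Adj u v → sbtw (f i) u (f j) → sbtw (f j) v (f i) →
        btw a u b ∧ btw a v b := by
      intro u v huv h1 h2
      by_cases c1 : sbtw a u b ∧ sbtw b v a
      · exact absurd huv (hab.not_adj hP c1.1 c1.2)
      by_cases c2 : sbtw a v b ∧ sbtw b u a
      · exact absurd huv.symm (hab.not_adj hP c2.1 c2.2)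
      simp only [sbtw_iff_val, btw_iff_val] at *
      omega
    -- The crossing chord is not `ab` itself, the only chord of `P` that turns into a boundary edge
    -- of the part.
    have hend : ∀ u v, sbtw (f i) u (f j) → sbtw (f j) v (f i) → ¬ (u = b ∧ v = a) ∧
        ¬ (v = b ∧ u = a) := by
      intro u v h1 h2
      simp only [sbtw_iff_val, btw_iff_val, Fin.ext_iff] at *
      omega
    have hboth : (btw a u b ∧ btw a v b) ∧ ¬ (u = b ∧ v = a) ∧ ¬ (v = b ∧ u = a) := by
      rcases hc.2 with ⟨h1, h2⟩ | ⟨h1, h2⟩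
      · exact ⟨hpos u v huv.1 h1 h2, hend u v h1 h2⟩
      · exact ⟨(hpos v u huv.1.symm h1 h2).symm, (hend v u h1 h2).symm⟩
    obtain ⟨⟨hu, hv⟩, e1, e2⟩ := hboth
    obtain ⟨u, rfl⟩ := (hf.mem_iff u).2 hu
    obtain ⟨v, rfl⟩ := (hf.mem_iff v).2 hv
    exact h u v (isChord_of_comp hP hd hf huv e1 e2) ((crosses_comp_iff hf.strictMono _ _ _ _).2 hc)
  · rintro ⟨-, h⟩
    exact ⟨hij, fun u v huv hc => h _ _ (comp_isChord hP hd hf huv)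
      ((crosses_comp_iff hf.strictMono _ _ _ _).1 hc)⟩

end Polygon

namespace Polygon

open Set Filter Topology

variable {n k l : ℕ} {P : Polygon Plane n} {f : Fin k → Fin n} {g : Fin l → Fin k}

/-! ### Subpolygons and pieces -/

/-- The polygon on the vertices selected by `f` is simple, and it has the visibility graph and the
uncrossed chords that it inherits from `P`. -/
structure IsFaithful (P : Polygon Plane n) (f : Fin k → Fin n) : Prop where
  strictMono : StrictMono f
  isSimple : (P.comp f).IsSimple
  adj_iff : ∀ i j, (P.comp f).visibilityGraph.Adj i j ↔ P.visibilityGraph.Adj (f i) (f j)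
  isUncrossedChord_iff : ∀ i j, (P.comp f).IsChord i j →
    ((P.comp f).IsUncrossedChord i j ↔ P.IsUncrossedChord (f i) (f j))

lemma IsFaithful.comp {a b : Fin k} (h : P.IsFaithful f) (hab : (P.comp f).IsUncrossedChord a b)
    (hg : IsArc a b g) : P.IsFaithful fun i => f (g i) := by
  have hd := hab.isDiagonal h.isSimple
  refine ⟨fun i j hij => h.strictMono (hg.strictMono hij), h.isSimple.comp hd hg, fun i j => ?_,
    fun i j hij => ?_⟩
  · exact (comp_adj_iff h.isSimple hd hg i j).trans (h.adj_iff _ _)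
  · exact (comp_isUncrossedChord_iff h.isSimple hab hg hij).trans
      (h.isUncrossedChord_iff _ _ (comp_isChord h.isSimple hd hg hij))

lemma IsSimple.isFaithful_of_surjective (hP : P.IsSimple) (hf : StrictMono f)
    (hs : Function.Surjective f) : P.IsFaithful f := by
  have hk : k = n := by
    have := Fintype.card_of_bijective ⟨hf.injective, hs⟩
    simpa using this
  subst hk
  have : f = id := by
    have := Subsingleton.elim (hf.orderIsoOfSurjective f hs) (OrderIso.refl _)
    funext i
    exact congrArg (fun e : Fin k ≃o Fin k => e i) this
  subst this
  exact ⟨hf, hP, fun _ _ => Iff.rfl, fun _ _ _ => Iff.rfl⟩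

lemma mem_iff_exists_orderEmb {S : Finset (Fin n)} {w : Fin n} :
    w ∈ S ↔ ∃ i, S.orderEmbOfFin rfl i = w := by
  have : w ∈ range (S.orderEmbOfFin rfl) ↔ w ∈ (S : Set (Fin n)) := by
    rw [Finset.range_orderEmbOfFin]
  rw [← mem_range, this, Finset.mem_coe]

/-- The vertices of a part of a subpolygon, enumerated within the subpolygon. -/
lemma exists_arc_of_divide {S T : Finset (Fin n)} {a b : Fin S.card}
    (hT : ∀ w, w ∈ T ↔ w ∈ S ∧ btw (S.orderEmbOfFin rfl a) w (S.orderEmbOfFin rfl b)) :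
    ∃ g : Fin T.card → Fin S.card, IsArc a b g ∧
      ∀ i, S.orderEmbOfFin rfl (g i) = T.orderEmbOfFin rfl i := by
  have hex : ∀ i, ∃ j, S.orderEmbOfFin rfl j = T.orderEmbOfFin rfl i := fun i =>
    mem_iff_exists_orderEmb.1 ((hT _).1 (mem_iff_exists_orderEmb.2 ⟨i, rfl⟩)).1
  choose g hg using hex
  refine ⟨g, ⟨fun i j hij => ?_, fun w => ?_⟩, hg⟩
  · rw [← (S.orderEmbOfFin rfl).lt_iff_lt, hg, hg]
    exact (T.orderEmbOfFin rfl).strictMono hij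
  · rw [← btw_map (S.orderEmbOfFin rfl).strictMono]
    have h1 := hT (S.orderEmbOfFin rfl w)
    rw [mem_iff_exists_orderEmb] at h1
    constructor
    · rintro ⟨i, rfl⟩
      exact (h1.1 ⟨i, (hg i).symm⟩).2
    · intro h
      obtain ⟨i, hi⟩ := h1.2 ⟨mem_iff_exists_orderEmb.2 ⟨w, rfl⟩, h⟩
      exact ⟨i, (S.orderEmbOfFin rfl).injective ((hg i).trans hi)⟩

/-- Each division uses an uncrossed chord of the current subpolygon; the induction identifies these
chords with uncrossed chords of `P`. -/
lemma IsSubpolygon.isFaithful (hP : P.IsSimple) {S : Finset (Fin n)} (hS : P.IsSubpolygon S) :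
    P.IsFaithful (S.orderEmbOfFin rfl) := by
  induction hS with
  | whole =>
    exact hP.isFaithful_of_surjective (Finset.orderEmbOfFin _ _).strictMono fun w =>
      mem_iff_exists_orderEmb.1 (Finset.mem_univ w)
  | divide S T a b _ hab hT ih =>
    obtain ⟨g, hg, hfg⟩ := exists_arc_of_divide hT
    have := ih.comp hab hg
    rwa [show (fun i => S.orderEmbOfFin rfl (g i)) = T.orderEmbOfFin rfl from funext hfg] at this

/-- The component left by the removal of two vertices of a cyclic sequence without an edge
between its two open arcs. -/
lemma image_supp_eq_arc {V : Type*} {G : SimpleGraph V} {f : Fin k → V} {a b : Fin k}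
    (hf : Function.Injective f) (hadj : ∀ i, G.Adj (f i) (f (finRotate k i))) (hab : a ≠ b)
    (hno : ∀ u v, sbtw a u b → sbtw b v a → ¬ G.Adj (f u) (f v)) {U : Set V}
    (hU : U = range f \ {f a, f b}) (C : (G.induce U).ConnectedComponent) {z : U}
    (hz : z ∈ C.supp) (hza : ∃ i, sbtw a i b ∧ f i = z) :
    Subtype.val '' C.supp = f '' {i | sbtw a i b} := by
  subst hU
  rw [SimpleGraph.ConnectedComponent.mem_supp_iff] at hz
  subst hz
  ext y
  constructor
  · rintro ⟨y, hy, rfl⟩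
    have hy := SimpleGraph.ConnectedComponent.exact
      ((SimpleGraph.ConnectedComponent.mem_supp_iff _ _).1 hy)
    exact sbtw_of_reachable hab hno hy.symm hza
  · rintro ⟨j, hj, rfl⟩
    obtain ⟨i, hi, hiz⟩ := hza
    refine ⟨⟨f j, mem_range_diff_of_sbtw hf hj⟩, ?_, rfl⟩
    rw [SimpleGraph.ConnectedComponent.mem_supp_iff]
    apply SimpleGraph.ConnectedComponent.sound
    have := reachable_of_arc hadj (fun i hi => mem_range_diff_of_sbtw hf hi) hj hi
    rwa [show (⟨f i, mem_range_diff_of_sbtw hf hi⟩ : ↥(range f \ {f a, f b})) = z from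
      Subtype.ext hiz] at this

/-! ### Reduced subpolygons and bottleneck pairs -/

namespace IsFaithful

lemma injective (h : P.IsFaithful f) : Function.Injective f := h.strictMono.injective

lemma adj_rotate (h : P.IsFaithful f) (i : Fin k) :
    P.visibilityGraph.Adj (f i) (f (finRotate k i)) :=
  (h.adj_iff _ _).1 (Polygon.adj_rotate h.isSimple i)

lemma not_adj (h : P.IsFaithful f) {a b : Fin k} (hab : (P.comp f).IsUncrossedChord a b)
    (u v : Fin k) (hu : sbtw a u b) (hv : sbtw b v a) :
    ¬ P.visibilityGraph.Adj (f u) (f v) := fun huv =>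
  hab.not_adj h.isSimple hu hv ((h.adj_iff _ _).2 huv)

lemma isUncrossedChord_of_adj (h : P.IsFaithful f) {a b : Fin k}
    (hab : P.IsUncrossedChord (f a) (f b)) (h₁ : b ≠ finRotate k a) (h₂ : a ≠ finRotate k b) :
    (P.comp f).IsUncrossedChord a b :=
  (h.isUncrossedChord_iff a b ⟨(h.adj_iff _ _).2 hab.1.1, h₁, h₂⟩).2 hab

/-- A subpolygon is reduced iff no bottleneck pair disconnects its vertices. -/
lemma isReduced_iff (hP : P.IsSimple) (h : P.IsFaithful f) :
    (P.comp f).IsReduced ↔ ∀ x y, P.visibilityGraph.IsBottleneckPair x y → x ∈ range f →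
      y ∈ range f → (P.visibilityGraph.induce (range f \ {x, y})).Preconnected := by
  constructor
  · rintro hred x y hxy ⟨a, rfl⟩ ⟨b, rfl⟩
    have hab : a ≠ b := fun h => hxy.1.1 (congrArg f h)
    -- A bottleneck pair of the whole graph may be consecutive in the subpolygon. Then its removal
    -- leaves a single arc, which is connected.
    by_cases h1 : b = finRotate k a
    · exact preconnected_of_link h.injective h.adj_rotate hab (Or.inl h1)
    by_cases h2 : a = finRotate k b
    · exact preconnected_of_link h.injective h.adj_rotate hab (Or.inr (Or.inl h2))
    have hunc := h.isUncrossedChord_of_adj ((hP.isBottleneckPair_iff _ _).1 hxy) h1 h2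
    obtain ⟨u, v, huv, hc⟩ := hred a b hunc.1
    exact absurd hc (hunc.2 u v huv)
  · intro hpre a b hab
    by_contra hcon
    push Not at hcon
    have hunc : (P.comp f).IsUncrossedChord a b := ⟨hab, hcon⟩
    exact not_preconnected_of_separated h.injective hab.1.1 hab.2.1 hab.2.2 (h.not_adj hunc)
      (hpre _ _ ((hP.isBottleneckPair_iff _ _).2 ((h.isUncrossedChord_iff a b hab).1 hunc))
        ⟨a, rfl⟩ ⟨b, rfl⟩)

end IsFaithful

lemma coe_divide_eq {S T : Finset (Fin n)} {a b : Fin S.card} (hab : a ≠ b)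
    (hT : ∀ w, w ∈ T ↔ w ∈ S ∧ btw (S.orderEmbOfFin rfl a) w (S.orderEmbOfFin rfl b)) :
    (T : Set (Fin n)) = S.orderEmbOfFin rfl '' {i | sbtw a i b} ∪
      {S.orderEmbOfFin rfl a, S.orderEmbOfFin rfl b} := by
  obtain ⟨g, hg, hfg⟩ := exists_arc_of_divide hT
  ext w
  rw [Finset.mem_coe, mem_iff_exists_orderEmb]
  constructor
  · rintro ⟨i, rfl⟩
    rw [← hfg i]
    by_cases h1 : g i = a
    · exact Or.inr (Or.inl (by rw [h1]))
    by_cases h2 : g i = b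
    · exact Or.inr (Or.inr (by rw [h2, mem_singleton_iff]))
    refine Or.inl ⟨g i, ?_, rfl⟩
    have := hg.btw_apply i
    rw [mem_ofPred_eq]
    rw [Fin.ext_iff] at h1 h2
    rw [Ne, Fin.ext_iff] at hab
    rw [btw_iff_val] at this
    rw [sbtw_iff_val]
    omega
  · have key : ∀ i, btw a i b → ∃ j, T.orderEmbOfFin rfl j = S.orderEmbOfFin rfl i := by
      intro i hi
      obtain ⟨j, rfl⟩ := (hg.mem_iff i).2 hi
      exact ⟨j, (hfg j).symm⟩
    rintro (⟨i, hi, rfl⟩ | rfl | h)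
    · exact key i (SBtw.sbtw.btw hi)
    · exact key a (btw_refl_left a b)
    · rw [mem_singleton_iff.1 h]; exact key b (btw_refl_right a b)

lemma range_orderEmb (S : Finset (Fin n)) : range (S.orderEmbOfFin rfl) = (S : Set (Fin n)) :=
  Finset.range_orderEmbOfFin _ _

lemma IsSubpolygon.isPiece (hP : P.IsSimple) {S : Finset (Fin n)} (hS : P.IsSubpolygon S) :
    P.visibilityGraph.IsPiece (S : Set (Fin n)) := by
  induction hS with
  | whole => rw [Finset.coe_univ]; exact SimpleGraph.IsPiece.whole
  | divide S T a b hS hab hT ih =>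
    have hF := hS.isFaithful hP
    set f := S.orderEmbOfFin rfl with hf
    have hbot : P.visibilityGraph.IsBottleneckPair (f a) (f b) :=
      (hP.isBottleneckPair_iff _ _).2 ((hF.isUncrossedChord_iff a b hab.1).1 hab)
    have hs : sbtw a (finRotate S.card a) b := by
      have h1 := hab.1.2.1
      have h2 := hab.1.1.1
      have := a.2
      have := b.2
      rw [Ne, Fin.ext_iff] at h1 h2
      rw [finRotate_val] at h1
      rw [sbtw_iff_val, finRotate_val]
      split_ifs at * <;> omega
    have hU : (S : Set (Fin n)) \ {f a, f b} = range f \ {f a, f b} := by rw [range_orderEmb]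
    -- The successor of `a` represents the component formed by the open arc from `a` to `b`.
    set z : ↥((S : Set (Fin n)) \ {f a, f b}) := ⟨f (finRotate S.card a), by
      rw [hU]; exact mem_range_diff_of_sbtw hF.injective hs⟩ with hz
    set C := (P.visibilityGraph.induce ((S : Set (Fin n)) \ {f a, f b})).connectedComponentMk z
    have hC := image_supp_eq_arc hF.injective hF.adj_rotate hab.1.1.1 (hF.not_adj hab) hU C
      (z := z) rfl ⟨_, hs, rfl⟩
    rw [coe_divide_eq hab.1.1.1 hT, ← hC]
    exact SimpleGraph.IsPiece.cut _ _ _ C ih hbot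
      (mem_iff_exists_orderEmb.2 ⟨a, rfl⟩) (mem_iff_exists_orderEmb.2 ⟨b, rfl⟩)

lemma exists_subpolygon_of_isPiece (hP : P.IsSimple) {U : Set (Fin n)}
    (hU : P.visibilityGraph.IsPiece U) :
    ∃ S : Finset (Fin n), P.IsSubpolygon S ∧ (S : Set (Fin n)) = U := by
  classical
  induction hU with
  | whole => exact ⟨_, IsSubpolygon.whole, Finset.coe_univ⟩
  | cut U x y C _ hxy hx hy ih =>
    obtain ⟨S, hS, rfl⟩ := ih
    obtain ⟨f, hf⟩ : ∃ f, f = S.orderEmbOfFin rfl := ⟨_, rfl⟩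
    have hF : P.IsFaithful f := hf ▸ hS.isFaithful hP
    obtain ⟨a, rfl⟩ : ∃ a, f a = x := hf ▸ mem_iff_exists_orderEmb.1 hx
    obtain ⟨b, rfl⟩ : ∃ b, f b = y := hf ▸ mem_iff_exists_orderEmb.1 hy
    have hrange : range f = (S : Set (Fin n)) := hf ▸ range_orderEmb S
    have hab : a ≠ b := fun h => hxy.1.1 (congrArg f h)
    have hU : (S : Set (Fin n)) \ {f a, f b} = range f \ {f a, f b} := by rw [hrange]
    -- A pair that is consecutive in the current subpolygon leaves a connected rest, so this cut
    -- returns the same piece and no division corresponds to it.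
    by_cases hadj : b = finRotate S.card a ∨ a = finRotate S.card b
    · refine ⟨S, hS, ?_⟩
      have hpre : (P.visibilityGraph.induce ((S : Set (Fin n)) \ {f a, f b})).Preconnected := by
        rw [hU]
        exact preconnected_of_link hF.injective hF.adj_rotate hab
          (hadj.imp_right fun h => Or.inl h)
      have hsupp : C.supp = univ := by
        obtain ⟨z, rfl⟩ := C.exists_rep
        rw [eq_univ_iff_forall]
        intro y
        exact SimpleGraph.ConnectedComponent.sound (hpre y z)
      rw [hsupp, image_univ, Subtype.range_coe, sdiff_union_of_subset]
      rintro w (rfl | h)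
      · exact hx
      · rw [mem_singleton_iff.1 h]; exact hy
    · rw [not_or] at hadj
      have hunc := hF.isUncrossedChord_of_adj ((hP.isBottleneckPair_iff _ _).1 hxy) hadj.1 hadj.2
      have step : ∀ a b : Fin S.card, (P.comp f).IsUncrossedChord a b →
          ∀ V : Set (Fin n), V = f '' {i | sbtw a i b} ∪ {f a, f b} →
          ∃ T : Finset (Fin n), P.IsSubpolygon T ∧ (T : Set (Fin n)) = V := by
        rintro a b hunc V rfl
        have hT : ∀ w, w ∈ S.filter (fun w => btw (f a) w (f b)) ↔ w ∈ S ∧ btw (f a) w (f b) :=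
          fun w => Finset.mem_filter
        exact ⟨_, hS.divide _ _ a b (by rw [hf] at hunc; exact hunc) (hf ▸ hT), by rw [coe_divide_eq hunc.1.1.1 (hf ▸ hT), hf]⟩
      -- Any vertex of `C` tells which of the two open arcs `C` is; the second case exchanges `a`
      -- and `b`.
      obtain ⟨z, hz⟩ := C.nonempty_supp
      obtain ⟨i, hi⟩ : ∃ i, f i = z := hrange.ge z.2.1
      rcases sbtw_or_sbtw hab (i := i) (fun h => z.2.2 (by simp [← hi, h]))
        (fun h => z.2.2 (by simp [← hi, h])) with h | h
      · refine step a b hunc _ ?_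
        rw [image_supp_eq_arc hF.injective hF.adj_rotate hab (hF.not_adj hunc) hU C hz
          ⟨i, h, hi⟩]
      · refine step b a hunc.symm _ ?_
        rw [image_supp_eq_arc hF.injective hF.adj_rotate hab.symm (hF.not_adj hunc.symm)
          (by rw [hU, pair_comm]) C hz ⟨i, h, hi⟩, pair_comm]

lemma isReduced_sub_iff (hP : P.IsSimple) {S : Finset (Fin n)} (hS : P.IsSubpolygon S) :
    (P.sub S).IsReduced ↔ ∀ x y, P.visibilityGraph.IsBottleneckPair x y →
      x ∈ (S : Set (Fin n)) → y ∈ (S : Set (Fin n)) →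
        (P.visibilityGraph.induce ((S : Set (Fin n)) \ {x, y})).Preconnected := by
  have := (hS.isFaithful hP).isReduced_iff hP
  rw [range_orderEmb] at this
  exact this

lemma isVisibilityGraphOfSub_induce (hP : P.IsSimple) {S : Finset (Fin n)}
    (hS : P.IsSubpolygon S) :
    P.IsVisibilityGraphOfSub S ((⊤ : P.visibilityGraph.Subgraph).induce (S : Set (Fin n))) := by
  refine ⟨rfl, fun a b => ?_⟩
  have h := (hS.isFaithful hP).adj_iff a b
  refine Iff.trans ?_ h.symm
  rw [SimpleGraph.Subgraph.induce_adj, SimpleGraph.Subgraph.top_adj]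
  exact ⟨fun h => h.2.2, fun h => ⟨mem_iff_exists_orderEmb.2 ⟨a, rfl⟩,
    mem_iff_exists_orderEmb.2 ⟨b, rfl⟩, h⟩⟩

end Polygon

/-! ### The theorem -/

theorem lemma3 {n : ℕ} (P : Polygon Plane n) (hP : P.IsSimple) :
    -- bottleneck pairs are exactly the chords that no chord crosses
    (∀ x y : Fin n, P.visibilityGraph.IsBottleneckPair x y ↔ P.IsUncrossedChord x y) ∧
    -- if no chord passes through a third vertex, crossing just means that the open segments meet
    ((∀ u v w : Fin n, P.IsChord u v → w ≠ u → w ≠ v → P w ∉ openSegment ℝ (P u) (P v)) →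
      ∀ x y : Fin n, P.visibilityGraph.IsBottleneckPair x y ↔
        P.IsChord x y ∧ ∀ u v : Fin n, P.IsChord u v → s(u, v) ≠ s(x, y) →
          Disjoint (openSegment ℝ (P u) (P v)) (openSegment ℝ (P x) (P y))) ∧
    -- the reduced subpolygons are simple polygons
    (∀ S : Finset (Fin n), P.IsReducedSubpolygon S → (P.sub S).IsSimple) ∧
    -- each reduced subgraph is the visibility graph of a reduced subpolygon
    (∀ H : P.visibilityGraph.Subgraph, P.visibilityGraph.IsReducedSubgraph H →
      ∃ S : Finset (Fin n), P.IsReducedSubpolygon S ∧ P.IsVisibilityGraphOfSub S H) ∧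
    -- each reduced subpolygon has a reduced subgraph as its visibility graph
    (∀ S : Finset (Fin n), P.IsReducedSubpolygon S →
      ∃ H : P.visibilityGraph.Subgraph,
        P.visibilityGraph.IsReducedSubgraph H ∧ P.IsVisibilityGraphOfSub S H) := by
  refine ⟨hP.isBottleneckPair_iff, fun H x y => ?_, fun S hS => (hS.1.isFaithful hP).isSimple,
    ?_, fun S hS => ?_⟩
  · rw [hP.isBottleneckPair_iff]
    exact ⟨fun h => ⟨h.1, fun u v huv hne => h.disjoint hP H huv hne⟩,
      fun h => hP.isUncrossedChord_of_disjoint H h.1 h.2⟩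
  · rintro _ ⟨U, hU, hpre, rfl⟩
    obtain ⟨S, hS, rfl⟩ := Polygon.exists_subpolygon_of_isPiece hP hU
    exact ⟨S, ⟨hS, (Polygon.isReduced_sub_iff hP hS).2 hpre⟩,
      Polygon.isVisibilityGraphOfSub_induce hP hS⟩
  · exact ⟨_, ⟨S, hS.1.isPiece hP, (Polygon.isReduced_sub_iff hP hS.1).1 hS.2, rfl⟩,
      Polygon.isVisibilityGraphOfSub_induce hP hS.1⟩
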